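/- Write $L^2=L^2(\mathbb R^n)$ (real valued). Let $\mathcal W:L^2\to[0,\infty]$ be weakly lower semicontinuous, and suppose that its domain $\mathrm W=\{v\in L^2:\mathcal W(v)<\infty\}$ is a Banach space with dense continuous embeddings $C_0^\infty(\mathbb R^n)\hookrightarrow \mathrm W\hookrightarrow L^2$, on which $\mathcal W$ is Gâteaux differentiable with $\|\nabla\mathcal W(v)\|_{\mathrm W'}\le C(1+\mathcal W(v)^\theta)$ for all $v\in\mathrm W$, for some $C\ge0$ and $\theta\in(0,1)$. Let $w_0,w_1\in\mathrm W$ and $f\in L^2_{\rm loc}([0,\infty);L^2)$, and put $\gamma(t)=\int_0^t\|f(s)\|_{L^2}^2\,ds$. For measurable $h:[0,\infty)\to[0,\infty]$ let $\mathcal A h(t)=\int_t^\infty e^{-(s-t)}h(s)\,ds$ and $\mathcal A^2h=\mathcal A(\mathcal Ah)$. For $\varepsilon\in(0,1)$ let $t_\varepsilon>0$ with $\lim_{\varepsilon\downarrow0}t_\varepsilon=0$, and let $\phi=\phi_\varepsilon:[0,\infty)\to L^2$ be measurable and satisfy 1. $\phi(t)=0$ for a.e. $t>T^*$, for some $T^*=T^*_\varepsilon$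 with $\varepsilon^2T^*\le\sqrt\varepsilon$; 2. $\int_0^\infty e^{-t}\|\phi(t)\|_{L^2}^2\,dt\le\varepsilon^2$; 3. $\varepsilon\int_0^t\mathcal A^2\|\phi(\cdot)\|_{L^2}^2(s)\,ds\le\gamma(\varepsilon t+t_\varepsilon)+\varepsilon^2$ for all $t\ge0$. For every $\varepsilon\in(0,1)$ let $u_\varepsilon$ be a minimizer of $$J_\varepsilon(u)=\int_0^\infty e^{-t}\Big(\frac1{2\varepsilon^2}\|u''(t)\|_{L^2}^2+\mathcal W(u(t))\Big)dt-\int_0^\infty e^{-t}\,(\phi_\varepsilon(t),u(t))_{L^2}\,dt$$ among all $u\in H^2_{\rm loc}([0,\infty);L^2)$ with $u(0)=w_0$ and $u'(0)=\varepsilon w_1$, and define its approximate energy $$E_\varepsilon(t)=\frac1{2\varepsilon^2}\|u_\varepsilon'(t)\|_{L^2}^2+\int_t^\infty e^{-(s-t)}(s-t)\,\mathcal W(u_\varepsilon(s))\,ds,\qquad t\ge0 .$$ Then $E_\varepsilon(t)<\infty$ for all $\varepsilon\in(0,1)$ and $t\ge0$, and for every $\beta>1$ there is a constant $C_\beta>0$,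 depending only on $\beta$, such that for all $T\ge0$ and all $\varepsilon\in(0,1)$ $$\sqrt{E_\varepsilon(T/\varepsilon)}\le\sqrt{E_\varepsilon(0)}+\Big(\sqrt{\varepsilon C_\beta}+\sqrt{T\beta/2}\Big)\sqrt{\gamma(T+t_\varepsilon)+\varepsilon^2}.$$ In particular, for every $T\ge0$ there is a constant $C_T$, independent of $\varepsilon$, such that $E_\varepsilon(t/\varepsilon)\le C_T$ for all $\varepsilon\in(0,1)$ and all $t\in[0,T]$. -/

import Mathlib

open MeasureTheory Set Filter Topology
open scoped ENNReal ContDiff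

/-- The real Hilbert space `L²(ℝⁿ)`. -/
abbrev L2 (n : ℕ) : Type :=
  Lp ℝ 2 (volume : Measure (EuclideanSpace ℝ (Fin n)))

/-- `g` is a smooth, compactly supported real function on `ℝⁿ`. -/
def IsTest {n : ℕ} (g : EuclideanSpace ℝ (Fin n) → ℝ) : Prop :=
  ContDiff ℝ ∞ g ∧ HasCompactSupport g

/-- The finiteness domain of the functional `W`, a subset of `L²`. -/
def dom {n : ℕ} (W : L2 n → ℝ≥0∞) : Set (L2 n) := {v | W v < ⊤}

/-- `(V, ι)` is a Banach space structure on the domain of `W`, with dense embeddings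
`C₀^∞ ↪ dom W ↪ L²`, for which `W` is Gateaux differentiable with derivative growing at most like
`1 + W ^ θ`, `0 < θ < 1`. The points of `V` are the points of `dom W`, through `ι`.
(Continuity of `C₀^∞ ↪ V` is not listed: it is automatic, by the closed graph theorem.) -/
structure IsDomainSpace {n : ℕ} (W : L2 n → ℝ≥0∞) (V : Type) [NormedAddCommGroup V]
    [NormedSpace ℝ V] (ι : V →L[ℝ] L2 n) : Prop where
  complete : CompleteSpace V
  injective : Function.Injective ι
  range_eq : range ι = dom W
  denseRange : DenseRange ι
  test_mem : ∀ g : EuclideanSpace ℝ (Fin n) → ℝ, IsTest g → ∃ v : V, ι v =ᵐ[volume] g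
  test_dense : Dense {v : V | ∃ g : EuclideanSpace ℝ (Fin n) → ℝ, IsTest g ∧ ι v =ᵐ[volume] g}
  gateaux : ∃ (DW : V → (V →L[ℝ] ℝ)) (C θ : ℝ), 0 ≤ C ∧ 0 < θ ∧ θ < 1 ∧
    (∀ v h : V, HasLineDerivAt ℝ (fun z : V => (W (ι z)).toReal) (DW v h) v h) ∧
    (∀ v : V, ‖DW v‖ ≤ C * (1 + (W (ι v)).toReal ^ θ))

/-- The standing assumption on the functional `W : L² → [0,∞]`: weak lower semicontinuity, and a
Banach space structure on its domain as in `IsDomainSpace`. -/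
def AdmissibleFunctional {n : ℕ} (W : L2 n → ℝ≥0∞) : Prop :=
  LowerSemicontinuous
      (fun v : WeakSpace ℝ (L2 n) => W ((toWeakSpace ℝ (L2 n)).symm v)) ∧
    ∃ (V : Type) (_ : NormedAddCommGroup V) (_ : NormedSpace ℝ V) (ι : V →L[ℝ] L2 n),
      IsDomainSpace W V ι

/-- `h ∈ L²_loc([0,∞); H)`. -/
def IsL2loc {H : Type} [NormedAddCommGroup H] (h : ℝ → H) : Prop :=
  ∀ T : ℝ, 0 < T → MemLp h 2 (volume.restrict (Ioc 0 T))

/-- An element of `H²_loc([0,∞); H)`, given by its `C¹` representative `u`, its derivative `u'`,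
which is locally absolutely continuous, and its second derivative `u'' ∈ L²_loc([0,∞); H)`.
Only the values at times `t ≥ 0` matter. -/
structure H2loc (H : Type) [NormedAddCommGroup H] [NormedSpace ℝ H] where
  /-- the function -/
  u : ℝ → H
  /-- its first time derivative -/
  u' : ℝ → H
  /-- its second time derivative -/
  u'' : ℝ → H
  memL2loc : IsL2loc u''
  u'_eq : ∀ t : ℝ, 0 ≤ t → u' t = u' 0 + ∫ s in (0 : ℝ)..t, u'' s
  u_eq : ∀ t : ℝ, 0 ≤ t → u t = u 0 + ∫ s in (0 : ℝ)..t, u' s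

/-- The average operator `𝒜 h (t) = ∫_t^∞ e^{-(s-t)} h(s) ds`. -/
noncomputable def avg (h : ℝ → ℝ≥0∞) (t : ℝ) : ℝ≥0∞ :=
  ∫⁻ s in Ioi t, ENNReal.ofReal (Real.exp (-(s - t))) * h s

/-- `‖v‖_𝓛² = ∫_0^∞ ∫ e^{-t} |v(t,x)|² dx dt ∈ [0,∞]`. -/
noncomputable def weightedNormSq {n : ℕ} (v : ℝ → L2 n) : ℝ≥0∞ :=
  ∫⁻ t in Ioi (0 : ℝ), ENNReal.ofReal (Real.exp (-t)) * ENNReal.ofReal (‖v t‖ ^ 2)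

/-- `γ(t) = ∫_0^t ‖f(s)‖² ds`. -/
noncomputable def gam {n : ℕ} (f : ℝ → L2 n) (t : ℝ) : ℝ :=
  ∫ s in (0 : ℝ)..t, ‖f s‖ ^ 2

/-- `H_ε(u) = ∫_0^∞ e^{-t} ( ‖u''(t)‖² / (2ε²) + W(u(t)) ) dt ∈ [0,∞]`. -/
noncomputable def Hfun {n : ℕ} (W : L2 n → ℝ≥0∞) (ε : ℝ) (u : H2loc (L2 n)) : ℝ≥0∞ :=
  ∫⁻ t in Ioi (0 : ℝ), ENNReal.ofReal (Real.exp (-t)) *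
    (ENNReal.ofReal (1 / (2 * ε ^ 2) * ‖u.u'' t‖ ^ 2) + W (u.u t))

/-- `S(u) = ∫_0^∞ e^{-t} (φ(t), u(t))_{L²} dt`. -/
noncomputable def Sfun {n : ℕ} (φ : ℝ → L2 n) (u : H2loc (L2 n)) : ℝ :=
  ∫ t in Ioi (0 : ℝ), Real.exp (-t) * inner ℝ (φ t) (u.u t)

/-- `J_ε(u) = H_ε(u) - S(u) ∈ (-∞,∞]`. -/
noncomputable def Jfun {n : ℕ} (W : L2 n → ℝ≥0∞) (φ : ℝ → L2 n) (ε : ℝ) (u : H2loc (L2 n)) :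
    EReal :=
  (Hfun W ε u : EReal) - (Sfun φ u : EReal)

/-- The boundary conditions `u(0) = w₀`, `u'(0) = ε w₁`. -/
def BoundaryCond {n : ℕ} (w₀ w₁ : L2 n) (ε : ℝ) (u : H2loc (L2 n)) : Prop :=
  u.u 0 = w₀ ∧ u.u' 0 = ε • w₁

/-- `u` minimizes `J_ε` among the functions in `H²_loc([0,∞); L²)` satisfying the boundary
conditions. -/
def IsMinimizer {n : ℕ} (W : L2 n → ℝ≥0∞) (φ : ℝ → L2 n) (w₀ w₁ : L2 n) (ε : ℝ)
    (u : H2loc (L2 n)) : Prop :=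
  BoundaryCond w₀ w₁ ε u ∧
    ∀ v : H2loc (L2 n), BoundaryCond w₀ w₁ ε v → Jfun W φ ε u ≤ Jfun W φ ε v

/-- The assumptions, for fixed `ε`, on the rescaled source `φ`; `f` is the forcing term and `τ` is
the time shift `t_ε`. -/
structure SourceCond {n : ℕ} (f : ℝ → L2 n) (τ ε : ℝ) (φ : ℝ → L2 n) : Prop where
  meas : AEStronglyMeasurable φ (volume.restrict (Ioi 0))
  supp : ∃ Tstar : ℝ, ε ^ 2 * Tstar ≤ √ε ∧ ∀ᵐ t : ℝ, 0 ≤ t → Tstar < t → φ t = 0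
  norm_le : weightedNormSq φ ≤ ENNReal.ofReal (ε ^ 2)
  avg_le : ∀ t : ℝ, 0 ≤ t →
    ENNReal.ofReal ε * ∫⁻ s in Ioc 0 t, avg (avg fun r => ENNReal.ofReal (‖φ r‖ ^ 2)) s
      ≤ ENNReal.ofReal (gam f (ε * t + τ) + ε ^ 2)

/-- The approximate energy
`E_ε(t) = ‖u'(t)‖² / (2ε²) + ∫_t^∞ e^{-(s-t)} (s-t) W(u(s)) ds`, a priori in `[0,∞]`. -/
noncomputable def approxEnergy {n : ℕ} (W : L2 n → ℝ≥0∞) (ε : ℝ) (u : H2loc (L2 n)) (t : ℝ) :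
    ℝ≥0∞ :=
  ENNReal.ofReal (1 / (2 * ε ^ 2) * ‖u.u' t‖ ^ 2) +
    ∫⁻ s in Ioi t, ENNReal.ofReal (Real.exp (-(s - t)) * (s - t)) * W (u.u s)

/-! The minimizer is compared with itself run on a slightly delayed clock. Write a, w, K for
`accel`, `potential`, `kinetic`, and g for `profile T`, the weight with ∫_0^T 𝒜²h dt = ∫ g(s) e^{-s}
h(s) ds. For δ in (0,1) put v(e(s)) = u(s), where e(s) = s + δ g(s). Since g and g' vanish at 0, v
has the boundary values of u. After the change of variables 𝒲 is still evaluated at u(s), so this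
variation never differentiates 𝒲. Dividing J(u) ≤ J(v) by δ and letting δ ↓ 0 gives
`inner_variation_inequality`: ∫ g e^{-s}(a + w) + K(T) ≤ K(0) + ∫ g' e^{-s}(w - 3a) + ∫ e^{-s} g (φ,
u'). The kinetic terms appear because e^{-s} g''(s) is the indicator of s < T, so the cross term
(u', u'') integrates exactly. As g - g' + s = e^T (s - T)⁺, the w-terms assemble into E(T) and E(0),
and E(T) ≤ E(0) - ∫ e^{-s}(g + 3g') a + ∫ e^{-s} g (φ, u').

The source term is ∫_0^T 𝒜²(φ, u')(t) dt. Inside the average, u'(s) is split as u'(t) + (u'(s) -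
u'(t)). The first part contributes ∫_0^T ‖u'‖ 𝒜²‖φ‖. The second is treated by Young's inequality and
a Hardy inequality with exponential weight (`H2loc.lintegral_avg_two_sub_le`): it costs 2ε² ∫_0^T
𝒜²‖φ‖² plus ∫ e^{-s}(g + 2g') a, which the dissipation absorbs. Since ‖u'‖ = √2 ε √K ≤ √2 ε √E, a
Gronwall inequality for √E, the Cauchy-Schwarz inequality and the rescaling T ↦ T/ε finish the
estimate, with C_β = 2 for every β and with T/2 in place of Tβ/2.

Two a priori facts support this. The value of the functional at u is bounded uniformly in ε
(`IsMinimizer.toReal_Hfun_le`), by comparison with the affine competitor w₀ + εt w₁, along which the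
sublinear bound on ∇𝒲 limits the growth of 𝒲. The integrability of g e^{-s}(a + w) is not known
beforehand and comes out of Fatou's lemma in the limit δ ↓ 0; with T = 1 it gives the finiteness of
E, and the inequality at T = 1 also bounds E(0) uniformly in ε. -/

/-! ### Absolutely continuous functions with values in a normed space -/

namespace AbsolutelyContinuousOnInterval

/-- The sums in the definition of absolute continuity are compared term by term. This one criterion
yields the absolute continuity of primitives, of u', of ‖u'‖², of the inverse Jacobian and of the
square root in the Gronwall argument. -/
theorem of_dist_le {X Y : Type*} [PseudoMetricSpace X] [PseudoMetricSpace Y]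
    {f : ℝ → X} {g : ℝ → Y} {a b C : ℝ} (hg : AbsolutelyContinuousOnInterval g a b)
    (h : ∀ x ∈ uIcc a b, ∀ y ∈ uIcc a b, dist (f x) (f y) ≤ C * dist (g x) (g y)) :
    AbsolutelyContinuousOnInterval f a b := by
  unfold AbsolutelyContinuousOnInterval at hg ⊢
  have hC := hg.const_mul C
  rw [mul_zero] at hC
  refine squeeze_zero' (Eventually.of_forall fun _ => Finset.sum_nonneg fun _ _ => dist_nonneg)
    ?_ hC
  have : ∀ᶠ E in totalLengthFilter ⊓ 𝓟 (disjWithin a b), E ∈ disjWithin a b :=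
    eventually_inf_principal.2 (Eventually.of_forall fun _ h => h)
  filter_upwards [this] with E hE
  rw [Finset.mul_sum]
  refine Finset.sum_le_sum fun i hi => ?_
  have := hE.1 i hi
  exact h _ this.1 _ this.2

theorem primitive {E : Type*} [NormedAddCommGroup E] [NormedSpace ℝ E]
    {α : ℝ → E} {a b : ℝ} (h : IntervalIntegrable α volume a b) :
    AbsolutelyContinuousOnInterval (fun t => ∫ s in a..t, α s) a b := by
  have h' : IntervalIntegrable (fun s => ‖α s‖) volume a b := h.norm
  refine of_dist_le (C := 1)
    (h'.absolutelyContinuousOnInterval_intervalIntegral (c := a) left_mem_uIcc) ?_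
  intro x hx y hy
  have hax : IntervalIntegrable α volume a x := h.mono_set (uIcc_subset_uIcc_left hx)
  have hay : IntervalIntegrable α volume a y := h.mono_set (uIcc_subset_uIcc_left hy)
  rw [one_mul, dist_eq_norm, Real.dist_eq, intervalIntegral.integral_interval_sub_left hax hay,
    intervalIntegral.integral_interval_sub_left hax.norm hay.norm]
  exact intervalIntegral.norm_integral_le_abs_integral_norm

/-- In a general Banach space absolute continuity does not imply differentiability almost
everywhere, so the derivative is a hypothesis. Subtracting the primitive of f' leaves an absolutely
continuous function with zero derivative almost everywhere, hence a constant. -/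
theorem integral_eq_sub {E : Type*} [NormedAddCommGroup E] [NormedSpace ℝ E] [CompleteSpace E]
    {f f' : ℝ → E} {a b : ℝ} (hf : AbsolutelyContinuousOnInterval f a b)
    (hd : ∀ᵐ x, x ∈ uIcc a b → HasDerivAt f (f' x) x)
    (hi : IntervalIntegrable f' volume a b) : ∫ x in a..b, f' x = f b - f a := by
  have hg : AbsolutelyContinuousOnInterval (fun t => f t - ∫ s in a..t, f' s) a b :=
    hf.fun_sub (primitive hi)
  obtain ⟨C, hC⟩ := hg.const_of_ae_hasDerivAt_zero (by
    filter_upwards [hd, hi.ae_hasDerivAt_integral] with x h1 h2 hx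
    simpa using (h1 hx).fun_sub (h2 hx a left_mem_uIcc))
  have ha := hC a left_mem_uIcc
  have hb := hC b right_mem_uIcc
  simp only [intervalIntegral.integral_same, sub_zero] at ha
  rw [← ha] at hb
  rw [← hb]
  abel

end AbsolutelyContinuousOnInterval

/-! ### Regularity and integration by parts in H²_loc -/

namespace H2loc

variable {E : Type} [NormedAddCommGroup E] [NormedSpace ℝ E] (u : H2loc E)

theorem intervalIntegrable_u'' {a b : ℝ} (ha : 0 ≤ a) (hb : 0 ≤ b) :
    IntervalIntegrable u.u'' volume a b := by
  have h := u.memL2loc (max a b + 1) (by positivity)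
  have h1 : IntegrableOn u.u'' (Ioc 0 (max a b + 1)) := h.integrable (by norm_num)
  rw [intervalIntegrable_iff]
  refine h1.mono_set ?_
  intro x hx
  rw [uIoc, mem_Ioc] at hx
  exact ⟨(le_min ha hb).trans_lt hx.1, by linarith [hx.2]⟩

theorem absolutelyContinuous_u' {t : ℝ} (ht : 0 ≤ t) :
    AbsolutelyContinuousOnInterval u.u' 0 t := by
  refine (AbsolutelyContinuousOnInterval.primitive
    (u.intervalIntegrable_u'' le_rfl ht)).of_dist_le (C := 1) ?_
  intro x hx y hy
  rw [uIcc_of_le ht] at hx hy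
  rw [u.u'_eq x hx.1, u.u'_eq y hy.1]
  simp

theorem continuousOn_u' : ContinuousOn u.u' (Ici 0) := by
  intro x hx
  have h := (u.absolutelyContinuous_u' (t := x + 1) (by linarith [mem_Ici.1 hx])).continuousOn
  rw [uIcc_of_le (by linarith [mem_Ici.1 hx])] at h
  refine (h x ⟨hx, by linarith⟩).mono_of_mem_nhdsWithin ?_
  rw [← Ici_inter_Iic]
  exact inter_mem_nhdsWithin _ (Iic_mem_nhds (by linarith))

theorem intervalIntegrable_u' {a b : ℝ} (ha : 0 ≤ a) (hb : 0 ≤ b) :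
    IntervalIntegrable u.u' volume a b := by
  refine (u.continuousOn_u'.mono ?_).intervalIntegrable
  intro x hx
  exact (le_min ha hb).trans hx.1

theorem u'_sub {a b : ℝ} (ha : 0 ≤ a) (hb : 0 ≤ b) :
    u.u' b - u.u' a = ∫ s in a..b, u.u'' s := by
  rw [u.u'_eq a ha, u.u'_eq b hb, add_sub_add_left_eq_sub,
    intervalIntegral.integral_interval_sub_left (u.intervalIntegrable_u'' le_rfl hb)
      (u.intervalIntegrable_u'' le_rfl ha)]

theorem u_sub {a b : ℝ} (ha : 0 ≤ a) (hb : 0 ≤ b) :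
    u.u b - u.u a = ∫ s in a..b, u.u' s := by
  rw [u.u_eq a ha, u.u_eq b hb, add_sub_add_left_eq_sub,
    intervalIntegral.integral_interval_sub_left (u.intervalIntegrable_u' le_rfl hb)
      (u.intervalIntegrable_u' le_rfl ha)]

theorem hasDerivAt_u [CompleteSpace E] {t : ℝ} (ht : 0 < t) : HasDerivAt u.u (u.u' t) t := by
  have h : HasDerivAt (fun r => u.u 0 + ∫ s in (0 : ℝ)..r, u.u' s) (u.u' t) t := by
    refine (intervalIntegral.integral_hasDerivAt_right (u.intervalIntegrable_u' le_rfl ht.le) ?_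
      (u.continuousOn_u'.continuousAt (Ici_mem_nhds ht))).const_add _
    exact ContinuousOn.stronglyMeasurableAtFilter isOpen_Ioi
      (u.continuousOn_u'.mono Ioi_subset_Ici_self) t ht
  refine h.congr_of_eventuallyEq ?_
  filter_upwards [Ioi_mem_nhds ht] with r hr using u.u_eq r (le_of_lt hr)

theorem continuousOn_u : ContinuousOn u.u (Ici 0) := by
  intro x hx
  have hx' : (0 : ℝ) ≤ x + 1 := by linarith [mem_Ici.1 hx]
  have h0 : AbsolutelyContinuousOnInterval u.u 0 (x + 1) := by
    refine (AbsolutelyContinuousOnInterval.primitive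
      (u.intervalIntegrable_u' le_rfl hx')).of_dist_le (C := 1) ?_
    intro x hx y hy
    rw [uIcc_of_le hx'] at hx hy
    rw [u.u_eq x hx.1, u.u_eq y hy.1]
    simp
  have h := h0.continuousOn
  rw [uIcc_of_le hx'] at h
  refine (h x ⟨hx, by linarith⟩).mono_of_mem_nhdsWithin ?_
  rw [← Ici_inter_Iic]
  exact inter_mem_nhdsWithin _ (Iic_mem_nhds (by linarith))

theorem aestronglyMeasurable_u'' : AEStronglyMeasurable u.u'' (volume.restrict (Ioi 0)) := by
  have : Ioi (0 : ℝ) = ⋃ n : ℕ, Ioc 0 ((n : ℝ) + 1) := by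
    ext x
    simp only [mem_Ioi, mem_iUnion, mem_Ioc]
    refine ⟨fun h => ?_, fun ⟨_, h⟩ => h.1⟩
    obtain ⟨n, hn⟩ := exists_nat_gt x
    exact ⟨n, h, by linarith⟩
  rw [this, aestronglyMeasurable_iUnion_iff]
  exact fun n => (u.memL2loc _ (by positivity)).1

theorem locallyIntegrable_indicator_u'' : LocallyIntegrable ((Ioi 0).indicator u.u'') := by
  intro x
  refine ⟨Iic (|x| + 1), Iic_mem_nhds (by linarith [le_abs_self x]), ?_⟩
  rw [IntegrableOn, integrable_indicator_iff measurableSet_Ioi, IntegrableOn,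
    Measure.restrict_restrict measurableSet_Ioi, Ioi_inter_Iic]
  exact (u.memL2loc _ (by positivity)).integrable (by norm_num)

theorem ae_hasDerivAt_u' [CompleteSpace E] :
    ∀ᵐ t, 0 < t → HasDerivAt u.u' (u.u'' t) t := by
  filter_upwards [LocallyIntegrable.ae_hasDerivAt_integral
    u.locallyIntegrable_indicator_u''] with t ht h0
  have h := (ht 0).const_add (u.u' 0)
  rw [indicator_of_mem (mem_Ioi.2 h0)] at h
  refine h.congr_of_eventuallyEq ?_
  filter_upwards [Ioi_mem_nhds h0] with r hr
  rw [u.u'_eq r (le_of_lt hr)]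
  congr 1
  refine intervalIntegral.integral_congr_ae (Eventually.of_forall fun s hs => ?_)
  rw [uIoc_of_le (le_of_lt hr)] at hs
  rw [indicator_of_mem (mem_Ioi.2 hs.1)]

/-- Product rule for k u'. With k the inverse Jacobian of a time change, this is the fundamental
theorem of calculus for the derivative of the reparametrized function. -/
theorem integral_smul_u' [CompleteSpace E] {k κ : ℝ → ℝ} {t : ℝ} (ht : 0 ≤ t)
    (hk : AbsolutelyContinuousOnInterval k 0 t)
    (hd : ∀ᵐ x, x ∈ uIcc 0 t → HasDerivAt k (κ x) x) (hi : IntervalIntegrable κ volume 0 t) :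
    ∫ s in (0 : ℝ)..t, (k s • u.u'' s + κ s • u.u' s) = k t • u.u' t - k 0 • u.u' 0 := by
  refine AbsolutelyContinuousOnInterval.integral_eq_sub
    (hk.fun_smul (u.absolutelyContinuous_u' ht)) ?_ ?_
  · have h0 : ∀ᵐ x : ℝ, x ≠ 0 := Measure.ae_ne volume 0
    filter_upwards [hd, u.ae_hasDerivAt_u', h0] with x h1 h2 h3 hx
    rw [uIcc_of_le ht] at hx h1
    exact (h1 hx).smul (h2 (lt_of_le_of_ne hx.1 h3.symm))
  · exact ((u.intervalIntegrable_u'' le_rfl ht).continuousOn_smul hk.continuousOn).add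
      (hi.smul_continuousOn (u.absolutelyContinuous_u' ht).continuousOn)

end H2loc

theorem H2loc.integral_inner_u'_u'' {H : Type} [NormedAddCommGroup H] [InnerProductSpace ℝ H]
    [CompleteSpace H] (u : H2loc H) {t : ℝ} (ht : 0 ≤ t) :
    ∫ s in (0 : ℝ)..t, 2 * inner ℝ (u.u' s) (u.u'' s) = ‖u.u' t‖ ^ 2 - ‖u.u' 0‖ ^ 2 := by
  have hac := u.absolutelyContinuous_u' ht
  obtain ⟨M, hM⟩ := hac.exists_bound
  refine AbsolutelyContinuousOnInterval.integral_eq_sub (f := fun s => ‖u.u' s‖ ^ 2)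
    (hac.of_dist_le (C := 2 * M) ?_) ?_ ?_
  · intro x hx y hy
    have h1 := hM x hx
    have h2 := hM y hy
    have h3 := abs_norm_sub_norm_le (u.u' x) (u.u' y)
    rw [Real.dist_eq, dist_eq_norm, sq_sub_sq, abs_mul]
    have h4 : |‖u.u' x‖ + ‖u.u' y‖| ≤ 2 * M := by
      rw [abs_of_nonneg (by positivity)]; linarith
    exact mul_le_mul h4 h3 (abs_nonneg _) (by linarith [norm_nonneg (u.u' x)])
  · have h0 : ∀ᵐ x : ℝ, x ≠ 0 := Measure.ae_ne volume 0
    filter_upwards [u.ae_hasDerivAt_u', h0] with x h2 h3 hx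
    rw [uIcc_of_le ht] at hx
    exact (h2 (lt_of_le_of_ne hx.1 h3.symm)).norm_sq
  · have h := u.intervalIntegrable_u'' le_rfl ht
    have h1 : IntervalIntegrable (fun s => inner ℝ (u.u' s) (u.u'' s)) volume 0 t := by
      rw [intervalIntegrable_iff] at h ⊢
      refine (h.norm.const_mul M).mono' ?_ ?_
      · exact ((hac.continuousOn.mono uIoc_subset_uIcc).aestronglyMeasurable
          measurableSet_uIoc).inner h.1
      · filter_upwards [ae_restrict_mem measurableSet_uIoc] with x hx
        exact (norm_inner_le_norm _ _).trans
          (mul_le_mul_of_nonneg_right (hM x (uIoc_subset_uIcc hx)) (norm_nonneg _))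
    exact h1.const_mul 2

/-! ### Change of the time variable -/

theorem integral_zero_orderIso_eq {E : Type*} [NormedAddCommGroup E] [NormedSpace ℝ E]
    (e : ℝ ≃o ℝ) {p : ℝ → ℝ} (he : ∀ s, HasDerivAt e (p s) s) (hp : ∀ s, 0 ≤ s → 0 ≤ p s)
    (h0 : e 0 = 0) (F : ℝ → E) {r : ℝ} (hr : 0 ≤ r) :
    ∫ τ in (0 : ℝ)..e r, F τ = ∫ s in (0 : ℝ)..r, p s • F (e s) := by
  have h1 : 0 ≤ e r := h0 ▸ e.monotone hr
  rw [intervalIntegral.integral_of_le h1, intervalIntegral.integral_of_le hr]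
  have h2 : e '' Ioc 0 r = Ioc 0 (e r) := by rw [OrderIso.image_Ioc, h0]
  rw [← h2, integral_image_eq_integral_abs_deriv_smul measurableSet_Ioc
    (fun x _ => (he x).hasDerivWithinAt) e.injective.injOn]
  refine setIntegral_congr_fun measurableSet_Ioc fun s hs => ?_
  simp only [abs_of_nonneg (hp s hs.1.le)]

/-- Reparametrization in time of a function in `H²_loc`, by an orientation preserving
diffeomorphism `e` with derivative `p ≥ 1`, where `κ` is the derivative of `p⁻¹`. -/
theorem H2loc.exists_reparam {E : Type} [NormedAddCommGroup E] [NormedSpace ℝ E]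
    [CompleteSpace E] (u : H2loc E) (e : ℝ ≃o ℝ) {p κ : ℝ → ℝ} {M : ℝ}
    (he : ∀ s, HasDerivAt e (p s) s) (h0 : e 0 = 0) (hp0 : p 0 = 1) (hpc : Continuous p)
    (hp1 : ∀ s, 0 ≤ s → 1 ≤ p s) (hpM : ∀ s, 0 ≤ s → p s ≤ M)
    (hac : ∀ t, 0 ≤ t → AbsolutelyContinuousOnInterval (fun s => (p s)⁻¹) 0 t)
    (hκ : Measurable κ) (hκM : ∀ s, 0 ≤ s → |κ s| ≤ M)
    (hd : ∀ᵐ s, 0 ≤ s → HasDerivAt (fun s => (p s)⁻¹) (κ s) s) :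
    ∃ v : H2loc E, v.u 0 = u.u 0 ∧ v.u' 0 = u.u' 0 ∧ (∀ t, v.u t = u.u (e.symm t)) ∧
      ∀ s, v.u'' (e s) = (p s)⁻¹ ^ 2 • u.u'' s + ((p s)⁻¹ * κ s) • u.u' s := by
  -- Differentiating v(e(s)) = u(s) gives v'(e(s)) = p⁻¹ u'(s); one more differentiation, followed
  -- by division by p, gives this expression for v''(e(s)).
  set G : ℝ → E := fun s => (p s)⁻¹ ^ 2 • u.u'' s + ((p s)⁻¹ * κ s) • u.u' s with hG
  have hpos : ∀ s, 0 ≤ s → 0 < p s := fun s hs => zero_lt_one.trans_le (hp1 s hs)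
  have hinv : ∀ s, 0 ≤ s → |(p s)⁻¹| ≤ 1 := fun s hs => by
    rw [abs_of_pos (inv_pos.2 (hpos s hs))]
    exact inv_le_one_of_one_le₀ (hp1 s hs)
  have hM : 0 ≤ M := (hpos 0 le_rfl).le.trans (hpM 0 le_rfl)
  have hs0 : e.symm 0 = 0 := by rw [← h0, e.symm_apply_apply, h0]
  have hGmem : ∀ r, MemLp G 2 (volume.restrict (Ioc 0 r)) := by
    intro r
    rcases le_or_gt r 0 with hr | hr
    · simp [Ioc_eq_empty (not_lt.2 hr)]
    obtain ⟨B, hB⟩ := (u.absolutelyContinuous_u' hr.le).exists_bound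
    rw [uIcc_of_le hr.le] at hB
    have hmp : Measurable fun s => (p s)⁻¹ := hpc.measurable.inv
    refine MemLp.add ?_ ?_
    · refine (u.memL2loc r hr).of_le_mul (c := 1) ?_ ?_
      · exact ((hmp.pow_const 2).aestronglyMeasurable).smul (u.memL2loc r hr).1
      · filter_upwards [ae_restrict_mem measurableSet_Ioc] with s hs
        rw [norm_smul, Real.norm_eq_abs, abs_pow]
        exact mul_le_mul_of_nonneg_right (pow_le_one₀ (abs_nonneg _) (hinv s hs.1.le))
          (norm_nonneg _)
    · refine MemLp.of_bound (C := 1 * M * B) ?_ ?_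
      · exact ((hmp.mul hκ).aestronglyMeasurable).smul ((u.continuousOn_u'.mono
          (fun x hx => le_of_lt hx.1)).aestronglyMeasurable measurableSet_Ioc)
      · filter_upwards [ae_restrict_mem measurableSet_Ioc] with s hs
        rw [norm_smul, Real.norm_eq_abs, abs_mul]
        have h1 := hinv s hs.1.le
        have h2 := hκM s hs.1.le
        have h3 := hB s (Ioc_subset_Icc_self hs)
        gcongr
  have hcomp : ∀ {F : Type} [NormedAddCommGroup F] [NormedSpace ℝ F] (f : ℝ → F) (r : ℝ),
      IntegrableOn f (Ioc 0 r) → IntegrableOn (fun t => f (e.symm t)) (Ioc 0 (e r)) := by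
    intro F _ _ f r hf
    have h2 : e '' Ioc 0 r = Ioc 0 (e r) := by rw [OrderIso.image_Ioc, h0]
    rw [← h2, integrableOn_image_iff_integrableOn_abs_deriv_smul measurableSet_Ioc
      (fun x _ => (he x).hasDerivWithinAt) e.injective.injOn]
    simp only [OrderIso.symm_apply_apply]
    refine (hf.norm.const_mul M).mono' ?_ ?_
    · exact (hpc.abs.measurable.aestronglyMeasurable).smul hf.1
    · filter_upwards [ae_restrict_mem measurableSet_Ioc] with s hs
      rw [norm_smul, Real.norm_eq_abs, abs_abs, abs_of_pos (hpos s hs.1.le)]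
      exact mul_le_mul_of_nonneg_right (hpM s hs.1.le) (norm_nonneg _)
  refine ⟨{ u := fun t => u.u (e.symm t)
            u' := fun t => (p (e.symm t))⁻¹ • u.u' (e.symm t)
            u'' := fun t => G (e.symm t)
            memL2loc := ?_
            u'_eq := ?_
            u_eq := ?_ }, ?_, ?_, ?_, ?_⟩
  · intro T hT
    have h1 := hcomp G (e.symm T) ((hGmem _).integrable (by norm_num))
    have h2 := hcomp (fun s => ‖G s‖ ^ 2) (e.symm T)
      ((memLp_two_iff_integrable_sq_norm (hGmem _).1).1 (hGmem _))
    rw [e.apply_symm_apply] at h1 h2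
    exact (memLp_two_iff_integrable_sq_norm h1.1).2 h2
  · intro t ht
    obtain ⟨r, rfl⟩ := e.surjective t
    have hr : 0 ≤ r := by rwa [← h0, e.le_iff_le] at ht
    rw [integral_zero_orderIso_eq e he (fun s hs => (hpos s hs).le) h0 _ hr]
    simp only [OrderIso.symm_apply_apply, hs0]
    have h1 := u.integral_smul_u' hr (hac r hr) (by
      rw [uIcc_of_le hr]
      filter_upwards [hd] with s hs h using hs h.1) (by
      rw [intervalIntegrable_iff, uIoc_of_le hr]
      exact Measure.integrableOn_of_bounded (M := M) (by simp) hκ.aestronglyMeasurable (by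
        filter_upwards [ae_restrict_mem measurableSet_Ioc] with s hs using hκM s hs.1.le))
    rw [← sub_eq_iff_eq_add', ← h1]
    refine intervalIntegral.integral_congr fun s hs => ?_
    rw [uIcc_of_le hr] at hs
    have := (hpos s hs.1).ne'
    simp only [hG, smul_add, smul_smul]
    congr 2 <;> field_simp
  · intro t ht
    obtain ⟨r, rfl⟩ := e.surjective t
    have hr : 0 ≤ r := by rwa [← h0, e.le_iff_le] at ht
    rw [integral_zero_orderIso_eq e he (fun s hs => (hpos s hs).le) h0 _ hr]
    simp only [OrderIso.symm_apply_apply, hs0]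
    rw [u.u_eq r hr]
    congr 1
    refine intervalIntegral.integral_congr fun s hs => ?_
    rw [uIcc_of_le hr] at hs
    have := (hpos s hs.1).ne'
    simp only [smul_smul, mul_inv_cancel₀ this, one_smul]
  · simp only [hs0]
  · simp only [hs0, hp0, inv_one, one_smul]
  · intro t; rfl
  · intro s; simp only [OrderIso.symm_apply_apply, hG]

/-! ### The weight and the inner variation that it generates -/

/-- The weight `∫_0^T e^t (s-t)⁺ dt`, as a function of `s`. -/
noncomputable def profile (T s : ℝ) : ℝ :=
  Real.exp (min s T) - 1 - s + Real.exp T * (s - min s T)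

/-- The derivative of `profile T`. -/
noncomputable def profileDeriv (T s : ℝ) : ℝ := Real.exp (min s T) - 1

/-- The second derivative of `profile T`. -/
noncomputable def profileDeriv2 (T s : ℝ) : ℝ := if s < T then Real.exp s else 0

theorem hasDerivAt_profile (T s : ℝ) : HasDerivAt (profile T) (profileDeriv T s) s := by
  have h1 : ∀ s ≤ T, HasDerivWithinAt (profile T) (profileDeriv T s) (Iic T) s := by
    intro s hs
    have h : HasDerivAt (fun s => Real.exp s - 1 - s) (Real.exp s - 1) s :=
      ((Real.hasDerivAt_exp s).sub_const 1).sub (hasDerivAt_id s)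
    rw [profileDeriv, min_eq_left hs]
    refine h.hasDerivWithinAt.congr (fun x hx => ?_) ?_
    · simp [profile, min_eq_left (mem_Iic.1 hx)]
    · simp [profile, min_eq_left hs]
  have h2 : ∀ s, T ≤ s → HasDerivWithinAt (profile T) (profileDeriv T s) (Ici T) s := by
    intro s hs
    have h : HasDerivAt (fun s => Real.exp T - 1 - s + Real.exp T * (s - T))
        (-1 + Real.exp T * 1) s :=
      ((hasDerivAt_id s).const_sub _).add (((hasDerivAt_id s).sub_const T).const_mul _)
    rw [profileDeriv, min_eq_right hs, show Real.exp T - 1 = -1 + Real.exp T * 1 by ring]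
    refine h.hasDerivWithinAt.congr (fun x hx => ?_) ?_
    · simp [profile, min_eq_right (mem_Ici.1 hx)]
    · simp [profile, min_eq_right hs]
  rcases lt_trichotomy s T with h | h | h
  · exact (h1 s h.le).hasDerivAt (Iic_mem_nhds h)
  · have := (h1 s h.le).union (h2 s h.ge)
    rw [Iic_union_Ici] at this
    exact this.hasDerivAt univ_mem
  · exact (h2 s h.le).hasDerivAt (Ici_mem_nhds h)

theorem hasDerivAt_profileDeriv {T s : ℝ} (h : s ≠ T) :
    HasDerivAt (profileDeriv T) (profileDeriv2 T s) s := by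
  rcases lt_or_gt_of_ne h with h | h
  · rw [profileDeriv2, if_pos h]
    refine ((Real.hasDerivAt_exp s).sub_const 1).congr_of_eventuallyEq ?_
    filter_upwards [Iio_mem_nhds h] with x hx
    simp [profileDeriv, min_eq_left (le_of_lt (mem_Iio.1 hx))]
  · rw [profileDeriv2, if_neg (not_lt.2 h.le)]
    refine (hasDerivAt_const s (Real.exp T - 1)).congr_of_eventuallyEq ?_
    filter_upwards [Ioi_mem_nhds h] with x hx
    simp [profileDeriv, min_eq_right (le_of_lt (mem_Ioi.1 hx))]

theorem continuous_profileDeriv (T : ℝ) : Continuous (profileDeriv T) := by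
  unfold profileDeriv; fun_prop

theorem continuous_profile (T : ℝ) : Continuous (profile T) := by
  unfold profile; fun_prop

theorem measurable_profileDeriv2 (T : ℝ) : Measurable (profileDeriv2 T) :=
  Measurable.ite measurableSet_Iio Real.measurable_exp measurable_const

theorem profile_zero {T : ℝ} (hT : 0 ≤ T) : profile T 0 = 0 := by
  simp [profile, min_eq_left hT]

theorem profileDeriv_zero {T : ℝ} (hT : 0 ≤ T) : profileDeriv T 0 = 0 := by
  simp [profileDeriv, min_eq_left hT]

theorem profileDeriv_nonneg {T s : ℝ} (hT : 0 ≤ T) (hs : 0 ≤ s) : 0 ≤ profileDeriv T s := by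
  have := Real.add_one_le_exp (min s T)
  have := le_min hs hT
  unfold profileDeriv; linarith

theorem neg_one_lt_profileDeriv (T s : ℝ) : -1 < profileDeriv T s := by
  have := Real.exp_pos (min s T)
  unfold profileDeriv; linarith

theorem profileDeriv_le (T s : ℝ) : profileDeriv T s ≤ Real.exp T := by
  have := Real.exp_le_exp.2 (min_le_right s T)
  unfold profileDeriv; linarith

theorem profileDeriv2_nonneg (T s : ℝ) : 0 ≤ profileDeriv2 T s := by
  unfold profileDeriv2; split_ifs <;> positivity

theorem profileDeriv2_le (T s : ℝ) : profileDeriv2 T s ≤ Real.exp T := by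
  unfold profileDeriv2
  split_ifs with h
  · exact Real.exp_le_exp.2 h.le
  · positivity

theorem monotoneOn_profile {T : ℝ} (hT : 0 ≤ T) : MonotoneOn (profile T) (Ici 0) := by
  refine monotoneOn_of_deriv_nonneg (convex_Ici 0) (continuous_profile T).continuousOn
    (fun s _ => (hasDerivAt_profile T s).differentiableAt.differentiableWithinAt) fun s hs => ?_
  rw [interior_Ici] at hs
  rw [(hasDerivAt_profile T s).deriv]
  exact profileDeriv_nonneg hT (le_of_lt hs)

theorem profile_nonneg {T s : ℝ} (hT : 0 ≤ T) (hs : 0 ≤ s) : 0 ≤ profile T s := by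
  rw [← profile_zero hT]
  exact monotoneOn_profile hT self_mem_Ici hs hs

/-- This identity turns the potential terms of the first order condition into the approximate
energies at times T and 0. -/
theorem profile_sub_profileDeriv (T s : ℝ) :
    profile T s - profileDeriv T s = Real.exp T * (s - min s T) - s := by
  unfold profile profileDeriv; ring

theorem absolutelyContinuous_profileDeriv (T : ℝ) {t : ℝ} :
    AbsolutelyContinuousOnInterval (profileDeriv T) 0 t := by
  have hi : ∀ a b, IntervalIntegrable (profileDeriv2 T) volume a b := fun a b => by
    rw [intervalIntegrable_iff]
    refine Measure.integrableOn_of_bounded (M := Real.exp T) (by simp)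
      (measurable_profileDeriv2 T).aestronglyMeasurable (Eventually.of_forall fun s => ?_)
    rw [Real.norm_eq_abs, abs_of_nonneg (profileDeriv2_nonneg T s)]
    exact profileDeriv2_le T s
  refine (AbsolutelyContinuousOnInterval.primitive (hi 0 t)).of_dist_le (C := 1) ?_
  intro x _ y _
  have h : ∀ x, ∫ s in (0 : ℝ)..x, profileDeriv2 T s = profileDeriv T x - profileDeriv T 0 :=
    fun x => integral_eq_of_hasDerivAt_off_countable _ _ (countable_singleton T)
      (continuous_profileDeriv T).continuousOn (fun s hs => hasDerivAt_profileDeriv hs.2) (hi _ _)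
  rw [h, h, dist_sub_right, one_mul]

/-- On the whole line the derivative of the weight is only known to exceed -1, so δ < 1 makes the
map strictly increasing. On the negative axis it lies below (1 - δ)s, which gives surjectivity. -/
theorem exists_orderIso_profile {T δ : ℝ} (hT : 0 ≤ T) (hδ : 0 < δ) (hδ1 : δ < 1) :
    ∃ e : ℝ ≃o ℝ, ∀ s, e s = s + δ * profile T s := by
  have hd : ∀ s, HasDerivAt (fun s => s + δ * profile T s) (1 + δ * profileDeriv T s) s :=
    fun s => (hasDerivAt_id s).add ((hasDerivAt_profile T s).const_mul δ)
  have hmono : StrictMono fun s => s + δ * profile T s := by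
    refine strictMono_of_deriv_pos fun s => ?_
    rw [(hd s).deriv]
    nlinarith [neg_one_lt_profileDeriv T s]
  have hsurj : Function.Surjective fun s => s + δ * profile T s := by
    refine Continuous.surjective (by have := continuous_profile T; fun_prop) ?_ ?_
    · refine tendsto_atTop_mono' atTop ?_ tendsto_id
      filter_upwards [eventually_ge_atTop 0] with s hs
      have := mul_nonneg hδ.le (profile_nonneg hT hs)
      simp only [id]; linarith
    · refine tendsto_atBot_mono' atBot (f₁ := fun s => (1 - δ) * s) ?_
        (tendsto_id.const_mul_atBot (by linarith))
      filter_upwards [eventually_le_atBot 0] with s hs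
      have h1 := Real.exp_le_one_iff.2 hs
      rw [profile, min_eq_left (hs.trans hT)]
      nlinarith
  exact ⟨hmono.orderIsoOfSurjective _ hsurj, fun s => rfl⟩

/-- The weight and its first derivative vanish at 0, so position and velocity at time 0 are
unchanged. The inverse Jacobian (1 + δ g')⁻¹ is absolutely continuous although g'' jumps at T, which
is enough for v to remain in H²_loc. -/
theorem H2loc.exists_inner_variation {E : Type} [NormedAddCommGroup E] [NormedSpace ℝ E]
    [CompleteSpace E] (u : H2loc E) {T δ : ℝ} (hT : 0 ≤ T) (hδ : 0 < δ) (hδ1 : δ < 1) :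
    ∃ (e : ℝ ≃o ℝ) (v : H2loc E), (∀ s, e s = s + δ * profile T s) ∧
      v.u 0 = u.u 0 ∧ v.u' 0 = u.u' 0 ∧ (∀ t, v.u t = u.u (e.symm t)) ∧
      ∀ s, v.u'' (e s) = (1 + δ * profileDeriv T s)⁻¹ ^ 2 •
        (u.u'' s - (δ * profileDeriv2 T s * (1 + δ * profileDeriv T s)⁻¹) • u.u' s) := by
  obtain ⟨e, he⟩ := exists_orderIso_profile hT hδ hδ1
  have hp1 : ∀ s, 0 ≤ s → 1 ≤ 1 + δ * profileDeriv T s := fun s hs => by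
    have := mul_nonneg hδ.le (profileDeriv_nonneg hT hs); linarith
  have hE := Real.exp_pos T
  have hd : ∀ s, HasDerivAt e (1 + δ * profileDeriv T s) s := fun s => by
    have := (hasDerivAt_id s).add ((hasDerivAt_profile T s).const_mul δ)
    rwa [show (e : ℝ → ℝ) = fun s => s + δ * profile T s from funext he]
  have hv : ∃ v : H2loc E, v.u 0 = u.u 0 ∧ v.u' 0 = u.u' 0 ∧ (∀ t, v.u t = u.u (e.symm t)) ∧
      ∀ s, v.u'' (e s) = (1 + δ * profileDeriv T s)⁻¹ ^ 2 • u.u'' s +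
        ((1 + δ * profileDeriv T s)⁻¹ *
          (-(δ * profileDeriv2 T s) / (1 + δ * profileDeriv T s) ^ 2)) • u.u' s := by
    refine u.exists_reparam e (p := fun s => 1 + δ * profileDeriv T s)
      (κ := fun s => -(δ * profileDeriv2 T s) / (1 + δ * profileDeriv T s) ^ 2)
      (M := 1 + Real.exp T) hd ?_ ?_ ?_ hp1 ?_ ?_ ?_ ?_ ?_
    · rw [he, profile_zero hT]; simp
    · simp [profileDeriv_zero hT]
    · have := continuous_profileDeriv T; fun_prop
    · intro s hs
      have := profileDeriv_le T s
      have := profileDeriv_nonneg hT hs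
      nlinarith
    · intro t ht
      refine (absolutelyContinuous_profileDeriv T).of_dist_le (C := 1) ?_
      intro x hx y hy
      rw [uIcc_of_le ht] at hx hy
      have hx1 := hp1 x hx.1
      have hy1 := hp1 y hy.1
      rw [Real.dist_eq, Real.dist_eq, one_mul, inv_sub_inv (by positivity) (by positivity), abs_div]
      refine (div_le_self (abs_nonneg _) ?_).trans ?_
      · rw [abs_of_pos (by positivity)]; nlinarith
      · rw [add_sub_add_left_eq_sub, ← mul_sub, abs_mul, abs_sub_comm, abs_of_pos hδ]
        exact mul_le_of_le_one_left (abs_nonneg _) hδ1.le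
    · have := (continuous_profileDeriv T).measurable
      have := measurable_profileDeriv2 T
      fun_prop
    · intro s hs
      have h1 := hp1 s hs
      have h2 := profileDeriv2_nonneg T s
      have h3 := profileDeriv2_le T s
      rw [abs_div, abs_neg, abs_of_nonneg (by positivity), abs_of_pos (by positivity)]
      refine (div_le_self (by positivity) (one_le_pow₀ h1)).trans ?_
      nlinarith
    · filter_upwards [Measure.ae_ne volume T] with s hs h0
      have h1 := hp1 s h0
      exact (((hasDerivAt_profileDeriv hs).const_mul δ).const_add 1).fun_inv (by positivity)
  obtain ⟨v, h1, h2, h3, h4⟩ := hv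
  refine ⟨e, v, he, h1, h2, h3, fun s => ?_⟩
  have hpos : 0 < 1 + δ * profileDeriv T s := by nlinarith [neg_one_lt_profileDeriv T s]
  rw [h4, smul_sub, smul_smul, sub_eq_add_neg, ← neg_smul]
  congr 2
  field_simp

/-! ### One-sided first order conditions -/

/-- Fatou's lemma: the limit inherits both integrability and the bound from nonnegative functions
whose integrals stay bounded. -/
theorem integrable_of_integral_le_of_tendsto {α : Type*} {m : MeasurableSpace α} {μ : Measure α}
    {F : ℕ → α → ℝ} {f : α → ℝ} {c : ℕ → ℝ} {C : ℝ} (hF : ∀ n, Integrable (F n) μ)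
    (hF0 : ∀ n, ∀ᵐ x ∂μ, 0 ≤ F n x) (hf : ∀ᵐ x ∂μ, Tendsto (fun n => F n x) atTop (𝓝 (f x)))
    (hc : ∀ n, ∫ x, F n x ∂μ ≤ c n) (hC : Tendsto c atTop (𝓝 C)) :
    Integrable f μ ∧ ∫ x, f x ∂μ ≤ C := by
  have hf0 : ∀ᵐ x ∂μ, 0 ≤ f x := by
    filter_upwards [hf, ae_all_iff.2 hF0] with x h1 h2 using ge_of_tendsto' h1 h2
  have hm : AEStronglyMeasurable f μ :=
    aestronglyMeasurable_of_tendsto_ae atTop (fun n => (hF n).1) hf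
  have hC0 : 0 ≤ C := ge_of_tendsto' hC fun n => (integral_nonneg_of_ae (hF0 n)).trans (hc n)
  have key : ∫⁻ x, ENNReal.ofReal (f x) ∂μ ≤ ENNReal.ofReal C := by
    calc ∫⁻ x, ENNReal.ofReal (f x) ∂μ
        = ∫⁻ x, liminf (fun n => ENNReal.ofReal (F n x)) atTop ∂μ := by
          refine lintegral_congr_ae ?_
          filter_upwards [hf] with x hx
          exact ((ENNReal.continuous_ofReal.tendsto _).comp hx).liminf_eq.symm
      _ ≤ liminf (fun n => ∫⁻ x, ENNReal.ofReal (F n x) ∂μ) atTop :=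
          lintegral_liminf_le' fun n => (hF n).1.aemeasurable.ennreal_ofReal
      _ ≤ liminf (fun n => ENNReal.ofReal (c n)) atTop := by
          refine liminf_le_liminf (Eventually.of_forall fun n => ?_)
          rw [← ofReal_integral_eq_lintegral_ofReal (hF n) (hF0 n)]
          exact ENNReal.ofReal_le_ofReal (hc n)
      _ = ENNReal.ofReal C := ((ENNReal.continuous_ofReal.tendsto _).comp hC).liminf_eq
  have hi : Integrable f μ := by
    refine ⟨hm, ?_⟩
    rw [hasFiniteIntegral_iff_ofReal hf0]
    exact key.trans_lt ENNReal.ofReal_lt_top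
  refine ⟨hi, ?_⟩
  rw [← ofReal_integral_eq_lintegral_ofReal hi hf0] at key
  exact (ENNReal.ofReal_le_ofReal_iff hC0).1 key

/-- The product g L is not assumed integrable, so the inequality cannot be differentiated at δ = 0.
Moving exp(-δ g) L to the left makes the difference quotient (1 - exp(-δ g))/δ · L appear; it is
nonnegative and tends to g L, so Fatou's lemma applies. On the right dominated convergence handles
Q, and the R term carries a spare factor δ. -/
theorem integrable_and_integral_le_of_variation {α : Type*} {m : MeasurableSpace α}
    {μ : Measure α} {L Q R g : α → ℝ} (hL : Integrable L μ) (hQ : Integrable Q μ)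
    (hR : Integrable R μ) (hg : AEStronglyMeasurable g μ) (hg0 : ∀ᵐ x ∂μ, 0 ≤ g x)
    (hL0 : ∀ᵐ x ∂μ, 0 ≤ L x) {S₀ σ : ℝ} {S : ℝ → ℝ}
    (h : ∀ δ ∈ Ioo (0 : ℝ) 1, ∫ x, L x ∂μ - S₀ ≤
      ∫ x, (Real.exp (-(δ * g x)) * (L x + δ * Q x) + δ ^ 2 * R x) ∂μ - S δ)
    (hS : Tendsto (fun δ => (S₀ - S δ) / δ) (𝓝[>] 0) (𝓝 σ)) :
    Integrable (fun x => g x * L x) μ ∧ ∫ x, g x * L x ∂μ ≤ ∫ x, Q x ∂μ + σ := by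
  -- The shift by two keeps every d n strictly inside (0, 1), where the variation is defined.
  set d : ℕ → ℝ := fun n => 1 / ((n : ℝ) + 1 + 1) with hd
  have hd0 : ∀ n, 0 < d n := fun n => by positivity
  have hd1 : ∀ n, d n < 1 := fun n => by
    rw [hd]; simp only; rw [div_lt_one (by positivity)]; linarith [n.cast_nonneg (α := ℝ)]
  have hdlim : Tendsto d atTop (𝓝 0) := by
    have := tendsto_one_div_add_atTop_nhds_zero_nat (𝕜 := ℝ)
    simpa [hd] using (tendsto_add_atTop_iff_nat 1).2 this
  have hdlim' : Tendsto d atTop (𝓝[>] 0) :=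
    tendsto_nhdsWithin_iff.2 ⟨hdlim, Eventually.of_forall hd0⟩
  have hexp : ∀ δ : ℝ, AEStronglyMeasurable (fun x => Real.exp (-(δ * g x))) μ := fun δ =>
    Real.continuous_exp.comp_aestronglyMeasurable (hg.const_mul δ).neg
  have hexp1 : ∀ δ : ℝ, 0 ≤ δ → ∀ᵐ x ∂μ, ‖Real.exp (-(δ * g x))‖ ≤ 1 := fun δ hδ => by
    filter_upwards [hg0] with x hx
    rw [Real.norm_eq_abs, Real.abs_exp, Real.exp_le_one_iff]
    nlinarith [mul_nonneg hδ hx]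
  have hint : ∀ δ : ℝ, 0 ≤ δ → ∀ {f : α → ℝ}, Integrable f μ →
      Integrable (fun x => Real.exp (-(δ * g x)) * f x) μ := fun δ hδ f hf =>
    hf.bdd_mul (hexp δ) (hexp1 δ hδ)
  refine integrable_of_integral_le_of_tendsto
    (F := fun n x => (1 - Real.exp (-(d n * g x))) / d n * L x)
    (c := fun n => ∫ x, Real.exp (-(d n * g x)) * Q x ∂μ + d n * ∫ x, R x ∂μ +
      (S₀ - S (d n)) / d n) ?_ ?_ ?_ ?_ ?_
  · intro n
    have := (hL.sub (hint _ (hd0 n).le hL)).const_mul (d n)⁻¹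
    refine this.congr (Eventually.of_forall fun x => ?_)
    simp only [Pi.sub_apply]
    ring
  · intro n
    filter_upwards [hg0, hL0] with x hx hLx
    refine mul_nonneg (div_nonneg ?_ (hd0 n).le) hLx
    have : Real.exp (-(d n * g x)) ≤ 1 := Real.exp_le_one_iff.2 (by
      nlinarith [mul_nonneg (hd0 n).le hx])
    linarith
  · refine Eventually.of_forall fun x => ?_
    refine Tendsto.mul_const _ ?_
    have h1 : HasDerivAt (fun δ : ℝ => 1 - Real.exp (-(δ * g x))) (g x) 0 := by
      have h2 : HasDerivAt (fun δ : ℝ => -(δ * g x)) (-g x) 0 := by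
        simpa using ((hasDerivAt_id (0 : ℝ)).mul_const (g x)).fun_neg
      simpa using (h2.exp).const_sub 1
    have h3 := (hasDerivAt_iff_tendsto_slope.1 h1).comp
      (hdlim'.mono_right (nhdsWithin_mono 0 fun y (hy : 0 < y) => hy.ne'))
    refine h3.congr fun n => ?_
    simp [slope_def_field]
  · intro n
    have h1 := h (d n) ⟨hd0 n, hd1 n⟩
    have hdn := hd0 n
    have e1 : ∫ x, (Real.exp (-(d n * g x)) * (L x + d n * Q x) + d n ^ 2 * R x) ∂μ =
        ∫ x, Real.exp (-(d n * g x)) * L x ∂μ + d n * ∫ x, Real.exp (-(d n * g x)) * Q x ∂μ +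
          d n ^ 2 * ∫ x, R x ∂μ := by
      rw [← integral_const_mul, ← integral_const_mul,
        ← integral_add (hint _ hdn.le hL) ((hint _ hdn.le hQ).const_mul _),
        ← integral_add ((hint _ hdn.le hL).fun_add ((hint _ hdn.le hQ).const_mul _))
          (hR.const_mul _)]
      congr 1; ext x; ring
    have e2 : ∫ x, (1 - Real.exp (-(d n * g x))) / d n * L x ∂μ =
        (d n)⁻¹ * (∫ x, L x ∂μ - ∫ x, Real.exp (-(d n * g x)) * L x ∂μ) := by
      rw [← integral_sub hL (hint _ hdn.le hL), ← integral_const_mul]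
      congr 1; ext x; ring
    rw [e1] at h1
    rw [e2, inv_mul_le_iff₀ hdn]
    have e3 : d n * (∫ x, Real.exp (-(d n * g x)) * Q x ∂μ + d n * ∫ x, R x ∂μ +
        (S₀ - S (d n)) / d n) = d n * ∫ x, Real.exp (-(d n * g x)) * Q x ∂μ +
        d n ^ 2 * ∫ x, R x ∂μ + (S₀ - S (d n)) := by field_simp
    rw [e3]; linarith
  · have h1 : Tendsto (fun n => ∫ x, Real.exp (-(d n * g x)) * Q x ∂μ) atTop
        (𝓝 (∫ x, Q x ∂μ)) := by
      refine tendsto_integral_of_dominated_convergence (fun x => ‖Q x‖)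
        (fun n => (hint _ (hd0 n).le hQ).1) hQ.norm ?_ ?_
      · intro n
        filter_upwards [hexp1 _ (hd0 n).le] with x hx
        rw [norm_mul]
        exact mul_le_of_le_one_left (norm_nonneg _) hx
      · refine Eventually.of_forall fun x => ?_
        have h2 : Tendsto (fun n => Real.exp (-(d n * g x))) atTop (𝓝 (Real.exp (-(0 * g x)))) :=
          (Real.continuous_exp.tendsto _).comp (hdlim.mul_const _).neg
        simpa using h2.mul_const (Q x)
    have h3 := (h1.add (hdlim.mul_const (∫ x, R x ∂μ))).add (hS.comp hdlim')
    simpa using h3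

theorem integrableOn_inner_of_ae_eq_zero {H : Type*} [NormedAddCommGroup H]
    [InnerProductSpace ℝ H] {φ v : ℝ → H} {Tstar : ℝ} (hφ : IntegrableOn φ (Ioi 0))
    (hφ0 : ∀ᵐ t : ℝ, 0 ≤ t → Tstar < t → φ t = 0) (hv : ContinuousOn v (Ici 0)) :
    IntegrableOn (fun t => inner ℝ (φ t) (v t)) (Ioi 0) := by
  obtain ⟨M, hM⟩ := isCompact_Icc.exists_bound_of_continuousOn
    (hv.mono (Icc_subset_Ici_self : Icc 0 Tstar ⊆ _))
  refine (hφ.norm.const_mul M).mono' ?_ ?_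
  · exact hφ.1.inner ((hv.mono Ioi_subset_Ici_self).aestronglyMeasurable measurableSet_Ioi)
  · filter_upwards [ae_restrict_of_ae hφ0, ae_restrict_mem measurableSet_Ioi] with t h1 ht
    rcases le_or_gt t Tstar with h | h
    · refine (norm_inner_le_norm _ _).trans ?_
      rw [mul_comm]
      exact mul_le_mul_of_nonneg_right (hM t ⟨le_of_lt ht, h⟩) (norm_nonneg _)
    · simp [h1 (le_of_lt ht) h]

/-- Here r δ is the inverse time change, so that r δ t - t = -δ g(r δ t) and the quotient of u tends
to g(t) u'(t). Since φ vanishes after `Tstar`, the bounds of u' and g on the compact interval up to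
`Tstar` dominate; no growth control on u at infinity is needed. -/
theorem H2loc.tendsto_source_variation {H : Type} [NormedAddCommGroup H]
    [InnerProductSpace ℝ H] [CompleteSpace H] (u : H2loc H) {φ : ℝ → H} {Tstar T : ℝ}
    (hT : 0 ≤ T) (hφ : IntegrableOn φ (Ioi 0))
    (hφ0 : ∀ᵐ t : ℝ, 0 ≤ t → Tstar < t → φ t = 0) {r : ℝ → ℝ → ℝ}
    (hrc : ∀ δ ∈ Ico (0 : ℝ) 1, Continuous (r δ))
    (hr0 : ∀ δ ∈ Ico (0 : ℝ) 1, ∀ t, 0 ≤ t → 0 ≤ r δ t)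
    (hr : ∀ δ ∈ Ico (0 : ℝ) 1, ∀ t, 0 ≤ t → r δ t + δ * profile T (r δ t) = t) :
    Tendsto (fun δ => ((∫ t in Ioi (0 : ℝ), Real.exp (-t) * inner ℝ (φ t) (u.u t)) -
        ∫ t in Ioi (0 : ℝ), Real.exp (-t) * inner ℝ (φ t) (u.u (r δ t))) / δ) (𝓝[>] 0)
      (𝓝 (∫ t in Ioi (0 : ℝ), Real.exp (-t) * (profile T t * inner ℝ (φ t) (u.u' t)))) := by
  have hle : ∀ δ ∈ Ico (0 : ℝ) 1, ∀ t, 0 ≤ t → r δ t ≤ t := fun δ hδ t ht => by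
    have := mul_nonneg hδ.1 (profile_nonneg hT (hr0 δ hδ t ht))
    linarith [hr δ hδ t ht]
  have h0 : (0 : ℝ) ∈ Ico (0 : ℝ) 1 := by simp
  have hev : ∀ᶠ δ in 𝓝[>] (0 : ℝ), δ ∈ Ioo (0 : ℝ) 1 := Ioo_mem_nhdsGT one_pos
  have hint : ∀ δ ∈ Ico (0 : ℝ) 1,
      IntegrableOn (fun t => Real.exp (-t) * inner ℝ (φ t) (u.u (r δ t))) (Ioi 0) := by
    intro δ hδ
    have h1 := integrableOn_inner_of_ae_eq_zero hφ hφ0 (v := fun t => u.u (r δ t))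
      (u.continuousOn_u.comp (hrc δ hδ).continuousOn fun t ht => hr0 δ hδ t ht)
    refine h1.bdd_mul (c := 1) (by fun_prop) ?_
    filter_upwards [ae_restrict_mem measurableSet_Ioi] with t ht
    rw [Real.norm_eq_abs, Real.abs_exp, Real.exp_le_one_iff]
    linarith [mem_Ioi.1 ht]
  have hr00 : ∀ t, 0 ≤ t → r 0 t = t := fun t ht => by simpa using hr 0 h0 t ht
  have hS0 : (∫ t in Ioi (0 : ℝ), Real.exp (-t) * inner ℝ (φ t) (u.u t)) =
      ∫ t in Ioi (0 : ℝ), Real.exp (-t) * inner ℝ (φ t) (u.u (r 0 t)) :=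
    setIntegral_congr_fun measurableSet_Ioi fun t ht => by simp only [hr00 t (le_of_lt ht)]
  obtain ⟨M, hM⟩ := isCompact_Icc.exists_bound_of_continuousOn
    (u.continuousOn_u'.mono (Icc_subset_Ici_self : Icc 0 Tstar ⊆ _))
  have key : Tendsto (fun δ => ∫ t in Ioi (0 : ℝ),
      Real.exp (-t) * inner ℝ (φ t) (δ⁻¹ • (u.u (r 0 t) - u.u (r δ t)))) (𝓝[>] 0)
      (𝓝 (∫ t in Ioi (0 : ℝ), Real.exp (-t) * (profile T t * inner ℝ (φ t) (u.u' t)))) := by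
    refine tendsto_integral_filter_of_dominated_convergence
      (fun t => M * profile T Tstar * ‖φ t‖) ?_ ?_ (hφ.norm.const_mul _) ?_
    · filter_upwards [hev] with δ hδ
      have h1 := ((hint 0 h0).sub (hint δ ⟨hδ.1.le, hδ.2⟩)).1.const_mul δ⁻¹
      refine h1.congr (Eventually.of_forall fun t => ?_)
      simp only [Pi.sub_apply, inner_smul_right, inner_sub_right]
      ring
    · filter_upwards [hev] with δ hδ
      have hδ' : δ ∈ Ico (0 : ℝ) 1 := ⟨hδ.1.le, hδ.2⟩
      filter_upwards [ae_restrict_of_ae hφ0, ae_restrict_mem measurableSet_Ioi] with t h1 ht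
      have ht' : 0 ≤ t := le_of_lt ht
      rcases le_or_gt t Tstar with h | h
      · rw [hr00 t ht', norm_mul, Real.norm_eq_abs, Real.abs_exp]
        have e1 : Real.exp (-t) ≤ 1 := Real.exp_le_one_iff.2 (by linarith)
        have hb := hr0 δ hδ' t ht'
        have hb' := hle δ hδ' t ht'
        have hg : profile T (r δ t) ≤ profile T Tstar :=
          monotoneOn_profile hT hb (ht'.trans h) (hb'.trans h)
        have hgn := profile_nonneg hT hb
        have hM0 : 0 ≤ M := (norm_nonneg _).trans (hM t ⟨ht', h⟩)
        have e2 : ‖u.u t - u.u (r δ t)‖ ≤ M * (δ * profile T Tstar) := by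
          rw [u.u_sub hb ht']
          refine (intervalIntegral.norm_integral_le_of_norm_le_const (C := M) ?_).trans ?_
          · intro x hx
            rw [uIoc_of_le hb'] at hx
            exact hM x ⟨hb.trans hx.1.le, hx.2.trans h⟩
          · have : t - r δ t = δ * profile T (r δ t) := by linarith [hr δ hδ' t ht']
            rw [this, abs_of_nonneg (mul_nonneg hδ.1.le hgn)]
            have := hδ.1
            gcongr
        have e3 : ‖δ⁻¹ • (u.u t - u.u (r δ t))‖ ≤ M * profile T Tstar := by
          rw [norm_smul, Real.norm_eq_abs, abs_of_pos (inv_pos.2 hδ.1), inv_mul_le_iff₀ hδ.1]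
          linarith
        calc Real.exp (-t) * ‖inner ℝ (φ t) (δ⁻¹ • (u.u t - u.u (r δ t)))‖
            ≤ 1 * (‖φ t‖ * (M * profile T Tstar)) := by
              gcongr
              exact (norm_inner_le_norm _ _).trans (by gcongr)
          _ = _ := by ring
      · simp [h1 ht' h]
    · filter_upwards [ae_restrict_mem measurableSet_Ioi] with t ht
      have ht' : 0 ≤ t := le_of_lt ht
      refine Tendsto.const_mul _ ?_
      have hrt : Tendsto (fun δ => r δ t) (𝓝[>] 0) (𝓝 t) := by
        have h1 : Tendsto (fun δ : ℝ => t - δ * profile T t) (𝓝[>] 0) (𝓝 t) := by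
          have : Tendsto (fun δ : ℝ => t - δ * profile T t) (𝓝 0) (𝓝 (t - 0 * profile T t)) :=
            (Continuous.tendsto (by fun_prop) 0)
          simpa using this.mono_left nhdsWithin_le_nhds
        refine tendsto_of_tendsto_of_tendsto_of_le_of_le' h1 tendsto_const_nhds ?_ ?_
        · filter_upwards [hev] with δ hδ
          have hδ' : δ ∈ Ico (0 : ℝ) 1 := ⟨hδ.1.le, hδ.2⟩
          have := monotoneOn_profile hT (hr0 δ hδ' t ht') ht' (hle δ hδ' t ht')
          have := mul_le_mul_of_nonneg_left this hδ.1.le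
          linarith [hr δ hδ' t ht']
        · filter_upwards [hev] with δ hδ
          exact hle δ ⟨hδ.1.le, hδ.2⟩ t ht'
      -- The slope of δ ↦ r δ t at 0 is exactly -g(r δ t), so continuity of g and r δ t → t suffice;
      -- no implicit function theorem is involved.
      have hrd : HasDerivWithinAt (fun δ => r δ t) (-profile T t) (Ioi 0) 0 := by
        rw [hasDerivWithinAt_iff_tendsto_slope' (by simp)]
        refine (((continuous_profile T).tendsto t).comp hrt).neg.congr' ?_
        filter_upwards [hev] with δ hδ
        have hδ' : δ ∈ Ico (0 : ℝ) 1 := ⟨hδ.1.le, hδ.2⟩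
        have := hr δ hδ' t ht'
        have := hδ.1.ne'
        rw [slope_def_field, hr00 t ht', sub_zero, eq_div_iff this]
        simp only [Function.comp]
        linarith
      have hud : HasDerivAt u.u (u.u' t) (r 0 t) := by rw [hr00 t ht']; exact u.hasDerivAt_u ht
      have hcomp := hud.scomp_hasDerivWithinAt 0 hrd
      rw [hasDerivWithinAt_iff_tendsto_slope' (by simp)] at hcomp
      have h2 : Tendsto (fun δ => inner ℝ (φ t) (-slope (u.u ∘ fun δ => r δ t) 0 δ)) (𝓝[>] 0)
          (𝓝 (inner ℝ (φ t) (-(-profile T t • u.u' t)))) :=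
        tendsto_const_nhds.inner hcomp.neg
      rw [neg_smul, neg_neg, inner_smul_right] at h2
      refine h2.congr fun δ => ?_
      rw [slope_def_module, sub_zero, ← smul_neg, neg_sub]
      rfl
  refine key.congr' ?_
  filter_upwards [hev] with δ hδ
  rw [hS0, ← integral_sub (hint 0 h0) (hint δ ⟨hδ.1.le, hδ.2⟩), div_eq_inv_mul,
    ← integral_const_mul]
  congr 1; ext t
  simp only [inner_smul_right, inner_sub_right]
  ring

/-! ### The first order condition for minimizers -/

theorem toReal_sub_le_of_coe_sub_le {a b : ℝ≥0∞} {s t : ℝ} (ha : a ≠ ⊤) (hb : b ≠ ⊤)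
    (h : (a : EReal) - (s : EReal) ≤ (b : EReal) - (t : EReal)) :
    a.toReal - s ≤ b.toReal - t := by
  lift a to NNReal using ha
  lift b to NNReal using hb
  rw [EReal.coe_nnreal_eq_coe_real, EReal.coe_nnreal_eq_coe_real, ← EReal.coe_sub,
    ← EReal.coe_sub, EReal.coe_le_coe_iff] at h
  exact h

/-- Expansion of the transformed acceleration with x = δ g' and y = δ g''. The Jacobian 1 + x times
the fourth power of its inverse leaves (1 + x)⁻³, whence the coefficient 1 - 3x. Everything of
second order is bounded by the last bracket, which is nonnegative and quadratic in δ. -/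
theorem mul_norm_sq_reparam_le {H : Type*} [NormedAddCommGroup H] [InnerProductSpace ℝ H]
    (a b : H) {x y : ℝ} (hx : 0 ≤ x) (hy : 0 ≤ y) :
    (1 + x) * ‖(1 + x)⁻¹ ^ 2 • (a - (y * (1 + x)⁻¹) • b)‖ ^ 2 ≤
      (1 - 3 * x) * ‖a‖ ^ 2 - 2 * y * inner ℝ b a +
        (6 * x ^ 2 * ‖a‖ ^ 2 + 4 * (x * y) * (‖a‖ ^ 2 + ‖b‖ ^ 2) + y ^ 2 * ‖b‖ ^ 2) := by
  have hpos : 0 < 1 + x := by linarith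
  set q := (1 + x)⁻¹ with hq
  have hq0 : 0 < q := inv_pos.2 hpos
  have hqx : (1 + x) * q = 1 := mul_inv_cancel₀ hpos.ne'
  have hq1 : q ≤ 1 := inv_le_one_of_one_le₀ (by linarith)
  rw [norm_smul, mul_pow, norm_sub_sq_real, inner_smul_right, norm_smul, mul_pow, Real.norm_eq_abs,
    Real.norm_eq_abs, sq_abs, sq_abs, real_inner_comm]
  set A := ‖a‖ ^ 2 with hA
  set B := ‖b‖ ^ 2 with hB
  set I := inner ℝ b a with hI
  have hA0 : 0 ≤ A := by positivity
  have hB0 : 0 ≤ B := by positivity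
  have hIab : |I| ≤ (A + B) / 2 := by
    have h1 := abs_real_inner_le_norm b a
    nlinarith [sq_nonneg (‖a‖ - ‖b‖)]
  have e : (1 + x) * ((q ^ 2) ^ 2 * (A - 2 * (y * q * I) + (y * q) ^ 2 * B)) =
      q ^ 3 * A - 2 * y * (q ^ 4 * I) + y ^ 2 * q ^ 5 * B := by
    linear_combination (q ^ 3 * (A - 2 * (y * q * I) + (y * q) ^ 2 * B)) * hqx
  rw [e]
  have h3 : q ^ 3 ≤ 1 - 3 * x + 6 * x ^ 2 := by
    rw [hq, inv_pow, inv_le_iff_one_le_mul₀ (by positivity)]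
    nlinarith [pow_nonneg hx 3, pow_nonneg hx 4, pow_nonneg hx 5]
  have hq1x : 1 - q ≤ x := by nlinarith
  have h4 : 1 - q ^ 4 ≤ 4 * x := by
    have h2 : q ^ 2 ≤ 1 := pow_le_one₀ hq0.le hq1
    have h3 : q ^ 3 ≤ 1 := pow_le_one₀ hq0.le hq1
    nlinarith
  have h4' : 0 ≤ 1 - q ^ 4 := by linarith [pow_le_one₀ hq0.le hq1 (n := 4)]
  have h5 : q ^ 5 ≤ 1 := pow_le_one₀ hq0.le hq1
  have t1 : q ^ 3 * A ≤ (1 - 3 * x + 6 * x ^ 2) * A := mul_le_mul_of_nonneg_right h3 hA0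
  have t2 : (1 - q ^ 4) * I ≤ 4 * x * ((A + B) / 2) :=
    (le_abs_self _).trans (by rw [abs_mul, abs_of_nonneg h4']; gcongr)
  have t3 : 2 * y * ((1 - q ^ 4) * I) ≤ 2 * y * (4 * x * ((A + B) / 2)) :=
    mul_le_mul_of_nonneg_left t2 (by positivity)
  have t4 : y ^ 2 * q ^ 5 * B ≤ y ^ 2 * B := by
    have : y ^ 2 * B * q ^ 5 ≤ y ^ 2 * B := mul_le_of_le_one_right (by positivity) h5
    linarith
  linarith

section InnerVariation

variable {n : ℕ} {W : L2 n → ℝ≥0∞} {φ : ℝ → L2 n} {w₀ w₁ : L2 n} {ε : ℝ} {u : H2loc (L2 n)}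

/-- The density `‖u''‖² / (2ε²)`. -/
noncomputable def accel (ε : ℝ) (u : H2loc (L2 n)) (s : ℝ) : ℝ := 1 / (2 * ε ^ 2) * ‖u.u'' s‖ ^ 2

/-- The kinetic energy `‖u'‖² / (2ε²)`. -/
noncomputable def kinetic (ε : ℝ) (u : H2loc (L2 n)) (s : ℝ) : ℝ := 1 / (2 * ε ^ 2) * ‖u.u' s‖ ^ 2

/-- The potential energy along `u`. -/
noncomputable def potential (W : L2 n → ℝ≥0∞) (u : H2loc (L2 n)) (s : ℝ) : ℝ :=
  (W (u.u s)).toReal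

theorem accel_nonneg (s : ℝ) : 0 ≤ accel ε u s := by unfold accel; positivity

theorem kinetic_nonneg (s : ℝ) : 0 ≤ kinetic ε u s := by unfold kinetic; positivity

theorem potential_nonneg (s : ℝ) : 0 ≤ potential W u s := ENNReal.toReal_nonneg

theorem aemeasurable_accel : AEMeasurable (accel ε u) (volume.restrict (Ioi 0)) :=
  ((u.aestronglyMeasurable_u''.norm.aemeasurable.pow_const 2).const_mul _)

theorem lintegral_accel_add_lintegral_potential :
    Hfun W ε u = (∫⁻ t in Ioi (0 : ℝ), ENNReal.ofReal (Real.exp (-t) * accel ε u t)) +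
      ∫⁻ t in Ioi (0 : ℝ), ENNReal.ofReal (Real.exp (-t)) * W (u.u t) := by
  rw [Hfun, ← lintegral_add_left']
  · refine lintegral_congr fun t => ?_
    rw [mul_add, ENNReal.ofReal_mul (Real.exp_pos _).le, accel]
  · exact ((Measurable.aemeasurable (by fun_prop)).mul aemeasurable_accel).ennreal_ofReal

theorem integrableOn_exp_mul_accel (hfin : Hfun W ε u ≠ ⊤) :
    IntegrableOn (fun t => Real.exp (-t) * accel ε u t) (Ioi 0) := by
  rw [lintegral_accel_add_lintegral_potential] at hfin
  refine ⟨((Measurable.aemeasurable (by fun_prop)).mul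
    aemeasurable_accel).aestronglyMeasurable, ?_⟩
  rw [hasFiniteIntegral_iff_ofReal (Eventually.of_forall fun t =>
    mul_nonneg (Real.exp_pos _).le (accel_nonneg t))]
  exact (le_self_add.trans_lt (lt_top_iff_ne_top.2 hfin))

theorem ae_lt_top_potential (hfin : Hfun W ε u ≠ ⊤)
    (hWm : AEMeasurable (fun t => W (u.u t)) (volume.restrict (Ioi 0))) :
    ∀ᵐ t ∂(volume.restrict (Ioi (0 : ℝ))), W (u.u t) < ⊤ := by
  rw [lintegral_accel_add_lintegral_potential] at hfin
  have h1 := ae_lt_top' (AEMeasurable.mul (by fun_prop) hWm) (ne_top_of_le_ne_top hfin le_add_self)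
  filter_upwards [h1] with t ht
  by_contra h
  rw [not_lt, top_le_iff] at h
  simp [h, Real.exp_pos] at ht

theorem integrableOn_exp_mul_potential (hfin : Hfun W ε u ≠ ⊤)
    (hWm : AEMeasurable (fun t => W (u.u t)) (volume.restrict (Ioi 0))) :
    IntegrableOn (fun t => Real.exp (-t) * potential W u t) (Ioi 0) := by
  have hae := ae_lt_top_potential hfin hWm
  rw [lintegral_accel_add_lintegral_potential] at hfin
  refine ⟨((Measurable.aemeasurable (by fun_prop)).mul
    hWm.ennreal_toReal).aestronglyMeasurable, ?_⟩
  rw [hasFiniteIntegral_iff_ofReal (Eventually.of_forall fun t =>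
    mul_nonneg (Real.exp_pos _).le (potential_nonneg t))]
  refine (le_of_eq ?_).trans_lt (le_add_self.trans_lt (lt_top_iff_ne_top.2 hfin))
  refine lintegral_congr_ae ?_
  filter_upwards [hae] with t ht
  rw [ENNReal.ofReal_mul (Real.exp_pos _).le, potential, ENNReal.ofReal_toReal ht.ne]

theorem toReal_Hfun (hfin : Hfun W ε u ≠ ⊤)
    (hWm : AEMeasurable (fun t => W (u.u t)) (volume.restrict (Ioi 0))) :
    (Hfun W ε u).toReal =
      ∫ t in Ioi (0 : ℝ), Real.exp (-t) * (accel ε u t + potential W u t) := by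
  have h1 := integrableOn_exp_mul_accel hfin
  have h2 := integrableOn_exp_mul_potential hfin hWm
  have h3 : Hfun W ε u = ENNReal.ofReal
      (∫ t in Ioi (0 : ℝ), Real.exp (-t) * (accel ε u t + potential W u t)) := by
    rw [ofReal_integral_eq_lintegral_ofReal]
    · rw [Hfun]
      refine lintegral_congr_ae ?_
      filter_upwards [ae_lt_top_potential hfin hWm] with t ht
      rw [ENNReal.ofReal_mul (Real.exp_pos _).le, ENNReal.ofReal_add (accel_nonneg t)
        (potential_nonneg t), potential, ENNReal.ofReal_toReal ht.ne, accel]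
    · refine (h1.add h2).congr (Eventually.of_forall fun t => ?_)
      simp only [Pi.add_apply]; ring
    · exact Eventually.of_forall fun t => mul_nonneg (Real.exp_pos _).le
        (add_nonneg (accel_nonneg t) (potential_nonneg t))
  rw [h3, ENNReal.toReal_ofReal]
  exact integral_nonneg fun t => mul_nonneg (Real.exp_pos _).le
    (add_nonneg (accel_nonneg t) (potential_nonneg t))

/-- The substitution t = e(s) brings 𝒲 back to the points u(s): the variation changes only the
weight in front of the potential. -/
theorem Hfun_reparam {v : H2loc (L2 n)} (e : ℝ ≃o ℝ) {p : ℝ → ℝ}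
    (he : ∀ s, HasDerivAt e (p s) s) (h0 : e 0 = 0) (hp : ∀ s, 0 ≤ s → 0 ≤ p s)
    (hv : ∀ s, v.u (e s) = u.u s) :
    Hfun W ε v = ∫⁻ s in Ioi (0 : ℝ), ENNReal.ofReal (p s * Real.exp (-(e s))) *
      (ENNReal.ofReal (accel ε v (e s)) + W (u.u s)) := by
  have h2 : e '' Ioi 0 = Ioi 0 := by rw [OrderIso.image_Ioi, h0]
  rw [Hfun]
  conv_lhs => rw [← h2]
  rw [lintegral_image_eq_lintegral_abs_deriv_mul measurableSet_Ioi
    (fun x _ => (he x).hasDerivWithinAt) e.injective.injOn]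
  refine setLIntegral_congr_fun measurableSet_Ioi fun s hs => ?_
  have := hp s (le_of_lt hs)
  simp only [hv, accel]
  rw [abs_of_nonneg this, ENNReal.ofReal_mul this, mul_assoc]

/-- Meant for the terms containing g'', which vanishes from time T on, so that local boundedness of
u' is enough. -/
theorem integrableOn_bounded_support {f : ℝ → ℝ} {T M : ℝ} {c : ℝ → ℝ} (hc : Measurable c)
    (hcM : ∀ s, |c s| ≤ M) (hc0 : ∀ s, T ≤ s → c s = 0) (hf : ContinuousOn f (Ici 0)) :
    IntegrableOn (fun s => c s * f s) (Ioi 0) := by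
  obtain ⟨B, hB⟩ := isCompact_Icc.exists_bound_of_continuousOn
    (hf.mono (Icc_subset_Ici_self : Icc 0 T ⊆ _))
  have h : IntegrableOn (fun s => (Ioc 0 T).indicator (fun _ => M * B) s) (Ioi 0) :=
    ((integrable_indicator_iff measurableSet_Ioc).2
      (integrableOn_const (by simp))).integrableOn
  refine h.mono' (hc.aestronglyMeasurable.mul
    ((hf.mono Ioi_subset_Ici_self).aestronglyMeasurable measurableSet_Ioi)) ?_
  filter_upwards [ae_restrict_mem measurableSet_Ioi] with s hs
  rcases le_or_gt T s with h | h
  · rw [hc0 s h, zero_mul, norm_zero]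
    refine indicator_nonneg (fun x hx => ?_) _
    exact mul_nonneg ((abs_nonneg _).trans (hcM 0))
      ((norm_nonneg _).trans (hB x (Ioc_subset_Icc_self hx)))
  · rw [indicator_of_mem (show s ∈ Ioc 0 T from ⟨hs, h.le⟩), norm_mul]
    exact mul_le_mul (hcM s) (hB s ⟨le_of_lt hs, h.le⟩) (norm_nonneg _)
      ((abs_nonneg _).trans (hcM s))

end InnerVariation

section InnerVariationInequality

variable {n : ℕ} {W : L2 n → ℝ≥0∞} {φ : ℝ → L2 n} {w₀ w₁ : L2 n} {ε : ℝ} {u : H2loc (L2 n)}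

theorem integrableOn_bdd_mul {f c : ℝ → ℝ} {M : ℝ} (hf : IntegrableOn f (Ioi 0))
    (hc : Measurable c) (hM : ∀ s, 0 ≤ s → |c s| ≤ M) :
    IntegrableOn (fun s => c s * f s) (Ioi 0) :=
  hf.bdd_mul hc.aestronglyMeasurable (by
    filter_upwards [ae_restrict_mem measurableSet_Ioi] with s hs using hM s (le_of_lt hs))

theorem abs_profileDeriv_le {T s : ℝ} (hT : 0 ≤ T) (hs : 0 ≤ s) :
    |profileDeriv T s| ≤ Real.exp T := by
  rw [abs_of_nonneg (profileDeriv_nonneg hT hs)]; exact profileDeriv_le T s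

theorem abs_profileDeriv2_le (T s : ℝ) : |profileDeriv2 T s| ≤ Real.exp T := by
  rw [abs_of_nonneg (profileDeriv2_nonneg T s)]; exact profileDeriv2_le T s

theorem profileDeriv2_eq_zero {T s : ℝ} (h : T ≤ s) : profileDeriv2 T s = 0 :=
  if_neg (not_lt.2 h)

theorem integrableOn_exp_mul_profileDeriv2_mul_inner (hfin : Hfun W ε u ≠ ⊤) (hε : 0 < ε)
    (T : ℝ) : IntegrableOn
      (fun s => Real.exp (-s) * (profileDeriv2 T s * (1 / ε ^ 2 * inner ℝ (u.u' s) (u.u'' s))))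
      (Ioi 0) := by
  have hA := integrableOn_bdd_mul (integrableOn_exp_mul_accel hfin) (measurable_profileDeriv2 T)
    (fun s _ => abs_profileDeriv2_le T s)
  have hB := integrableOn_bounded_support (measurable_profileDeriv2 T) (abs_profileDeriv2_le T)
    (fun s => profileDeriv2_eq_zero) (f := fun s => Real.exp (-s) * kinetic ε u s) (by
      have := u.continuousOn_u'; unfold kinetic; fun_prop)
  refine (hA.add hB).mono' ?_ (Eventually.of_forall fun s => ?_)
  · have h1 : AEStronglyMeasurable (fun s => inner ℝ (u.u' s) (u.u'' s))
        (volume.restrict (Ioi 0)) :=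
      ((u.continuousOn_u'.mono Ioi_subset_Ici_self).aestronglyMeasurable
        measurableSet_Ioi).inner u.aestronglyMeasurable_u''
    exact AEStronglyMeasurable.mul (by fun_prop)
      ((measurable_profileDeriv2 T).aestronglyMeasurable.mul (h1.const_mul _))
  · have h1 : |inner ℝ (u.u' s) (u.u'' s)| ≤ (‖u.u'' s‖ ^ 2 + ‖u.u' s‖ ^ 2) / 2 := by
      have h1 := abs_real_inner_le_norm (u.u' s) (u.u'' s)
      nlinarith [sq_nonneg (‖u.u' s‖ - ‖u.u'' s‖)]
    have h2 := profileDeriv2_nonneg T s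
    simp only [Pi.add_apply]
    rw [norm_mul, norm_mul, norm_mul, Real.norm_eq_abs, Real.norm_eq_abs, Real.norm_eq_abs,
      Real.norm_eq_abs, Real.abs_exp, abs_of_nonneg h2,
      abs_of_pos (show 0 < 1 / ε ^ 2 by positivity)]
    calc Real.exp (-s) * (profileDeriv2 T s * (1 / ε ^ 2 * |inner ℝ (u.u' s) (u.u'' s)|))
        ≤ Real.exp (-s) * (profileDeriv2 T s *
            (1 / ε ^ 2 * ((‖u.u'' s‖ ^ 2 + ‖u.u' s‖ ^ 2) / 2))) := by gcongr
      _ = _ := by unfold accel kinetic; field_simp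

theorem exp_mul_profileDeriv2 (T s : ℝ) (x : ℝ) :
    Real.exp (-s) * (profileDeriv2 T s * x) = if s < T then x else 0 := by
  unfold profileDeriv2
  split_ifs
  · rw [← mul_assoc, ← Real.exp_add]; simp
  · simp

/-- The weight is built so that e^{-s} g''(s) is the indicator of s < T; what remains is the
derivative of the kinetic energy. -/
theorem integral_exp_mul_profileDeriv2_mul_inner (hε : 0 < ε) {T : ℝ} (hT : 0 ≤ T) :
    ∫ s in Ioi (0 : ℝ), Real.exp (-s) *
      (profileDeriv2 T s * (1 / ε ^ 2 * inner ℝ (u.u' s) (u.u'' s))) =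
        kinetic ε u T - kinetic ε u 0 := by
  have h := u.integral_inner_u'_u'' hT
  rw [intervalIntegral.integral_of_le hT, integral_Ioc_eq_integral_Ioo] at h
  calc ∫ s in Ioi (0 : ℝ), Real.exp (-s) *
      (profileDeriv2 T s * (1 / ε ^ 2 * inner ℝ (u.u' s) (u.u'' s)))
      = ∫ s in Ioi (0 : ℝ), (Iio T).indicator
          (fun s => 1 / (2 * ε ^ 2) * (2 * inner ℝ (u.u' s) (u.u'' s))) s := by
        congr 1; ext s
        rw [exp_mul_profileDeriv2, indicator_apply]
        simp only [mem_Iio]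
        congr 1
        field_simp
    _ = ∫ s in Ioo (0 : ℝ) T, 1 / (2 * ε ^ 2) * (2 * inner ℝ (u.u' s) (u.u'' s)) := by
        rw [integral_indicator measurableSet_Iio, Measure.restrict_restrict measurableSet_Iio,
          inter_comm, Ioi_inter_Iio]
    _ = _ := by rw [integral_const_mul, h]; unfold kinetic; ring

/-- First order condition for minimizers with respect to the inner variations
`s ↦ s + δ * profile T s`, `δ > 0`. -/
theorem inner_variation_inequality (hε : 0 < ε) (hmin : IsMinimizer W φ w₀ w₁ ε u)
    (hfin : Hfun W ε u ≠ ⊤)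
    (hWm : AEMeasurable (fun t => W (u.u t)) (volume.restrict (Ioi 0)))
    {Tstar : ℝ} (hφ : IntegrableOn φ (Ioi 0))
    (hφ0 : ∀ᵐ t : ℝ, 0 ≤ t → Tstar < t → φ t = 0) {T : ℝ} (hT : 0 ≤ T) :
    IntegrableOn (fun s => profile T s * (Real.exp (-s) * (accel ε u s + potential W u s)))
      (Ioi 0) ∧
    (∫ s in Ioi (0 : ℝ), profile T s * (Real.exp (-s) * (accel ε u s + potential W u s))) +
        kinetic ε u T ≤
      kinetic ε u 0 +
        (∫ s in Ioi (0 : ℝ), profileDeriv T s *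
          (Real.exp (-s) * (potential W u s - 3 * accel ε u s))) +
        ∫ s in Ioi (0 : ℝ), Real.exp (-s) * (profile T s * inner ℝ (φ s) (u.u' s)) := by
  have hc : 0 < 1 / (2 * ε ^ 2) := by positivity
  have iA := integrableOn_exp_mul_accel hfin
  have iW := integrableOn_exp_mul_potential hfin hWm
  have iL : IntegrableOn (fun s => Real.exp (-s) * (accel ε u s + potential W u s)) (Ioi 0) :=
    (iA.add iW).congr (Eventually.of_forall fun s => by simp only [Pi.add_apply]; ring)
  have m1 := (continuous_profileDeriv T).measurable
  have m2 := measurable_profileDeriv2 T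
  have iP : IntegrableOn (fun s => profileDeriv T s *
      (Real.exp (-s) * (potential W u s - 3 * accel ε u s))) (Ioi 0) := by
    refine integrableOn_bdd_mul ?_ m1 (fun s hs => abs_profileDeriv_le hT hs)
    exact (iW.sub (iA.const_mul 3)).congr (Eventually.of_forall fun s => by
      simp only [Pi.sub_apply]; ring)
  have iC := integrableOn_exp_mul_profileDeriv2_mul_inner hfin hε T
  have ck : ContinuousOn (kinetic ε u) (Ici 0) := by
    have := u.continuousOn_u'; unfold kinetic; fun_prop
  -- Q is the coefficient of δ in the expansion of the varied integrand, apart from the factor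
  -- exp(-δ g).
  set Q : ℝ → ℝ := fun s => profileDeriv T s *
      (Real.exp (-s) * (potential W u s - 3 * accel ε u s)) -
      Real.exp (-s) * (profileDeriv2 T s * (1 / ε ^ 2 * inner ℝ (u.u' s) (u.u'' s))) with hQ
  -- R collects the quadratic remainder of `mul_norm_sq_reparam_le`. Its kinetic part always
  -- contains a factor g'', hence has bounded support.
  set R : ℝ → ℝ := fun s => (6 * profileDeriv T s ^ 2 + 4 * (profileDeriv T s *
      profileDeriv2 T s)) * (Real.exp (-s) * accel ε u s) +
      (4 * (profileDeriv T s * profileDeriv2 T s) + profileDeriv2 T s ^ 2) *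
        (Real.exp (-s) * kinetic ε u s) with hR
  have hE := Real.exp_pos T
  have b1 : ∀ s, |profileDeriv T s| ≤ Real.exp T + 1 := fun s => by
    have := neg_one_lt_profileDeriv T s
    have := profileDeriv_le T s
    rw [abs_le]; constructor <;> linarith
  have b2 := abs_profileDeriv2_le T
  have b3 : ∀ s, |profileDeriv T s * profileDeriv2 T s| ≤ (Real.exp T + 1) * Real.exp T :=
    fun s => by rw [abs_mul]; exact mul_le_mul (b1 s) (b2 s) (abs_nonneg _) (by positivity)
  have b4 : ∀ s, |profileDeriv2 T s ^ 2| ≤ Real.exp T ^ 2 := fun s => by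
    rw [abs_pow]; exact pow_le_pow_left₀ (abs_nonneg _) (b2 s) 2
  have b5 : ∀ s, |profileDeriv T s ^ 2| ≤ (Real.exp T + 1) ^ 2 := fun s => by
    rw [abs_pow]; exact pow_le_pow_left₀ (abs_nonneg _) (b1 s) 2
  have iR : IntegrableOn R (Ioi 0) := by
    refine Integrable.add ?_ ?_
    · refine integrableOn_bdd_mul iA (by fun_prop)
        (M := 6 * (Real.exp T + 1) ^ 2 + 4 * ((Real.exp T + 1) * Real.exp T)) fun s _ => ?_
      refine (abs_add_le _ _).trans ?_
      rw [abs_mul, abs_mul, abs_of_pos (by norm_num : (0 : ℝ) < 6),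
        abs_of_pos (by norm_num : (0 : ℝ) < 4)]
      linarith [b3 s, b5 s]
    · refine integrableOn_bounded_support (T := T) (by fun_prop)
        (M := 4 * ((Real.exp T + 1) * Real.exp T) + Real.exp T ^ 2) (fun s => ?_)
        (fun s hs => ?_) (by fun_prop)
      · refine (abs_add_le _ _).trans ?_
        rw [abs_mul, abs_of_pos (by norm_num : (0 : ℝ) < 4)]
        linarith [b3 s, b4 s]
      · rw [profileDeriv2_eq_zero hs]; ring
  have hr : ∀ δ : ℝ, ∃ r : ℝ → ℝ, δ ∈ Ico (0 : ℝ) 1 → Continuous r ∧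
      (∀ t, 0 ≤ t → 0 ≤ r t) ∧ (∀ t, 0 ≤ t → r t + δ * profile T (r t) = t) ∧
      (0 < δ → (∫ s in Ioi (0 : ℝ), Real.exp (-s) * (accel ε u s + potential W u s)) -
          Sfun φ u ≤ (∫ s in Ioi (0 : ℝ), (Real.exp (-(δ * profile T s)) *
            (Real.exp (-s) * (accel ε u s + potential W u s) + δ * Q s) + δ ^ 2 * R s)) -
          ∫ t in Ioi (0 : ℝ), Real.exp (-t) * inner ℝ (φ t) (u.u (r t))) := by
    intro δ
    by_cases hδ : δ ∈ Ioo (0 : ℝ) 1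
    swap
    -- Outside (0, 1) only δ = 0 carries a condition, and the identity is the inverse time change
    -- there. The family must include δ = 0 because `tendsto_source_variation` takes its base point
    -- from it.
    · refine ⟨id, fun h => ⟨continuous_id, fun t ht => ht, ?_, fun h0 => absurd ⟨h0, h.2⟩ hδ⟩⟩
      have : δ = 0 := by
        rcases h.1.eq_or_lt with h0 | h0
        · exact h0.symm
        · exact absurd ⟨h0, h.2⟩ hδ
      simp [this]
    obtain ⟨hδ0, hδ1⟩ := hδ
    obtain ⟨e, v, he, hv0, hv0', hv, hv''⟩ := u.exists_inner_variation hT hδ0 hδ1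
    have he0 : e 0 = 0 := by simp [he, profile_zero hT]
    have hes : e.symm 0 = 0 := by rw [← he0, e.symm_apply_apply, he0]
    refine ⟨e.symm, fun _ => ⟨e.symm.continuous, fun t ht => hes ▸ e.symm.monotone ht,
      fun t _ => by rw [← he, e.apply_symm_apply], fun _ => ?_⟩⟩
    have hJ := hmin.2 v ⟨hv0.trans hmin.1.1, hv0'.trans hmin.1.2⟩
    set m : ℝ → ℝ := fun s => Real.exp (-(δ * profile T s)) *
            (Real.exp (-s) * (accel ε u s + potential W u s) + δ * Q s) + δ ^ 2 * R s with hm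
    have hexp : ∀ s, 0 ≤ s → Real.exp (-(δ * profile T s)) ≤ 1 := fun s hs =>
      Real.exp_le_one_iff.2 (by linarith [mul_nonneg hδ0.le (profile_nonneg hT hs)])
    have im : IntegrableOn m (Ioi 0) := by
      refine Integrable.add (integrableOn_bdd_mul (M := 1) (iL.add ((iP.sub iC).const_mul δ)) ?_
        fun s hs => ?_) (iR.const_mul _)
      · have := (continuous_profile T).measurable; fun_prop
      · rw [Real.abs_exp]; exact hexp s hs
    have hpt : ∀ s, 0 ≤ s → (1 + δ * profileDeriv T s) * Real.exp (-(e s)) *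
        (accel ε v (e s) + potential W u s) ≤ m s := by
      intro s hs
      have hg1 := profileDeriv_nonneg hT hs
      have hg2 := profileDeriv2_nonneg T s
      have hR0 : 0 ≤ R s := by
        have := accel_nonneg (ε := ε) (u := u) s
        have := kinetic_nonneg (ε := ε) (u := u) s
        rw [hR]; positivity
      have key := mul_le_mul_of_nonneg_left (mul_norm_sq_reparam_le (u.u'' s) (u.u' s)
        (mul_nonneg hδ0.le hg1) (mul_nonneg hδ0.le hg2)) hc.le
      rw [← hv''] at key
      have hE1 : Real.exp (-(e s)) = Real.exp (-(δ * profile T s)) * Real.exp (-s) := by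
        rw [← Real.exp_add, he]; congr 1; ring
      have h2 := mul_le_mul_of_nonneg_left key (Real.exp_pos (-(e s))).le
      have h3 : Real.exp (-(δ * profile T s)) * (δ ^ 2 * R s) ≤ δ ^ 2 * R s :=
        -- Dropping the exponential in front of the remainder is allowed since R ≥ 0; it puts the
        -- bound into the form required by the abstract variation lemma.
        mul_le_of_le_one_left (by positivity) (hexp s hs)
      have h4 : Real.exp (-(e s)) * (1 / (2 * ε ^ 2) *
          ((1 - 3 * (δ * profileDeriv T s)) * ‖u.u'' s‖ ^ 2 -
            2 * (δ * profileDeriv2 T s) * inner ℝ (u.u' s) (u.u'' s) +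
            (6 * (δ * profileDeriv T s) ^ 2 * ‖u.u'' s‖ ^ 2 +
              4 * (δ * profileDeriv T s * (δ * profileDeriv2 T s)) *
                (‖u.u'' s‖ ^ 2 + ‖u.u' s‖ ^ 2) +
              (δ * profileDeriv2 T s) ^ 2 * ‖u.u' s‖ ^ 2))) +
          (1 + δ * profileDeriv T s) * Real.exp (-(e s)) * potential W u s =
          Real.exp (-(δ * profile T s)) *
            (Real.exp (-s) * (accel ε u s + potential W u s) + δ * Q s) +
          Real.exp (-(δ * profile T s)) * (δ ^ 2 * R s) := by
        rw [hE1, hQ, hR]; unfold accel kinetic; field_simp; ring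
      have h5 : accel ε v (e s) = 1 / (2 * ε ^ 2) * ‖v.u'' (e s)‖ ^ 2 := rfl
      rw [hm]; simp only
      rw [h5]
      linarith
    have hcov := Hfun_reparam (W := W) (ε := ε) (u := u) (v := v) e
      (p := fun s => 1 + δ * profileDeriv T s) (fun s => by
        have := (hasDerivAt_id s).add ((hasDerivAt_profile T s).const_mul δ)
        rwa [show (e : ℝ → ℝ) = fun s => s + δ * profile T s from funext he]) he0
      (fun s hs => by have := profileDeriv_nonneg hT hs; positivity)
      (fun s => by rw [hv, e.symm_apply_apply])
    have hle : Hfun W ε v ≤ ENNReal.ofReal (∫ s in Ioi (0 : ℝ), m s) := by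
      rw [ofReal_integral_eq_lintegral_ofReal im, hcov]
      · refine lintegral_mono_ae ?_
        filter_upwards [ae_lt_top_potential hfin hWm, ae_restrict_mem measurableSet_Ioi]
          with s hs hs0
        rw [← ENNReal.ofReal_toReal hs.ne, ← ENNReal.ofReal_add (accel_nonneg _)
          ENNReal.toReal_nonneg, ← ENNReal.ofReal_mul]
        · exact ENNReal.ofReal_le_ofReal (hpt s (le_of_lt hs0))
        · have := profileDeriv_nonneg hT (le_of_lt hs0); positivity
      · filter_upwards [ae_restrict_mem measurableSet_Ioi] with s hs0
        refine le_trans ?_ (hpt s (le_of_lt hs0))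
        have := profileDeriv_nonneg hT (le_of_lt hs0)
        have := accel_nonneg (ε := ε) (u := v) (e s)
        have := potential_nonneg (W := W) (u := u) s
        positivity
    have hm0 : 0 ≤ ∫ s in Ioi (0 : ℝ), m s := by
      refine setIntegral_nonneg measurableSet_Ioi fun s hs0 => ?_
      refine le_trans ?_ (hpt s (le_of_lt hs0))
      have := profileDeriv_nonneg hT (le_of_lt hs0)
      have := accel_nonneg (ε := ε) (u := v) (e s)
      have := potential_nonneg (W := W) (u := u) s
      positivity
    have h1 := toReal_sub_le_of_coe_sub_le hfin (ne_top_of_le_ne_top ENNReal.ofReal_ne_top hle) hJ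
    have h2 := ENNReal.toReal_le_of_le_ofReal hm0 hle
    have h3 : Sfun φ v = ∫ t in Ioi (0 : ℝ), Real.exp (-t) * inner ℝ (φ t) (u.u (e.symm t)) := by
      simp only [Sfun, hv]
    rw [toReal_Hfun hfin hWm, h3] at h1
    linarith
  choose r hr using hr
  have hmain := integrable_and_integral_le_of_variation iL (iP.sub iC) iR
    (g := profile T) (continuous_profile T).aestronglyMeasurable
    (by filter_upwards [ae_restrict_mem measurableSet_Ioi] with s hs
          using profile_nonneg hT (le_of_lt hs))
    (Eventually.of_forall fun s => mul_nonneg (Real.exp_pos _).le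
      (add_nonneg (accel_nonneg s) (potential_nonneg s)))
    (fun δ hδ => (hr δ ⟨hδ.1.le, hδ.2⟩).2.2.2 hδ.1)
    (u.tendsto_source_variation hT hφ hφ0 (fun δ hδ => (hr δ hδ).1)
      (fun δ hδ => (hr δ hδ).2.1) (fun δ hδ => (hr δ hδ).2.2.1))
  refine ⟨hmain.1, ?_⟩
  have h1 := hmain.2
  have h2 := integral_sub iP iC
  rw [integral_exp_mul_profileDeriv2_mul_inner hε hT] at h2
  simp only [Pi.sub_apply] at h1
  linarith

end InnerVariationInequality

/-! ### Tonelli's theorem and the exponential kernels -/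

theorem lintegral_Ioi_lintegral_Ioi_eq {F : ℝ → ℝ → ℝ≥0∞} (hF : Measurable (Function.uncurry F))
    (a : ℝ) : ∫⁻ r in Ioi a, ∫⁻ s in Ioi r, F r s = ∫⁻ s in Ioi a, ∫⁻ r in Ioo a s, F r s := by
  have hm : Measurable (Function.uncurry fun r s : ℝ => if a < r ∧ r < s then F r s else 0) := by
    refine Measurable.ite ?_ hF measurable_const
    exact (measurableSet_lt measurable_const measurable_fst).inter
      (measurableSet_lt measurable_fst measurable_snd)
  have h1 : ∫⁻ r in Ioi a, ∫⁻ s in Ioi r, F r s =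
      ∫⁻ r, ∫⁻ s, if a < r ∧ r < s then F r s else 0 := by
    rw [← lintegral_indicator measurableSet_Ioi]
    refine lintegral_congr fun r => ?_
    by_cases hr : a < r
    · rw [indicator_of_mem (mem_Ioi.2 hr), ← lintegral_indicator measurableSet_Ioi]
      refine lintegral_congr fun s => ?_
      simp [indicator_apply, hr]
    · simp [hr]
  have h2 : ∫⁻ s in Ioi a, ∫⁻ r in Ioo a s, F r s =
      ∫⁻ s, ∫⁻ r, if a < r ∧ r < s then F r s else 0 := by
    rw [← lintegral_indicator measurableSet_Ioi]
    refine lintegral_congr fun s => ?_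
    by_cases hs : a < s
    · rw [indicator_of_mem (mem_Ioi.2 hs), ← lintegral_indicator measurableSet_Ioo]
      refine lintegral_congr fun r => ?_
      simp [indicator_apply]
    · have : ∀ r, ¬ (a < r ∧ r < s) := fun r h => hs (h.1.trans h.2)
      simp [hs, this]
  rw [h1, h2, lintegral_lintegral_swap hm.aemeasurable]

theorem lintegral_Ioi_lintegral_Ioi_mul {k : ℝ → ℝ → ℝ≥0∞}
    (hk : Measurable (Function.uncurry k)) {h : ℝ → ℝ≥0∞} {a : ℝ}
    (hh : AEMeasurable h (volume.restrict (Ioi a))) :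
    ∫⁻ r in Ioi a, ∫⁻ s in Ioi r, k r s * h s =
      ∫⁻ s in Ioi a, (∫⁻ r in Ioo a s, k r s) * h s := by
  set h' := hh.mk h with hh'
  have hae : ∀ᵐ s, s ∈ Ioi a → h s = h' s := (ae_restrict_iff' measurableSet_Ioi).1 hh.ae_eq_mk
  have hm' : Measurable h' := hh.measurable_mk
  have e1 : ∫⁻ r in Ioi a, ∫⁻ s in Ioi r, k r s * h s =
      ∫⁻ r in Ioi a, ∫⁻ s in Ioi r, k r s * h' s := by
    refine setLIntegral_congr_fun measurableSet_Ioi fun r hr => ?_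
    refine setLIntegral_congr_fun_ae measurableSet_Ioi ?_
    filter_upwards [hae] with s hs hrs
    rw [hs ((mem_Ioi.1 hr).trans hrs)]
  rw [e1, lintegral_Ioi_lintegral_Ioi_eq (F := fun r s => k r s * h' s)
    (hk.mul (hm'.comp measurable_snd))]
  refine setLIntegral_congr_fun_ae measurableSet_Ioi ?_
  filter_upwards [hae] with s hs hrs
  rw [hs hrs]
  exact lintegral_mul_const _ (show Measurable fun r => k r s from
    hk.comp (measurable_id.prodMk measurable_const))

theorem lintegral_Ioi_lintegral_Ioo_mul {k : ℝ → ℝ → ℝ≥0∞}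
    (hk : Measurable (Function.uncurry k)) {h : ℝ → ℝ≥0∞} {a : ℝ}
    (hh : AEMeasurable h (volume.restrict (Ioi a))) :
    ∫⁻ s in Ioi a, ∫⁻ r in Ioo a s, k r s * h r =
      ∫⁻ r in Ioi a, (∫⁻ s in Ioi r, k r s) * h r := by
  set h' := hh.mk h with hh'
  have hae : ∀ᵐ s, s ∈ Ioi a → h s = h' s := (ae_restrict_iff' measurableSet_Ioi).1 hh.ae_eq_mk
  have hm' : Measurable h' := hh.measurable_mk
  have e1 : ∫⁻ s in Ioi a, ∫⁻ r in Ioo a s, k r s * h r =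
      ∫⁻ s in Ioi a, ∫⁻ r in Ioo a s, k r s * h' r := by
    refine setLIntegral_congr_fun measurableSet_Ioi fun s hs => ?_
    refine setLIntegral_congr_fun_ae measurableSet_Ioo ?_
    filter_upwards [hae] with r hr hrs
    rw [hr hrs.1]
  rw [e1, ← lintegral_Ioi_lintegral_Ioi_eq (F := fun r s => k r s * h' r)
    (hk.mul (hm'.comp measurable_fst))]
  refine setLIntegral_congr_fun_ae measurableSet_Ioi ?_
  filter_upwards [hae] with r hs hrs
  rw [hs hrs]
  exact lintegral_mul_const _ (show Measurable fun s => k r s from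
    hk.comp (measurable_const.prodMk measurable_id))

theorem lintegral_Ioo_ofReal_eq_sub {f f' : ℝ → ℝ} {a b : ℝ} (hab : a ≤ b)
    (hf : ∀ x, HasDerivAt f (f' x) x) (hc : Continuous f') (h0 : ∀ x ∈ Icc a b, 0 ≤ f' x) :
    ∫⁻ x in Ioo a b, ENNReal.ofReal (f' x) = ENNReal.ofReal (f b - f a) := by
  rw [← intervalIntegral.integral_eq_sub_of_hasDerivAt (fun x _ => hf x)
    (hc.intervalIntegrable a b), intervalIntegral.integral_of_le hab, integral_Ioc_eq_integral_Ioo,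
    ofReal_integral_eq_lintegral_ofReal]
  · exact (hc.integrableOn_Icc).mono_set Ioo_subset_Icc_self
  · filter_upwards [ae_restrict_mem measurableSet_Ioo] with x hx
    exact h0 x (Ioo_subset_Icc_self hx)

theorem lintegral_Ioi_ofReal_eq_sub {f f' : ℝ → ℝ} {a l : ℝ}
    (hf : ∀ x, HasDerivAt f (f' x) x) (h0 : ∀ x ∈ Ioi a, 0 ≤ f' x)
    (hl : Tendsto f atTop (𝓝 l)) :
    ∫⁻ x in Ioi a, ENNReal.ofReal (f' x) = ENNReal.ofReal (l - f a) := by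
  rw [← integral_Ioi_of_hasDerivAt_of_nonneg' (fun x _ => hf x) h0 hl,
    ofReal_integral_eq_lintegral_ofReal]
  · exact integrableOn_Ioi_deriv_of_nonneg' (fun x _ => hf x) h0 hl
  · filter_upwards [ae_restrict_mem measurableSet_Ioi] with x hx using h0 x hx

/-- Cauchy-Schwarz in squared form, so that infinite integrals need no separate treatment. -/
theorem lintegral_mul_sq_le {α : Type*} {m : MeasurableSpace α} {μ : Measure α}
    {f g : α → ℝ≥0∞} (hf : AEMeasurable f μ) (hg : AEMeasurable g μ) :
    (∫⁻ x, f x * g x ∂μ) ^ 2 ≤ (∫⁻ x, f x ^ 2 ∂μ) * ∫⁻ x, g x ^ 2 ∂μ := by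
  have h := ENNReal.lintegral_mul_le_Lp_mul_Lq μ Real.HolderConjugate.two_two hf hg
  have h2 := pow_le_pow_left₀ zero_le h 2
  simp only [Pi.mul_apply] at h2
  refine h2.trans_eq ?_
  rw [mul_pow, ← ENNReal.rpow_natCast, ← ENNReal.rpow_natCast, ← ENNReal.rpow_mul,
    ← ENNReal.rpow_mul]
  norm_num

theorem hasDerivAt_exp_kernel (c : ℝ) (r : ℝ) :
    HasDerivAt (fun r => Real.exp (-(c - r)) * (c - r + 1)) (Real.exp (-(c - r)) * (c - r)) r := by
  have h1 : HasDerivAt (fun r : ℝ => c - r) (-1) r := by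
    simpa using (hasDerivAt_id r).const_sub c
  have h2 := (h1.fun_neg.exp).fun_mul (h1.add_const 1)
  refine h2.congr_deriv ?_
  ring

/-- Exchanging the integrals leaves ∫ e^{-(s-t)}(s-t) dt over 0 < t < min(s, T), with antiderivative
e^{-(s-t)}(s-t+1). This is where `profile` comes from. -/
theorem lintegral_Ioc_avg_two {h : ℝ → ℝ≥0∞} (hh : AEMeasurable h (volume.restrict (Ioi 0)))
    {T : ℝ} (hT : 0 ≤ T) :
    ∫⁻ t in Ioc 0 T, ∫⁻ s in Ioi t, ENNReal.ofReal (Real.exp (-(s - t)) * (s - t)) * h s =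
      ∫⁻ s in Ioi (0 : ℝ), ENNReal.ofReal (profile T s * Real.exp (-s)) * h s := by
  have hk : Measurable (Function.uncurry fun t s : ℝ =>
      if t ≤ T then ENNReal.ofReal (Real.exp (-(s - t)) * (s - t)) else 0) :=
    Measurable.ite (measurableSet_le measurable_fst measurable_const) (by fun_prop)
      measurable_const
  have h1 := lintegral_Ioi_lintegral_Ioi_mul hk hh
  have e1 : ∫⁻ t in Ioc 0 T, ∫⁻ s in Ioi t,
      ENNReal.ofReal (Real.exp (-(s - t)) * (s - t)) * h s = ∫⁻ t in Ioi (0 : ℝ), ∫⁻ s in Ioi t,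
        (if t ≤ T then ENNReal.ofReal (Real.exp (-(s - t)) * (s - t)) else 0) * h s := by
    rw [← Ioi_inter_Iic, inter_comm, ← Measure.restrict_restrict measurableSet_Iic,
      ← lintegral_indicator measurableSet_Iic]
    refine lintegral_congr fun t => ?_
    by_cases ht : t ≤ T <;> simp [ht]
  rw [e1, h1]
  refine setLIntegral_congr_fun measurableSet_Ioi fun s hs => ?_
  have hs' : 0 ≤ s := le_of_lt hs
  congr 1
  -- The conditions r ≤ T and r < T differ only at the null point r = T.
  have e2 : ∫⁻ r in Ioo 0 s,
      (if r ≤ T then ENNReal.ofReal (Real.exp (-(s - r)) * (s - r)) else 0) =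
      ∫⁻ r in Ioo 0 (min s T), ENNReal.ofReal (Real.exp (-(s - r)) * (s - r)) := by
    rw [← lintegral_indicator measurableSet_Ioo, ← lintegral_indicator measurableSet_Ioo]
    refine lintegral_congr_ae ?_
    filter_upwards [Measure.ae_ne volume T] with r hr
    simp only [indicator_apply, mem_Ioo, lt_min_iff]
    by_cases h1 : 0 < r ∧ r < s
    · by_cases h2 : r < T
      · simp [h1, h2, h2.le]
      · simp [h1, h2, (lt_of_le_of_ne (not_lt.1 h2) hr.symm)]
    · have : ¬ (0 < r ∧ r < s ∧ r < T) := fun h => h1 ⟨h.1, h.2.1⟩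
      simp [h1, this]
  rw [e2, lintegral_Ioo_ofReal_eq_sub (le_min hs' hT) (hasDerivAt_exp_kernel s) (by fun_prop)
    (fun x hx => mul_nonneg (Real.exp_pos _).le (by linarith [hx.2, min_le_left s T]))]
  congr 1
  unfold profile
  rcases le_total s T with h | h
  · rw [min_eq_left h]
    simp only [sub_self, sub_zero, neg_zero, Real.exp_zero, mul_zero, add_zero]
    rw [sub_mul, sub_mul, ← Real.exp_add]; simp; ring
  · rw [min_eq_right h]
    simp only [sub_zero]
    rw [show -(s - T) = T + -s by ring, Real.exp_add]; ring

/-- One average less than before: the weight drops from g to g'. -/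
theorem lintegral_Ioc_avg {h : ℝ → ℝ≥0∞} (hh : AEMeasurable h (volume.restrict (Ioi 0)))
    {T : ℝ} (hT : 0 ≤ T) :
    ∫⁻ t in Ioc 0 T, ∫⁻ s in Ioi t, ENNReal.ofReal (Real.exp (-(s - t))) * h s =
      ∫⁻ s in Ioi (0 : ℝ), ENNReal.ofReal (profileDeriv T s * Real.exp (-s)) * h s := by
  have hk : Measurable (Function.uncurry fun t s : ℝ =>
      if t ≤ T then ENNReal.ofReal (Real.exp (-(s - t))) else 0) :=
    Measurable.ite (measurableSet_le measurable_fst measurable_const) (by fun_prop)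
      measurable_const
  have h1 := lintegral_Ioi_lintegral_Ioi_mul hk hh
  have e1 : ∫⁻ t in Ioc 0 T, ∫⁻ s in Ioi t,
      ENNReal.ofReal (Real.exp (-(s - t))) * h s = ∫⁻ t in Ioi (0 : ℝ), ∫⁻ s in Ioi t,
        (if t ≤ T then ENNReal.ofReal (Real.exp (-(s - t))) else 0) * h s := by
    rw [← Ioi_inter_Iic, inter_comm, ← Measure.restrict_restrict measurableSet_Iic,
      ← lintegral_indicator measurableSet_Iic]
    refine lintegral_congr fun t => ?_
    by_cases ht : t ≤ T <;> simp [ht]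
  rw [e1, h1]
  refine setLIntegral_congr_fun measurableSet_Ioi fun s hs => ?_
  have hs' : 0 ≤ s := le_of_lt hs
  congr 1
  have e2 : ∫⁻ r in Ioo 0 s, (if r ≤ T then ENNReal.ofReal (Real.exp (-(s - r))) else 0) =
      ∫⁻ r in Ioo 0 (min s T), ENNReal.ofReal (Real.exp (-(s - r))) := by
    rw [← lintegral_indicator measurableSet_Ioo, ← lintegral_indicator measurableSet_Ioo]
    refine lintegral_congr_ae ?_
    filter_upwards [Measure.ae_ne volume T] with r hr
    simp only [indicator_apply, mem_Ioo, lt_min_iff]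
    by_cases h1 : 0 < r ∧ r < s
    · by_cases h2 : r < T
      · simp [h1, h2, h2.le]
      · simp [h1, h2, (lt_of_le_of_ne (not_lt.1 h2) hr.symm)]
    · have : ¬ (0 < r ∧ r < s ∧ r < T) := fun h => h1 ⟨h.1, h.2.1⟩
      simp [h1, this]
  have hd : ∀ r, HasDerivAt (fun r => Real.exp (-(s - r))) (Real.exp (-(s - r))) r := fun r => by
    simpa using (((hasDerivAt_id r).const_sub s).fun_neg).exp
  rw [e2, lintegral_Ioo_ofReal_eq_sub (le_min hs' hT) hd (by fun_prop)
    (fun x hx => (Real.exp_pos _).le)]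
  congr 1
  unfold profileDeriv
  rw [show -(s - min s T) = min s T + -s by ring, Real.exp_add, sub_zero]; ring

/-- The exponentials of the two averages multiply to e^{-(s-t)}, independent of the intermediate
time, which therefore contributes the length s - t. -/
theorem avg_avg_eq {h : ℝ → ℝ≥0∞} (hh : AEMeasurable h (volume.restrict (Ioi 0))) {t : ℝ}
    (ht : 0 ≤ t) : avg (avg h) t =
      ∫⁻ s in Ioi t, ENNReal.ofReal (Real.exp (-(s - t)) * (s - t)) * h s := by
  have hk : Measurable (Function.uncurry fun r s : ℝ =>
      ENNReal.ofReal (Real.exp (-(s - t)))) := by fun_prop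
  have h1 := lintegral_Ioi_lintegral_Ioi_mul hk
    (hh.mono_measure (Measure.restrict_mono (Ioi_subset_Ioi ht) le_rfl))
  have e1 : avg (avg h) t = ∫⁻ r in Ioi t, ∫⁻ s in Ioi r,
      ENNReal.ofReal (Real.exp (-(s - t))) * h s := by
    unfold avg
    refine lintegral_congr fun r => ?_
    rw [← lintegral_const_mul' _ _ ENNReal.ofReal_ne_top]
    refine lintegral_congr fun s => ?_
    rw [← mul_assoc, ← ENNReal.ofReal_mul (Real.exp_pos _).le, ← Real.exp_add]
    congr 3; ring_nf
  rw [e1, h1]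
  refine setLIntegral_congr_fun measurableSet_Ioi fun s hs => ?_
  rw [setLIntegral_const, Real.volume_Ioo, ENNReal.ofReal_mul (Real.exp_pos _).le]

/-! ### Weighted Hardy inequalities and the source term -/

theorem ofReal_norm_sq {E : Type*} [NormedAddCommGroup E] (x : E) :
    ENNReal.ofReal (‖x‖ ^ 2) = ‖x‖ₑ ^ 2 := by
  rw [ENNReal.ofReal_pow (norm_nonneg _), ofReal_norm]

/-- Weighted Cauchy-Schwarz inequality for a primitive. -/
theorem enorm_intervalIntegral_sq_le {E : Type*} [NormedAddCommGroup E] [NormedSpace ℝ E]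
    {g : ℝ → E} {t s : ℝ} (hts : t ≤ s) (hg : AEStronglyMeasurable g (volume.restrict (Ioo t s))) :
    ‖∫ r in t..s, g r‖ₑ ^ 2 ≤
      ∫⁻ r in Ioo t s, (2 * ENNReal.ofReal (Real.exp ((s - r) / 2))) * ‖g r‖ₑ ^ 2 := by
  -- The factor 1 is split as e^{-(s-r)/4} e^{(s-r)/4}. The first part has square integral at most
  -- 2; the square of the second grows at rate 1/2, which the weight e^{-s} still beats.
  have h1 : ‖∫ r in t..s, g r‖ₑ ≤ ∫⁻ r in Ioo t s, ENNReal.ofReal (Real.exp (-(s - r) / 4)) *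
      (ENNReal.ofReal (Real.exp ((s - r) / 4)) * ‖g r‖ₑ) := by
    rw [intervalIntegral.integral_of_le hts, integral_Ioc_eq_integral_Ioo]
    refine (enorm_integral_le_lintegral_enorm _).trans_eq (lintegral_congr fun r => ?_)
    rw [← mul_assoc, ← ENNReal.ofReal_mul (Real.exp_pos _).le, ← Real.exp_add]
    ring_nf; simp
  have h2 : ∫⁻ r in Ioo t s, ENNReal.ofReal (Real.exp (-(s - r) / 4)) ^ 2 ≤ 2 := by
    have hd : ∀ r, HasDerivAt (fun r => 2 * Real.exp (-(s - r) / 2)) (Real.exp (-(s - r) / 2)) r :=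
      fun r => by
        have := (((((hasDerivAt_id r).const_sub s).fun_neg).div_const 2).exp).const_mul 2
        refine this.congr_deriv ?_
        simp only [id]; ring
    have e : ∀ r, ENNReal.ofReal (Real.exp (-(s - r) / 4)) ^ 2 =
        ENNReal.ofReal (Real.exp (-(s - r) / 2)) := fun r => by
      rw [← ENNReal.ofReal_pow (Real.exp_pos _).le, ← Real.exp_nat_mul]
      congr 2; push_cast; ring
    simp only [e]
    rw [lintegral_Ioo_ofReal_eq_sub hts hd (by fun_prop) fun x _ => (Real.exp_pos _).le,
      ← ENNReal.ofReal_ofNat]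
    refine ENNReal.ofReal_le_ofReal ?_
    simp only [sub_self, neg_zero, zero_div, Real.exp_zero]
    linarith [Real.exp_pos (-(s - t) / 2)]
  calc ‖∫ r in t..s, g r‖ₑ ^ 2 ≤ _ := pow_le_pow_left₀ zero_le h1 2
    _ ≤ _ := lintegral_mul_sq_le (by fun_prop) (by fun_prop)
    _ ≤ _ := mul_le_mul_left h2 _
    _ = _ := by
      rw [← lintegral_const_mul' _ _ (by simp)]
      refine lintegral_congr fun r => ?_
      rw [mul_pow, ← ENNReal.ofReal_pow (Real.exp_pos _).le, ← Real.exp_nat_mul, mul_assoc]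
      congr 4; push_cast; ring

theorem tendsto_exp_neg_mul_affine {c : ℝ} (hc : 0 < c) (a b : ℝ) :
    Tendsto (fun s : ℝ => Real.exp (-(c * s)) * (a * s + b)) atTop (𝓝 0) := by
  have h1 : Tendsto (fun s : ℝ => c * s) atTop atTop := tendsto_id.const_mul_atTop hc
  have h2 := ((Real.tendsto_pow_mul_exp_neg_atTop_nhds_zero 1).comp h1).const_mul (a / c)
  have h3 := (Real.tendsto_exp_neg_atTop_nhds_zero.comp h1).const_mul b
  have h4 := h2.add h3
  rw [mul_zero, mul_zero, add_zero] at h4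
  refine h4.congr fun s => ?_
  simp only [Function.comp, pow_one]
  field_simp

theorem lintegral_Ioi_exp_mul_linear_half {t ρ : ℝ} (h : t ≤ ρ) :
    ∫⁻ s in Ioi ρ, ENNReal.ofReal (Real.exp (-(s - t)) * (s - t)) *
      (2 * ENNReal.ofReal (Real.exp ((s - ρ) / 2))) =
      ENNReal.ofReal (Real.exp (-(ρ - t)) * (4 * (ρ - t) + 8)) := by
  have hd : ∀ s, HasDerivAt
      (fun s => -(Real.exp (t - ρ / 2 - s / 2) * (4 * (s - t) + 8)))
      (Real.exp (t - ρ / 2 - s / 2) * (2 * (s - t))) s := by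
    intro s
    have h1 : HasDerivAt (fun s : ℝ => t - ρ / 2 - s / 2) (-(1 / 2)) s :=
      ((hasDerivAt_id s).div_const 2).const_sub _
    have h2 : HasDerivAt (fun s : ℝ => 4 * (s - t) + 8) (4 * 1) s :=
      (((hasDerivAt_id s).sub_const t).const_mul 4).add_const 8
    refine (h1.exp.fun_mul h2).fun_neg.congr_deriv ?_
    ring
  have hl : Tendsto (fun s => -(Real.exp (t - ρ / 2 - s / 2) * (4 * (s - t) + 8))) atTop
      (𝓝 0) := by
    have := ((tendsto_exp_neg_mul_affine (c := 1 / 2) (by norm_num) 4 (8 - 4 * t)).const_mul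
      (Real.exp (t - ρ / 2))).neg
    rw [mul_zero, neg_zero] at this
    refine this.congr fun s => ?_
    rw [← mul_assoc, ← Real.exp_add]
    ring_nf
  have h3 := lintegral_Ioi_ofReal_eq_sub (a := ρ) hd (fun s hs =>
    mul_nonneg (Real.exp_pos _).le (by linarith [mem_Ioi.1 hs])) hl
  have e : -(ρ - t) = t - ρ / 2 - ρ / 2 := by ring
  rw [e, show Real.exp (t - ρ / 2 - ρ / 2) * (4 * (ρ - t) + 8) =
    0 - -(Real.exp (t - ρ / 2 - ρ / 2) * (4 * (ρ - t) + 8)) by ring, ← h3]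
  refine setLIntegral_congr_fun measurableSet_Ioi fun s hs => ?_
  have hs' : 0 ≤ s - t := by linarith [mem_Ioi.1 hs]
  rw [show (2 : ℝ≥0∞) = ENNReal.ofReal 2 by simp, ← ENNReal.ofReal_mul (by norm_num),
    ← ENNReal.ofReal_mul (by positivity),
    show t - ρ / 2 - s / 2 = -(s - t) + (s - ρ) / 2 by ring, Real.exp_add]
  congr 1; ring

theorem lintegral_Ioi_exp_mul_half (ρ : ℝ) :
    ∫⁻ s in Ioi ρ, ENNReal.ofReal (Real.exp (-s)) *
      (2 * ENNReal.ofReal (Real.exp ((s - ρ) / 2))) = 4 * ENNReal.ofReal (Real.exp (-ρ)) := by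
  have hd : ∀ s, HasDerivAt (fun s => -(4 * Real.exp (-(ρ / 2) - s / 2)))
      (2 * Real.exp (-(ρ / 2) - s / 2)) s := by
    intro s
    have h1 : HasDerivAt (fun s : ℝ => -(ρ / 2) - s / 2) (-(1 / 2)) s :=
      ((hasDerivAt_id s).div_const 2).const_sub _
    refine (h1.exp.const_mul 4).fun_neg.congr_deriv ?_
    ring
  have hl : Tendsto (fun s => -(4 * Real.exp (-(ρ / 2) - s / 2))) atTop (𝓝 0) := by
    have := ((tendsto_exp_neg_mul_affine (c := 1 / 2) (by norm_num) 0 4).const_mul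
      (Real.exp (-(ρ / 2)))).neg
    rw [mul_zero, neg_zero] at this
    refine this.congr fun s => ?_
    rw [← mul_assoc, ← Real.exp_add]
    ring_nf
  have h3 := lintegral_Ioi_ofReal_eq_sub (a := ρ) hd (fun s _ => by positivity) hl
  rw [show (4 : ℝ≥0∞) = ENNReal.ofReal 4 by simp, ← ENNReal.ofReal_mul (by norm_num),
    show 4 * Real.exp (-ρ) = 0 - -(4 * Real.exp (-(ρ / 2) - ρ / 2)) by ring_nf, ← h3]
  refine lintegral_congr fun s => ?_
  rw [show (2 : ℝ≥0∞) = ENNReal.ofReal 2 by simp, ← ENNReal.ofReal_mul (by norm_num),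
    ← ENNReal.ofReal_mul (by positivity),
    show -(ρ / 2) - s / 2 = -s + (s - ρ) / 2 by ring, Real.exp_add]
  congr 1; ring

theorem lintegral_Ioi_exp_mul_linear (t : ℝ) :
    ∫⁻ s in Ioi t, ENNReal.ofReal (Real.exp (-(s - t)) * (s - t)) = 1 := by
  have hd : ∀ s, HasDerivAt (fun s => -(Real.exp (t - s) * (s - t + 1)))
      (Real.exp (t - s) * (s - t)) s := by
    intro s
    have h1 : HasDerivAt (fun s : ℝ => t - s) (-1) s := (hasDerivAt_id s).const_sub _
    have h2 : HasDerivAt (fun s : ℝ => s - t + 1) 1 s :=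
      ((hasDerivAt_id s).sub_const t).add_const 1
    refine (h1.exp.fun_mul h2).fun_neg.congr_deriv ?_
    ring
  have hl : Tendsto (fun s => -(Real.exp (t - s) * (s - t + 1))) atTop (𝓝 0) := by
    have := ((tendsto_exp_neg_mul_affine (c := 1) (by norm_num) 1 (1 - t)).const_mul
      (Real.exp t)).neg
    rw [mul_zero, neg_zero] at this
    refine this.congr fun s => ?_
    rw [← mul_assoc, ← Real.exp_add]
    ring_nf
  have h3 := lintegral_Ioi_ofReal_eq_sub (a := t) hd (fun s hs =>
    mul_nonneg (Real.exp_pos _).le (by linarith [mem_Ioi.1 hs])) hl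
  simpa using h3

/-- Hardy inequality: u'(s) - u'(t) is the primitive of u'', Cauchy-Schwarz bounds its square, and
Tonelli moves the kernel onto ‖u''‖². The kernel 4(s-t) + 8 is a multiple of the 𝒜² kernel plus a
multiple of the 𝒜 kernel, which is what allows its absorption later. -/
theorem H2loc.lintegral_avg_two_sub_le {E : Type} [NormedAddCommGroup E] [NormedSpace ℝ E]
    (u : H2loc E) {t : ℝ} (ht : 0 ≤ t) :
    ∫⁻ s in Ioi t, ENNReal.ofReal (Real.exp (-(s - t)) * (s - t)) * ‖u.u' s - u.u' t‖ₑ ^ 2 ≤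
      ∫⁻ s in Ioi t, ENNReal.ofReal (Real.exp (-(s - t)) * (4 * (s - t) + 8)) *
        ‖u.u'' s‖ₑ ^ 2 := by
  have hm : AEStronglyMeasurable u.u'' (volume.restrict (Ioi t)) :=
    u.aestronglyMeasurable_u''.mono_measure (Measure.restrict_mono (Ioi_subset_Ioi ht) le_rfl)
  have h1 := lintegral_Ioi_lintegral_Ioo_mul
    (k := fun r s => ENNReal.ofReal (Real.exp (-(s - t)) * (s - t)) *
      (2 * ENNReal.ofReal (Real.exp ((s - r) / 2)))) (by fun_prop) (hm.enorm.pow_const 2)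
  refine (lintegral_mono_ae ?_).trans (h1.trans_le (le_of_eq ?_))
  · filter_upwards [ae_restrict_mem measurableSet_Ioi] with s hs
    rw [u.u'_sub ht (ht.trans (le_of_lt hs))]
    have h2 := enorm_intervalIntegral_sq_le (le_of_lt hs)
      (hm.mono_measure (Measure.restrict_mono (fun x hx => hx.1) le_rfl))
    refine (mul_le_mul_right h2 _).trans_eq ?_
    rw [← lintegral_const_mul' _ _ ENNReal.ofReal_ne_top]
    exact lintegral_congr fun r => by ring
  · refine setLIntegral_congr_fun measurableSet_Ioi fun r hr => ?_
    rw [lintegral_Ioi_exp_mul_linear_half (le_of_lt hr)]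

/-- The same argument with the plain weight e^{-s}; applied twice in the level estimate. -/
theorem lintegral_exp_mul_primitive_sq_le {E : Type*} [NormedAddCommGroup E] [NormedSpace ℝ E]
    {g : ℝ → E} (hm : AEStronglyMeasurable g (volume.restrict (Ioi 0))) :
    ∫⁻ s in Ioi (0 : ℝ), ENNReal.ofReal (Real.exp (-s)) * ‖∫ r in (0 : ℝ)..s, g r‖ₑ ^ 2 ≤
      4 * ∫⁻ s in Ioi (0 : ℝ), ENNReal.ofReal (Real.exp (-s)) * ‖g s‖ₑ ^ 2 := by
  have h1 := lintegral_Ioi_lintegral_Ioo_mul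
    (k := fun r s => ENNReal.ofReal (Real.exp (-s)) *
      (2 * ENNReal.ofReal (Real.exp ((s - r) / 2)))) (by fun_prop) (hm.enorm.pow_const 2)
  refine (lintegral_mono_ae ?_).trans (h1.trans_le (le_of_eq ?_))
  · filter_upwards [ae_restrict_mem measurableSet_Ioi] with s hs
    have h2 := enorm_intervalIntegral_sq_le (le_of_lt hs)
      (hm.mono_measure (Measure.restrict_mono (fun x hx => hx.1) le_rfl))
    refine (mul_le_mul_right h2 _).trans_eq ?_
    rw [← lintegral_const_mul' _ _ ENNReal.ofReal_ne_top]
    exact lintegral_congr fun r => by ring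
  · rw [← lintegral_const_mul' _ _ (by simp)]
    refine lintegral_congr fun r => ?_
    rw [lintegral_Ioi_exp_mul_half, mul_assoc]

theorem aemeasurable_lintegral_Ioi_mul {k : ℝ → ℝ → ℝ≥0∞}
    (hk : Measurable (Function.uncurry k)) {h : ℝ → ℝ≥0∞} {a : ℝ}
    (hh : AEMeasurable h (volume.restrict (Ioi a))) :
    AEMeasurable (fun t => ∫⁻ s in Ioi t, k t s * h s) (volume.restrict (Ioi a)) := by
  set h' := hh.mk h with hh'
  have hae : ∀ᵐ s, s ∈ Ioi a → h s = h' s := (ae_restrict_iff' measurableSet_Ioi).1 hh.ae_eq_mk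
  have hm' : Measurable h' := hh.measurable_mk
  refine ⟨fun t => ∫⁻ s, if t < s then k t s * h' s else 0, ?_, ?_⟩
  · refine Measurable.lintegral_prod_right'
      (f := fun p : ℝ × ℝ => if p.1 < p.2 then k p.1 p.2 * h' p.2 else 0) ?_
    exact Measurable.ite (measurableSet_lt measurable_fst measurable_snd)
      (hk.mul (hm'.comp measurable_snd)) measurable_const
  · filter_upwards [ae_restrict_mem measurableSet_Ioi] with t ht
    rw [← lintegral_indicator measurableSet_Ioi]
    refine lintegral_congr_ae ?_
    filter_upwards [hae] with s hs
    by_cases hts : t < s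
    · simp [hts, hs ((mem_Ioi.1 ht).trans hts)]
    · simp [hts]

/-- Cauchy-Schwarz for the measure g(s) e^{-s} ds, whose total mass is T because 𝒜² preserves
constants. -/
theorem lintegral_profile_mul_sq_le {h : ℝ → ℝ≥0∞}
    (hh : AEMeasurable h (volume.restrict (Ioi 0))) {T : ℝ} (hT : 0 ≤ T) :
    (∫⁻ s in Ioi (0 : ℝ), ENNReal.ofReal (profile T s * Real.exp (-s)) * h s) ^ 2 ≤
      ENNReal.ofReal T *
        ∫⁻ s in Ioi (0 : ℝ), ENNReal.ofReal (profile T s * Real.exp (-s)) * h s ^ 2 := by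
  have hmp : Measurable (profile T) := (continuous_profile T).measurable
  have e1 : ∫⁻ s in Ioi (0 : ℝ), ENNReal.ofReal (profile T s * Real.exp (-s)) =
      ENNReal.ofReal T := by
    have := lintegral_Ioc_avg_two (h := fun _ => 1) (by fun_prop) hT
    simp only [mul_one, lintegral_Ioi_exp_mul_linear] at this
    rw [← this]; simp
  have e2 : ∀ s ∈ Ioi (0 : ℝ), ENNReal.ofReal √(profile T s * Real.exp (-s)) ^ 2 =
      ENNReal.ofReal (profile T s * Real.exp (-s)) := fun s hs => by
    rw [← ENNReal.ofReal_pow (Real.sqrt_nonneg _), Real.sq_sqrt]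
    exact mul_nonneg (profile_nonneg hT (le_of_lt hs)) (Real.exp_pos _).le
  have h1 := lintegral_mul_sq_le (μ := volume.restrict (Ioi (0 : ℝ)))
    (f := fun s => ENNReal.ofReal √(profile T s * Real.exp (-s)))
    (g := fun s => ENNReal.ofReal √(profile T s * Real.exp (-s)) * h s) (by fun_prop) (by fun_prop)
  rw [setLIntegral_congr_fun measurableSet_Ioi e2, e1] at h1
  refine (le_of_eq ?_).trans (h1.trans_eq ?_)
  · congr 1
    refine setLIntegral_congr_fun measurableSet_Ioi fun s hs => ?_
    rw [← mul_assoc, ← sq, e2 s hs]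
  · congr 1
    refine setLIntegral_congr_fun measurableSet_Ioi fun s hs => ?_
    rw [mul_pow, e2 s hs]

/-- Triangle inequality for b, then Young's inequality. The coefficient 1/(8ε²) is chosen so that
the Hardy kernel 4(s-t) + 8 becomes the kernel (s-t) + 2 of the density `accel`. -/
theorem enorm_mul_enorm_le {E F : Type*} [NormedAddCommGroup E] [NormedAddCommGroup F]
    {ε : ℝ} (hε : 0 < ε) (a : E) (b c : F) :
    ‖a‖ₑ * ‖b‖ₑ ≤ ‖c‖ₑ * ‖a‖ₑ + (ENNReal.ofReal (2 * ε ^ 2) * ‖a‖ₑ ^ 2 +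
      ENNReal.ofReal (1 / (8 * ε ^ 2)) * ‖b - c‖ₑ ^ 2) := by
  simp only [← ofReal_norm]
  rw [← ENNReal.ofReal_mul (norm_nonneg _), ← ENNReal.ofReal_mul (norm_nonneg _),
    ← ENNReal.ofReal_pow (norm_nonneg _), ← ENNReal.ofReal_pow (norm_nonneg _),
    ← ENNReal.ofReal_mul (by positivity), ← ENNReal.ofReal_mul (by positivity),
    ← ENNReal.ofReal_add (by positivity) (by positivity),
    ← ENNReal.ofReal_add (by positivity) (by positivity)]
  refine ENNReal.ofReal_le_ofReal ?_
  have h1 : ‖b‖ ≤ ‖c‖ + ‖b - c‖ := by simpa using norm_add_le c (b - c)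
  have h2 : ‖a‖ * ‖b - c‖ ≤ 2 * ε ^ 2 * ‖a‖ ^ 2 + 1 / (8 * ε ^ 2) * ‖b - c‖ ^ 2 := by
    have h3 : 2 * ε ^ 2 * ‖a‖ ^ 2 + 1 / (8 * ε ^ 2) * ‖b - c‖ ^ 2 - ‖a‖ * ‖b - c‖ =
        2 * (ε * ‖a‖ - ‖b - c‖ / (4 * ε)) ^ 2 := by field_simp; ring
    linarith [sq_nonneg (ε * ‖a‖ - ‖b - c‖ / (4 * ε))]
  nlinarith [norm_nonneg a]

section

variable {n : ℕ} {φ : ℝ → L2 n} {ε : ℝ} (u : H2loc (L2 n))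

/-- The weighted integral is rewritten as ∫_0^T 𝒜² dt, and at each t the velocity u'(s) is replaced
by the frozen value u'(t). The replacement error is paid for by ‖φ‖² and by the acceleration with
weights g and 2g', which are below the weights g and 3g' available as dissipation. -/
theorem lintegral_profile_source_le (hε : 0 < ε)
    (hφ : AEStronglyMeasurable φ (volume.restrict (Ioi 0))) {T : ℝ} (hT : 0 ≤ T) :
    ∫⁻ s in Ioi (0 : ℝ), ENNReal.ofReal (profile T s * Real.exp (-s)) * (‖φ s‖ₑ * ‖u.u' s‖ₑ) ≤
      (∫⁻ t in Ioc 0 T, ‖u.u' t‖ₑ *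
        ∫⁻ s in Ioi t, ENNReal.ofReal (Real.exp (-(s - t)) * (s - t)) * ‖φ s‖ₑ) +
      (ENNReal.ofReal (2 * ε ^ 2) *
        (∫⁻ s in Ioi (0 : ℝ), ENNReal.ofReal (profile T s * Real.exp (-s)) * ‖φ s‖ₑ ^ 2) +
      ((∫⁻ s in Ioi (0 : ℝ), ENNReal.ofReal (profile T s * Real.exp (-s)) *
          ENNReal.ofReal (accel ε u s)) +
        ENNReal.ofReal 2 * ∫⁻ s in Ioi (0 : ℝ), ENNReal.ofReal (profileDeriv T s * Real.exp (-s)) *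
          ENNReal.ofReal (accel ε u s))) := by
  have hu' : AEStronglyMeasurable u.u' (volume.restrict (Ioi 0)) :=
    (u.continuousOn_u'.mono Ioi_subset_Ici_self).aestronglyMeasurable measurableSet_Ioi
  have hφe : AEMeasurable (fun s => ‖φ s‖ₑ) (volume.restrict (Ioi 0)) := hφ.enorm
  have hφe2 : AEMeasurable (fun s => ‖φ s‖ₑ ^ 2) (volume.restrict (Ioi 0)) := hφe.pow_const 2
  have hae : AEMeasurable (fun s => ENNReal.ofReal (accel ε u s)) (volume.restrict (Ioi 0)) :=
    aemeasurable_accel.ennreal_ofReal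
  have hsub : ∀ {f : ℝ → ℝ≥0∞} {t : ℝ}, 0 ≤ t → AEMeasurable f (volume.restrict (Ioi 0)) →
      AEMeasurable f (volume.restrict (Ioi t)) := fun ht hf =>
    hf.mono_measure (Measure.restrict_mono (Ioi_subset_Ioi ht) le_rfl)
  have hsubT : ∀ {f : ℝ → ℝ≥0∞}, AEMeasurable f (volume.restrict (Ioi 0)) →
      AEMeasurable f (volume.restrict (Ioc 0 T)) := fun hf =>
    hf.mono_measure (Measure.restrict_mono Ioc_subset_Ioi_self le_rfl)
  have hk2 : Measurable (Function.uncurry fun t s : ℝ =>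
      ENNReal.ofReal (Real.exp (-(s - t)) * (s - t))) := by fun_prop
  have hk1 : Measurable (Function.uncurry fun t s : ℝ =>
      ENNReal.ofReal (Real.exp (-(s - t)))) := by fun_prop
  have hφu : AEMeasurable (fun s => ‖φ s‖ₑ * ‖u.u' s‖ₑ) (volume.restrict (Ioi 0)) :=
    hφe.mul hu'.enorm
  have hub : AEMeasurable (fun t => ‖u.u' t‖ₑ *
      ∫⁻ s in Ioi t, ENNReal.ofReal (Real.exp (-(s - t)) * (s - t)) * ‖φ s‖ₑ)
      (volume.restrict (Ioc 0 T)) :=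
    (hsubT hu'.enorm).mul (hsubT (aemeasurable_lintegral_Ioi_mul hk2 hφe))
  rw [← lintegral_Ioc_avg_two hφu hT, ← lintegral_Ioc_avg_two hφe2 hT,
    ← lintegral_Ioc_avg_two hae hT, ← lintegral_Ioc_avg hae hT,
    ← lintegral_const_mul' _ _ ENNReal.ofReal_ne_top, ← lintegral_const_mul' _ _ (by simp),
    ← lintegral_add_left' (hsubT (aemeasurable_lintegral_Ioi_mul hk2 hae)),
    ← lintegral_add_left' ((hsubT (aemeasurable_lintegral_Ioi_mul hk2 hφe2)).const_mul _),
    ← lintegral_add_left' hub]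
  refine lintegral_mono_ae ?_
  filter_upwards [ae_restrict_mem measurableSet_Ioc] with t ht
  have ht0 : 0 ≤ t := ht.1.le
  have hkt : Measurable fun s : ℝ => ENNReal.ofReal (Real.exp (-(s - t)) * (s - t)) := by fun_prop
  have hmul : ∀ {f : ℝ → ℝ≥0∞}, AEMeasurable f (volume.restrict (Ioi 0)) →
      AEMeasurable (fun s => ENNReal.ofReal (Real.exp (-(s - t)) * (s - t)) * f s)
        (volume.restrict (Ioi t)) := fun hf => hkt.aemeasurable.mul (hsub ht0 hf)
  calc ∫⁻ s in Ioi t, ENNReal.ofReal (Real.exp (-(s - t)) * (s - t)) * (‖φ s‖ₑ * ‖u.u' s‖ₑ)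
      ≤ ∫⁻ s in Ioi t, (‖u.u' t‖ₑ *
            (ENNReal.ofReal (Real.exp (-(s - t)) * (s - t)) * ‖φ s‖ₑ) +
          (ENNReal.ofReal (2 * ε ^ 2) *
            (ENNReal.ofReal (Real.exp (-(s - t)) * (s - t)) * ‖φ s‖ₑ ^ 2) +
          ENNReal.ofReal (1 / (8 * ε ^ 2)) *
            (ENNReal.ofReal (Real.exp (-(s - t)) * (s - t)) * ‖u.u' s - u.u' t‖ₑ ^ 2))) := by
        refine lintegral_mono fun s => ?_
        refine (mul_le_mul_right (enorm_mul_enorm_le hε (φ s) (u.u' s) (u.u' t)) _).trans_eq ?_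
        ring
    _ = ‖u.u' t‖ₑ * (∫⁻ s in Ioi t, ENNReal.ofReal (Real.exp (-(s - t)) * (s - t)) * ‖φ s‖ₑ) +
          (ENNReal.ofReal (2 * ε ^ 2) *
            (∫⁻ s in Ioi t, ENNReal.ofReal (Real.exp (-(s - t)) * (s - t)) * ‖φ s‖ₑ ^ 2) +
          ENNReal.ofReal (1 / (8 * ε ^ 2)) *
            ∫⁻ s in Ioi t, ENNReal.ofReal (Real.exp (-(s - t)) * (s - t)) *
              ‖u.u' s - u.u' t‖ₑ ^ 2) := by
        rw [lintegral_add_left' ((hmul hφe).const_mul _),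
          lintegral_add_left' ((hmul hφe2).const_mul _),
          lintegral_const_mul' _ _ enorm_ne_top, lintegral_const_mul' _ _ ENNReal.ofReal_ne_top,
          lintegral_const_mul' _ _ ENNReal.ofReal_ne_top]
    _ ≤ _ := by
        -- Only the oscillation of u' remains. After the Hardy inequality, (4(s-t) + 8)‖u''‖²/(8ε²)
        -- equals ((s-t) + 2) times `accel`.
        refine add_le_add_right (add_le_add_right ?_ _) _
        refine (mul_le_mul_right (u.lintegral_avg_two_sub_le ht0) _).trans_eq ?_
        rw [← lintegral_const_mul' _ _ ENNReal.ofReal_ne_top,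
          ← lintegral_const_mul' _ _ (by simp),
          ← lintegral_add_left' (hmul hae)]
        refine setLIntegral_congr_fun measurableSet_Ioi fun s hs => ?_
        have hs' : 0 ≤ s - t := by linarith [mem_Ioi.1 hs]
        have he := Real.exp_pos (-(s - t))
        have ha := accel_nonneg (ε := ε) (u := u) s
        rw [← ofReal_norm_sq,
          ← ENNReal.ofReal_mul (by positivity), ← ENNReal.ofReal_mul (by positivity),
          ← ENNReal.ofReal_mul (by positivity), ← ENNReal.ofReal_mul (by positivity),
          ← ENNReal.ofReal_mul (by positivity), ← ENNReal.ofReal_add (by positivity)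
            (by positivity)]
        congr 1
        unfold accel
        field_simp
        ring

end

/-! ### A square root Gronwall inequality and elementary bounds -/

/-- A Gronwall inequality of square root type. -/
theorem sqrt_le_sqrt_add_half_integral {E y c : ℝ → ℝ} {F₀ T : ℝ} (hT : 0 ≤ T)
    (hF₀ : 0 ≤ F₀) (hy0 : ∀ t ∈ Icc 0 T, 0 ≤ y t) (hc0 : ∀ t ∈ Icc 0 T, 0 ≤ c t)
    (hyE : ∀ t ∈ Icc 0 T, y t ≤ √(E t)) (hc : IntervalIntegrable c volume 0 T)
    (hyc : IntervalIntegrable (fun t => y t * c t) volume 0 T)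
    (hE : ∀ t ∈ Icc 0 T, E t ≤ F₀ + ∫ s in (0 : ℝ)..t, y s * c s) :
    √(E T) ≤ √F₀ + 1 / 2 * ∫ s in (0 : ℝ)..T, c s := by
  -- E is dominated by F, a positive constant plus the primitive of y c, and (√F)' = y c / (2√F) ≤
  -- c/2. No regularity of E is used. Adding η keeps F away from 0, where the square root is not
  -- Lipschitz; η tends to 0 at the end.
  have key : ∀ η : ℝ, 0 < η → √(E T) ≤ √(F₀ + η) + 1 / 2 * ∫ s in (0 : ℝ)..T, c s := by
    intro η hη
    set F : ℝ → ℝ := fun t => F₀ + η + ∫ s in (0 : ℝ)..t, y s * c s with hF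
    have hFη : ∀ t ∈ Icc 0 T, η ≤ F t := by
      intro t ht
      have : 0 ≤ ∫ s in (0 : ℝ)..t, y s * c s :=
        intervalIntegral.integral_nonneg ht.1 fun s hs =>
          mul_nonneg (hy0 s ⟨hs.1, hs.2.trans ht.2⟩) (hc0 s ⟨hs.1, hs.2.trans ht.2⟩)
      rw [hF]; simp only; linarith
    have hyF : ∀ t ∈ Icc 0 T, y t ≤ √(F t) := fun t ht =>
      (hyE t ht).trans (Real.sqrt_le_sqrt (by rw [hF]; simp only; linarith [hE t ht]))
    have hFpos : ∀ t ∈ Icc 0 T, 0 < √(F t) := fun t ht =>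
      Real.sqrt_pos.2 (hη.trans_le (hFη t ht))
    have hac : AbsolutelyContinuousOnInterval (fun t => √(F t)) 0 T := by
      refine (AbsolutelyContinuousOnInterval.primitive hyc).of_dist_le (C := (√η)⁻¹) ?_
      intro s hs t ht
      rw [uIcc_of_le hT] at hs ht
      have h1 : F s - F t = (√(F s) - √(F t)) * (√(F s) + √(F t)) := by
        have := Real.mul_self_sqrt (hη.le.trans (hFη s hs))
        have := Real.mul_self_sqrt (hη.le.trans (hFη t ht))
        linarith
      have h2 : √η ≤ √(F s) + √(F t) := by
        linarith [Real.sqrt_le_sqrt (hFη s hs), Real.sqrt_nonneg (F t)]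
      have h3 : dist (∫ r in (0 : ℝ)..s, y r * c r) (∫ r in (0 : ℝ)..t, y r * c r) =
          |F s - F t| := by rw [Real.dist_eq, hF]; simp
      rw [h3, h1, abs_mul, Real.dist_eq, inv_mul_eq_div, le_div_iff₀ (Real.sqrt_pos.2 hη)]
      exact mul_le_mul_of_nonneg_left (h2.trans (le_abs_self _)) (abs_nonneg _)
    have hcont : ContinuousOn (fun t => (2 * √(F t))⁻¹) (uIcc 0 T) := by
      refine (continuousOn_const.mul hac.continuousOn).inv₀ fun t ht => ?_
      rw [uIcc_of_le hT] at ht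
      exact (mul_pos two_pos (hFpos t ht)).ne'
    have hi : IntervalIntegrable (fun t => y t * c t * (2 * √(F t))⁻¹) volume 0 T :=
      hyc.mul_continuousOn hcont
    have h1 := hac.integral_eq_sub (f' := fun t => y t * c t * (2 * √(F t))⁻¹) (by
      filter_upwards [hyc.ae_hasDerivAt_integral] with t ht htT
      have h2 := (ht htT 0 left_mem_uIcc).const_add (F₀ + η)
      rw [uIcc_of_le hT] at htT
      exact h2.sqrt ((hη.trans_le (hFη t htT)).ne')) hi
    have h2 : ∫ t in (0 : ℝ)..T, y t * c t * (2 * √(F t))⁻¹ ≤ ∫ t in (0 : ℝ)..T, 1 / 2 * c t := by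
      refine intervalIntegral.integral_mono_on hT hi (hc.const_mul _) fun t ht => ?_
      have h3 := hFpos t ht
      rw [← div_eq_mul_inv, div_le_iff₀ (by positivity)]
      have := mul_le_mul_of_nonneg_right (hyF t ht) (hc0 t ht)
      linarith
    rw [h1, intervalIntegral.integral_const_mul] at h2
    have h4 : √(E T) ≤ √(F T) := Real.sqrt_le_sqrt (by
      rw [hF]; simp only; linarith [hE T ⟨hT, le_rfl⟩])
    have h5 : F 0 = F₀ + η := by simp [hF]
    rw [h5] at h2
    linarith
  have hlim : Tendsto (fun η : ℝ => √(F₀ + η) + 1 / 2 * ∫ s in (0 : ℝ)..T, c s) (𝓝[>] 0)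
      (𝓝 (√F₀ + 1 / 2 * ∫ s in (0 : ℝ)..T, c s)) := by
    have : Tendsto (fun η : ℝ => √(F₀ + η) + 1 / 2 * ∫ s in (0 : ℝ)..T, c s) (𝓝 0)
        (𝓝 (√(F₀ + 0) + 1 / 2 * ∫ s in (0 : ℝ)..T, c s)) := Continuous.tendsto (by fun_prop) 0
    rw [add_zero] at this
    exact this.mono_left nhdsWithin_le_nhds
  refine ge_of_tendsto hlim ?_
  filter_upwards [self_mem_nhdsWithin] with η hη using key η hη

/-- For s ≥ 1 the weight is e·s - 1 - s, and e ≥ 2. This makes the weight with T = 1 control the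
first moment that occurs in the energy at time 0. -/
theorem le_one_add_profile_one {s : ℝ} (hs : 0 ≤ s) : s ≤ 1 + profile 1 s := by
  rcases le_total s 1 with h | h
  · linarith [profile_nonneg zero_le_one hs]
  · have := Real.add_one_le_exp 1
    rw [profile, min_eq_right h]
    nlinarith

theorem sqrt_add_le {a b : ℝ} (ha : 0 ≤ a) (hb : 0 ≤ b) : √(a + b) ≤ √a + √b := by
  rw [Real.sqrt_le_iff]
  refine ⟨by positivity, ?_⟩
  nlinarith [Real.sq_sqrt ha, Real.sq_sqrt hb, mul_nonneg (Real.sqrt_nonneg a) (Real.sqrt_nonneg b)]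

/-! ### The energy estimate for a fixed ε -/

section Energy

variable {n : ℕ} {W : L2 n → ℝ≥0∞} {φ : ℝ → L2 n} {w₀ w₁ : L2 n} {ε : ℝ} {u : H2loc (L2 n)}

/-- The average `𝒜² ‖φ‖`. -/
noncomputable def sourceAvg (φ : ℝ → L2 n) (t : ℝ) : ℝ :=
  (∫⁻ s in Ioi t, ENNReal.ofReal (Real.exp (-(s - t)) * (s - t)) * ‖φ s‖ₑ).toReal

/-- The integral over `(0, T)` of `𝒜² ‖φ‖²`. -/
noncomputable def sourceMass (φ : ℝ → L2 n) (T : ℝ) : ℝ≥0∞ :=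
  ∫⁻ s in Ioi (0 : ℝ), ENNReal.ofReal (profile T s * Real.exp (-s)) * ‖φ s‖ₑ ^ 2

theorem sourceMass_eq (hφ : AEStronglyMeasurable φ (volume.restrict (Ioi 0))) {T : ℝ}
    (hT : 0 ≤ T) : sourceMass φ T =
      ∫⁻ s in Ioc 0 T, avg (avg fun r => ENNReal.ofReal (‖φ r‖ ^ 2)) s := by
  have h : AEMeasurable (fun r => ‖φ r‖ₑ ^ 2) (volume.restrict (Ioi 0)) := hφ.enorm.pow_const 2
  rw [sourceMass, ← lintegral_Ioc_avg_two h hT]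
  refine setLIntegral_congr_fun measurableSet_Ioc fun s hs => ?_
  simp only [ofReal_norm_sq]
  rw [avg_avg_eq h hs.1.le]

theorem sourceMass_mono (hφ : AEStronglyMeasurable φ (volume.restrict (Ioi 0))) {s t : ℝ}
    (hs : 0 ≤ s) (hst : s ≤ t) : sourceMass φ s ≤ sourceMass φ t := by
  rw [sourceMass_eq hφ hs, sourceMass_eq hφ (hs.trans hst)]
  exact lintegral_mono_set (Ioc_subset_Ioc_right hst)

theorem lintegral_avg_norm_sq_le (hφ : AEStronglyMeasurable φ (volume.restrict (Ioi 0))) {T : ℝ}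
    (hT : 0 ≤ T) :
    (∫⁻ t in Ioc 0 T, ∫⁻ s in Ioi t,
      ENNReal.ofReal (Real.exp (-(s - t)) * (s - t)) * ‖φ s‖ₑ) ^ 2 ≤
      ENNReal.ofReal T * sourceMass φ T := by
  have h : AEMeasurable (fun r => ‖φ r‖ₑ) (volume.restrict (Ioi 0)) := hφ.enorm
  rw [lintegral_Ioc_avg_two h hT]
  exact lintegral_profile_mul_sq_le h hT

theorem lintegral_avg_norm_ne_top (hφ : AEStronglyMeasurable φ (volume.restrict (Ioi 0))) {T : ℝ}
    (hT : 0 ≤ T) (hY : sourceMass φ T ≠ ⊤) :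
    ∫⁻ t in Ioc 0 T, ∫⁻ s in Ioi t,
      ENNReal.ofReal (Real.exp (-(s - t)) * (s - t)) * ‖φ s‖ₑ ≠ ⊤ := by
  intro h
  have h1 := lintegral_avg_norm_sq_le hφ hT
  rw [h] at h1
  have h2 := ENNReal.mul_ne_top ENNReal.ofReal_ne_top hY (a := ENNReal.ofReal T)
  exact h2 (top_le_iff.1 (by simpa using h1))

theorem aemeasurable_avg_norm (hφ : AEStronglyMeasurable φ (volume.restrict (Ioi 0))) (T : ℝ) :
    AEMeasurable (fun t => ∫⁻ s in Ioi t,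
      ENNReal.ofReal (Real.exp (-(s - t)) * (s - t)) * ‖φ s‖ₑ) (volume.restrict (Ioc 0 T)) :=
  (aemeasurable_lintegral_Ioi_mul (k := fun t s => ENNReal.ofReal (Real.exp (-(s - t)) * (s - t)))
    (by fun_prop) hφ.enorm).mono_measure (Measure.restrict_mono Ioc_subset_Ioi_self le_rfl)

theorem integrableOn_sourceAvg (hφ : AEStronglyMeasurable φ (volume.restrict (Ioi 0))) {T : ℝ}
    (hT : 0 ≤ T) (hY : sourceMass φ T ≠ ⊤) : IntegrableOn (sourceAvg φ) (Ioc 0 T) :=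
  integrable_toReal_of_lintegral_ne_top (aemeasurable_avg_norm hφ T)
    (lintegral_avg_norm_ne_top hφ hT hY)

/-- Cauchy-Schwarz passes from the time integral of 𝒜²‖φ‖ to that of 𝒜²‖φ‖², the only quantity
controlled by the assumptions. -/
theorem integral_sourceAvg_le (hφ : AEStronglyMeasurable φ (volume.restrict (Ioi 0))) {T : ℝ}
    (hT : 0 ≤ T) (hY : sourceMass φ T ≠ ⊤) :
    ∫ t in (0 : ℝ)..T, sourceAvg φ t ≤ √(T * (sourceMass φ T).toReal) := by
  have h1 := lintegral_avg_norm_ne_top hφ hT hY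
  rw [intervalIntegral.integral_of_le hT]
  unfold sourceAvg
  rw [integral_toReal (aemeasurable_avg_norm hφ T) (ae_lt_top' (aemeasurable_avg_norm hφ T) h1)]
  refine Real.le_sqrt_of_sq_le ?_
  have h2 := ENNReal.toReal_mono (ENNReal.mul_ne_top ENNReal.ofReal_ne_top hY)
    (lintegral_avg_norm_sq_le hφ hT)
  rwa [ENNReal.toReal_pow, ENNReal.toReal_mul, ENNReal.toReal_ofReal hT] at h2

theorem lintegral_enorm_mul_avg_norm (hφ : AEStronglyMeasurable φ (volume.restrict (Ioi 0)))
    {T : ℝ} (hT : 0 ≤ T) (hY : sourceMass φ T ≠ ⊤) :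
    IntervalIntegrable (fun t => ‖u.u' t‖ * sourceAvg φ t) volume 0 T ∧
    ∫⁻ t in Ioc 0 T, ‖u.u' t‖ₑ *
        ∫⁻ s in Ioi t, ENNReal.ofReal (Real.exp (-(s - t)) * (s - t)) * ‖φ s‖ₑ =
      ENNReal.ofReal (∫ t in (0 : ℝ)..T, ‖u.u' t‖ * sourceAvg φ t) := by
  have hi : IntervalIntegrable (fun t => ‖u.u' t‖ * sourceAvg φ t) volume 0 T :=
    ((intervalIntegrable_iff_integrableOn_Ioc_of_le hT).2
      (integrableOn_sourceAvg hφ hT hY)).continuousOn_mul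
      (u.continuousOn_u'.norm.mono (by rw [uIcc_of_le hT]; exact Icc_subset_Ici_self))
  refine ⟨hi, ?_⟩
  rw [intervalIntegral.integral_of_le hT, ofReal_integral_eq_lintegral_ofReal
    ((intervalIntegrable_iff_integrableOn_Ioc_of_le hT).1 hi)
    (Eventually.of_forall fun t => mul_nonneg (norm_nonneg _) ENNReal.toReal_nonneg)]
  refine lintegral_congr_ae ?_
  filter_upwards [ae_lt_top' (aemeasurable_avg_norm hφ T) (lintegral_avg_norm_ne_top hφ hT hY)]
    with t ht
  rw [ENNReal.ofReal_mul (norm_nonneg _), ofReal_norm, sourceAvg, ENNReal.ofReal_toReal ht.ne]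

/-- Real valued version of `approxEnergy`. -/
noncomputable def energy (W : L2 n → ℝ≥0∞) (ε : ℝ) (u : H2loc (L2 n)) (T : ℝ) : ℝ :=
  kinetic ε u T +
    ∫ s in Ioi (0 : ℝ), Real.exp T * (s - min s T) * (Real.exp (-s) * potential W u s)

theorem energy_nonneg (T : ℝ) : 0 ≤ energy W ε u T := by
  refine add_nonneg (kinetic_nonneg T) (integral_nonneg fun s => ?_)
  have h2 := potential_nonneg (W := W) (u := u) s
  have h3 : 0 ≤ s - min s T := by linarith [min_le_left s T]
  positivity

theorem kinetic_le_energy (T : ℝ) : kinetic ε u T ≤ energy W ε u T := by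
  refine le_add_of_nonneg_right (integral_nonneg fun s => ?_)
  have h2 := potential_nonneg (W := W) (u := u) s
  have h3 : 0 ≤ s - min s T := by linarith [min_le_left s T]
  positivity

theorem energy_zero : energy W ε u 0 =
    kinetic ε u 0 + ∫ s in Ioi (0 : ℝ), s * (Real.exp (-s) * potential W u s) := by
  rw [energy]
  congr 1
  refine setIntegral_congr_fun measurableSet_Ioi fun s hs => ?_
  simp only [min_eq_right (le_of_lt (mem_Ioi.1 hs)), Real.exp_zero, sub_zero, one_mul]

/-- The properties of a minimizer which are needed for the energy estimates. -/
structure MinimizerData (W : L2 n → ℝ≥0∞) (φ : ℝ → L2 n) (w₀ w₁ : L2 n) (ε : ℝ)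
    (u : H2loc (L2 n)) : Prop where
  pos : 0 < ε
  isMin : IsMinimizer W φ w₀ w₁ ε u
  finite : Hfun W ε u ≠ ⊤
  meas : AEMeasurable (fun t => W (u.u t)) (volume.restrict (Ioi 0))
  source : IntegrableOn φ (Ioi 0)
  supp : ∃ Tstar : ℝ, ∀ᵐ t : ℝ, 0 ≤ t → Tstar < t → φ t = 0
  mass : ∀ T, 0 ≤ T → sourceMass φ T ≠ ⊤

namespace MinimizerData

theorem integrableOn_profile_potential (h : MinimizerData W φ w₀ w₁ ε u) {T : ℝ} (hT : 0 ≤ T) :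
    IntegrableOn (fun s => profile T s * (Real.exp (-s) * potential W u s)) (Ioi 0) := by
  obtain ⟨Tstar, hs⟩ := h.supp
  have h1 := (inner_variation_inequality h.pos h.isMin h.finite h.meas h.source hs hT).1
  refine h1.mono' ?_ ?_
  · exact (continuous_profile T).aestronglyMeasurable.mul
      (integrableOn_exp_mul_potential h.finite h.meas).1
  · filter_upwards [ae_restrict_mem measurableSet_Ioi] with s hs
    have := profile_nonneg hT (le_of_lt hs)
    have h2 := potential_nonneg (W := W) (u := u) s
    have h3 := accel_nonneg (ε := ε) (u := u) s
    rw [Real.norm_eq_abs, abs_of_nonneg (by positivity)]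
    have : potential W u s ≤ accel ε u s + potential W u s := by linarith
    gcongr

theorem integrableOn_profile_accel (h : MinimizerData W φ w₀ w₁ ε u) {T : ℝ} (hT : 0 ≤ T) :
    IntegrableOn (fun s => profile T s * (Real.exp (-s) * accel ε u s)) (Ioi 0) := by
  obtain ⟨Tstar, hs⟩ := h.supp
  have h1 := (inner_variation_inequality h.pos h.isMin h.finite h.meas h.source hs hT).1
  refine (h1.sub (h.integrableOn_profile_potential hT)).congr (Eventually.of_forall fun s => ?_)
  simp only [Pi.sub_apply]; ring

theorem integrableOn_profileDeriv_potential (h : MinimizerData W φ w₀ w₁ ε u) {T : ℝ} (hT : 0 ≤ T) :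
    IntegrableOn (fun s => profileDeriv T s * (Real.exp (-s) * potential W u s)) (Ioi 0) :=
  integrableOn_bdd_mul (integrableOn_exp_mul_potential h.finite h.meas)
    (continuous_profileDeriv T).measurable fun _ hs => abs_profileDeriv_le hT hs

theorem integrableOn_profileDeriv_accel (h : MinimizerData W φ w₀ w₁ ε u) {T : ℝ} (hT : 0 ≤ T) :
    IntegrableOn (fun s => profileDeriv T s * (Real.exp (-s) * accel ε u s)) (Ioi 0) :=
  integrableOn_bdd_mul (integrableOn_exp_mul_accel h.finite)
    (continuous_profileDeriv T).measurable fun _ hs => abs_profileDeriv_le hT hs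

/-- The acceleration has disappeared: the first order condition supplies it with the weight g + 3g'
on the left, and the source estimate uses g + 2g'. This form, with the potential still weighted by
g, serves both the energy estimate and the bound of the energy at time 0. -/
theorem kinetic_add_integral_profile_le (h : MinimizerData W φ w₀ w₁ ε u) {T : ℝ} (hT : 0 ≤ T) :
    kinetic ε u T + ∫ s in Ioi (0 : ℝ), profile T s * (Real.exp (-s) * potential W u s) ≤
      kinetic ε u 0 + (∫ s in Ioi (0 : ℝ), profileDeriv T s * (Real.exp (-s) * potential W u s)) +
        (∫ t in (0 : ℝ)..T, ‖u.u' t‖ * sourceAvg φ t) +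
        2 * ε ^ 2 * (sourceMass φ T).toReal := by
  obtain ⟨Tstar, hs⟩ := h.supp
  have hε := h.pos
  have h1 := (inner_variation_inequality h.pos h.isMin h.finite h.meas h.source hs hT).2
  have ipa := h.integrableOn_profile_accel hT
  have ipw := h.integrableOn_profile_potential hT
  have ida := h.integrableOn_profileDeriv_accel hT
  have idw := h.integrableOn_profileDeriv_potential hT
  have hX0 : 0 ≤ ∫ t in (0 : ℝ)..T, ‖u.u' t‖ * sourceAvg φ t :=
    intervalIntegral.integral_nonneg hT fun t _ =>
      mul_nonneg (norm_nonneg _) ENNReal.toReal_nonneg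
  have hpa0 : 0 ≤ ∫ s in Ioi (0 : ℝ), profile T s * (Real.exp (-s) * accel ε u s) :=
    setIntegral_nonneg measurableSet_Ioi fun s hs => mul_nonneg (profile_nonneg hT (le_of_lt hs))
      (mul_nonneg (Real.exp_pos _).le (accel_nonneg s))
  have hda0 : 0 ≤ ∫ s in Ioi (0 : ℝ), profileDeriv T s * (Real.exp (-s) * accel ε u s) :=
    setIntegral_nonneg measurableSet_Ioi fun s hs =>
      mul_nonneg (profileDeriv_nonneg hT (le_of_lt hs))
        (mul_nonneg (Real.exp_pos _).le (accel_nonneg s))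
  have e1 : ∫⁻ s in Ioi (0 : ℝ), ENNReal.ofReal (profile T s * Real.exp (-s)) *
      ENNReal.ofReal (accel ε u s) =
      ENNReal.ofReal (∫ s in Ioi (0 : ℝ), profile T s * (Real.exp (-s) * accel ε u s)) := by
    rw [ofReal_integral_eq_lintegral_ofReal ipa]
    · refine setLIntegral_congr_fun measurableSet_Ioi fun s hs => ?_
      have := profile_nonneg hT (le_of_lt hs)
      rw [← ENNReal.ofReal_mul (by positivity), mul_assoc]
    · filter_upwards [ae_restrict_mem measurableSet_Ioi] with s hs
      exact mul_nonneg (profile_nonneg hT (le_of_lt hs))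
        (mul_nonneg (Real.exp_pos _).le (accel_nonneg s))
  have e2 : ∫⁻ s in Ioi (0 : ℝ), ENNReal.ofReal (profileDeriv T s * Real.exp (-s)) *
      ENNReal.ofReal (accel ε u s) =
      ENNReal.ofReal (∫ s in Ioi (0 : ℝ), profileDeriv T s * (Real.exp (-s) * accel ε u s)) := by
    rw [ofReal_integral_eq_lintegral_ofReal ida]
    · refine setLIntegral_congr_fun measurableSet_Ioi fun s hs => ?_
      have := profileDeriv_nonneg hT (le_of_lt hs)
      rw [← ENNReal.ofReal_mul (by positivity), mul_assoc]
    · filter_upwards [ae_restrict_mem measurableSet_Ioi] with s hs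
      exact mul_nonneg (profileDeriv_nonneg hT (le_of_lt hs))
        (mul_nonneg (Real.exp_pos _).le (accel_nonneg s))
  have h2 := lintegral_profile_source_le u hε h.source.1 hT
  rw [(lintegral_enorm_mul_avg_norm h.source.1 hT (h.mass T hT)).2, e1, e2] at h2
  -- Folds the ‖φ‖² integral into `sourceMass`; every term is then finite and the inequality can be
  -- read in ℝ.
  change _ ≤ _ + (_ * sourceMass φ T + _) at h2
  rw [← ENNReal.ofReal_toReal (h.mass T hT),
    ← ENNReal.ofReal_mul (by positivity), ← ENNReal.ofReal_mul (by positivity),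
    ← ENNReal.ofReal_add (by positivity) (by positivity),
    ← ENNReal.ofReal_add (by positivity) (by positivity),
    ← ENNReal.ofReal_add (by positivity) (by positivity)] at h2
  have h3 : ‖∫ s in Ioi (0 : ℝ), Real.exp (-s) * (profile T s * inner ℝ (φ s) (u.u' s))‖ₑ ≤
      ∫⁻ s in Ioi (0 : ℝ), ENNReal.ofReal (profile T s * Real.exp (-s)) *
        (‖φ s‖ₑ * ‖u.u' s‖ₑ) := by
    refine (enorm_integral_le_lintegral_enorm _).trans (lintegral_mono_ae ?_)
    filter_upwards [ae_restrict_mem measurableSet_Ioi] with s hs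
    have h4 := profile_nonneg hT (le_of_lt hs)
    simp only [← ofReal_norm]
    rw [← ENNReal.ofReal_mul (norm_nonneg _), ← ENNReal.ofReal_mul (by positivity)]
    refine ENNReal.ofReal_le_ofReal ?_
    rw [norm_mul, norm_mul, Real.norm_eq_abs, Real.norm_eq_abs, Real.abs_exp, abs_of_nonneg h4]
    have := norm_inner_le_norm (𝕜 := ℝ) (φ s) (u.u' s)
    calc Real.exp (-s) * (profile T s * ‖inner ℝ (φ s) (u.u' s)‖)
        ≤ Real.exp (-s) * (profile T s * (‖φ s‖ * ‖u.u' s‖)) := by gcongr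
      _ = _ := by ring
  have h4 := h3.trans h2
  rw [← ofReal_norm, ENNReal.ofReal_le_ofReal_iff (by positivity)] at h4
  have h5 := (le_abs_self _).trans h4
  have e3 : ∫ s in Ioi (0 : ℝ), profile T s * (Real.exp (-s) * (accel ε u s + potential W u s)) =
      (∫ s in Ioi (0 : ℝ), profile T s * (Real.exp (-s) * accel ε u s)) +
      ∫ s in Ioi (0 : ℝ), profile T s * (Real.exp (-s) * potential W u s) := by
    rw [← integral_add ipa ipw]; congr 1; ext s; ring
  have e4 : ∫ s in Ioi (0 : ℝ), profileDeriv T s *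
      (Real.exp (-s) * (potential W u s - 3 * accel ε u s)) =
      (∫ s in Ioi (0 : ℝ), profileDeriv T s * (Real.exp (-s) * potential W u s)) -
      3 * ∫ s in Ioi (0 : ℝ), profileDeriv T s * (Real.exp (-s) * accel ε u s) := by
    rw [← integral_const_mul, ← integral_sub idw (ida.const_mul 3)]; congr 1; ext s; ring
  rw [e3, e4] at h1
  linarith

/-- The integrability that Fatou's lemma produced for T = 1 bounds the first moment of the
potential. The finiteness of the energy at every later time follows from it, since e^T (s - T)⁺ ≤
e^T s. -/
theorem integrableOn_mul_exp_potential (h : MinimizerData W φ w₀ w₁ ε u) :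
    IntegrableOn (fun s => s * (Real.exp (-s) * potential W u s)) (Ioi 0) := by
  refine ((integrableOn_exp_mul_potential h.finite h.meas).add
    (h.integrableOn_profile_potential zero_le_one)).mono' ?_ ?_
  · exact aestronglyMeasurable_id.mul (integrableOn_exp_mul_potential h.finite h.meas).1
  · filter_upwards [ae_restrict_mem measurableSet_Ioi] with s hs
    have h1 : s ≤ 1 + profile 1 s := le_one_add_profile_one (le_of_lt hs)
    have h2 := potential_nonneg (W := W) (u := u) s
    have hs' : 0 ≤ s := le_of_lt hs
    rw [Real.norm_eq_abs, abs_of_nonneg (by positivity)]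
    simp only [Pi.add_apply]
    have := mul_le_mul_of_nonneg_right h1 (mul_nonneg (Real.exp_pos (-s)).le h2)
    linarith

theorem integrableOn_energy (h : MinimizerData W φ w₀ w₁ ε u) {T : ℝ} (hT : 0 ≤ T) : IntegrableOn
    (fun s => Real.exp T * (s - min s T) * (Real.exp (-s) * potential W u s)) (Ioi 0) := by
  refine (h.integrableOn_mul_exp_potential.const_mul (Real.exp T)).mono' ?_ ?_
  · exact AEStronglyMeasurable.mul (Continuous.aestronglyMeasurable (by fun_prop))
      (integrableOn_exp_mul_potential h.finite h.meas).1
  · filter_upwards [ae_restrict_mem measurableSet_Ioi] with s hs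
    have h2 := potential_nonneg (W := W) (u := u) s
    have h3 : 0 ≤ s - min s T := by linarith [min_le_left s T]
    have h4 : s - min s T ≤ s := by linarith [le_min (le_of_lt hs) hT]
    rw [Real.norm_eq_abs, abs_of_nonneg (by positivity), mul_assoc]
    gcongr

theorem approxEnergy_eq (h : MinimizerData W φ w₀ w₁ ε u) {T : ℝ} (hT : 0 ≤ T) :
    approxEnergy W ε u T = ENNReal.ofReal (energy W ε u T) := by
  have hi := h.integrableOn_energy hT
  have h0 : ∀ s, 0 ≤ Real.exp T * (s - min s T) * (Real.exp (-s) * potential W u s) := fun s => by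
    have h2 := potential_nonneg (W := W) (u := u) s
    have h3 : 0 ≤ s - min s T := by linarith [min_le_left s T]
    positivity
  rw [approxEnergy, energy, ENNReal.ofReal_add (kinetic_nonneg T) (integral_nonneg h0), kinetic,
    ofReal_integral_eq_lintegral_ofReal hi (Eventually.of_forall h0)]
  congr 1
  have e1 : Ioi T = Ioi T ∩ Ioi 0 := (inter_eq_left.2 (Ioi_subset_Ioi hT)).symm
  rw [e1, ← Measure.restrict_restrict measurableSet_Ioi, ← lintegral_indicator measurableSet_Ioi]
  refine lintegral_congr_ae ?_
  filter_upwards [ae_lt_top_potential h.finite h.meas] with s hs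
  rcases lt_or_ge T s with hTs | hTs
  · rw [indicator_of_mem (mem_Ioi.2 hTs), min_eq_right hTs.le, ← ENNReal.ofReal_toReal hs.ne,
      ← ENNReal.ofReal_mul (mul_nonneg (Real.exp_pos _).le (by linarith)), potential,
      show -(s - T) = T + -s by ring, Real.exp_add]
    congr 1; ring
  · rw [indicator_of_notMem (by simpa using hTs), min_eq_left hTs]
    simp

/-- The identity g - g' + s = e^T (s - T)⁺ converts the weighted inequality into a comparison of
energies. -/
theorem energy_le (h : MinimizerData W φ w₀ w₁ ε u)
    {T : ℝ} (hT : 0 ≤ T) : energy W ε u T ≤ energy W ε u 0 +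
    (∫ t in (0 : ℝ)..T, ‖u.u' t‖ * sourceAvg φ t) + 2 * ε ^ 2 * (sourceMass φ T).toReal := by
  have h1 := h.kinetic_add_integral_profile_le hT
  have e1 : ∫ s in Ioi (0 : ℝ), Real.exp T * (s - min s T) * (Real.exp (-s) * potential W u s) =
      (∫ s in Ioi (0 : ℝ), profile T s * (Real.exp (-s) * potential W u s)) -
      (∫ s in Ioi (0 : ℝ), profileDeriv T s * (Real.exp (-s) * potential W u s)) +
      ∫ s in Ioi (0 : ℝ), s * (Real.exp (-s) * potential W u s) := by
    rw [← integral_sub (h.integrableOn_profile_potential hT)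
      (h.integrableOn_profileDeriv_potential hT), ← integral_add
      ((h.integrableOn_profile_potential hT).fun_sub (h.integrableOn_profileDeriv_potential hT))
      h.integrableOn_mul_exp_potential]
    congr 1; ext s
    rw [← sub_mul, profile_sub_profileDeriv]; ring
  rw [energy_zero, energy, e1]
  linarith

theorem sqrt_energy_le (h : MinimizerData W φ w₀ w₁ ε u)
    {T : ℝ} (hT : 0 ≤ T) : √(energy W ε u T) ≤ √(energy W ε u 0) +
    (√(2 * ε ^ 2) + √(T * ε ^ 2 / 2)) * √(sourceMass φ T).toReal := by
  have hε := h.pos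
  set Y := (sourceMass φ T).toReal with hY
  have hY0 : 0 ≤ Y := ENNReal.toReal_nonneg
  have hb : IntervalIntegrable (sourceAvg φ) volume 0 T :=
    (intervalIntegrable_iff_integrableOn_Ioc_of_le hT).2
      (integrableOn_sourceAvg h.source.1 hT (h.mass T hT))
  have hk : ∀ t, √(kinetic ε u t) * (√2 * ε * sourceAvg φ t) = ‖u.u' t‖ * sourceAvg φ t := by
    intro t
    have h2 : √(kinetic ε u t) * (√2 * ε) = ‖u.u' t‖ := by
      rw [← Real.sqrt_sq hε.le, ← Real.sqrt_mul (by norm_num), ← Real.sqrt_mul (kinetic_nonneg t),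
        Real.sqrt_sq hε.le]
      rw [show kinetic ε u t * (2 * ε ^ 2) = ‖u.u' t‖ ^ 2 by unfold kinetic; field_simp]
      exact Real.sqrt_sq (norm_nonneg _)
    rw [← h2]; ring
  -- Here y = √K and c = √2 ε 𝒜²‖φ‖, so that y c = ‖u'‖ 𝒜²‖φ‖. The error 2ε² times the source mass
  -- at time T goes into the constant F₀: the mass is nondecreasing in time, so this serves all t ≤
  -- T.
  have h1 := sqrt_le_sqrt_add_half_integral (E := energy W ε u)
    (y := fun t => √(kinetic ε u t)) (c := fun t => √2 * ε * sourceAvg φ t)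
    (F₀ := energy W ε u 0 + 2 * ε ^ 2 * Y) hT
    (add_nonneg (energy_nonneg 0) (by positivity)) (fun t _ => Real.sqrt_nonneg _)
    (fun t _ => mul_nonneg (by positivity) ENNReal.toReal_nonneg)
    (fun t _ => Real.sqrt_le_sqrt (kinetic_le_energy t)) (hb.const_mul _) (by
      simp only [hk]
      exact (lintegral_enorm_mul_avg_norm h.source.1 hT (h.mass T hT)).1) (by
      intro t ht
      simp only [hk]
      have h2 := h.energy_le ht.1
      have h3 : (sourceMass φ t).toReal ≤ Y :=
        ENNReal.toReal_mono (h.mass T hT) (sourceMass_mono h.source.1 ht.1 ht.2)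
      have h4 := mul_le_mul_of_nonneg_left h3 (show 0 ≤ 2 * ε ^ 2 by positivity)
      linarith)
  have h2 := integral_sourceAvg_le h.source.1 hT (h.mass T hT)
  rw [intervalIntegral.integral_const_mul] at h1
  have h3 : √(energy W ε u 0 + 2 * ε ^ 2 * Y) ≤ √(energy W ε u 0) + √(2 * ε ^ 2) * √Y := by
    rw [← Real.sqrt_mul (by positivity)]
    exact sqrt_add_le (energy_nonneg 0) (by positivity)
  have h4 : 1 / 2 * (√2 * ε * √(T * Y)) = √(T * ε ^ 2 / 2) * √Y := by
    rw [Real.sqrt_mul hT, Real.sqrt_div (by positivity), Real.sqrt_mul hT, Real.sqrt_sq hε.le]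
    have : √2 * √2 = 2 := Real.mul_self_sqrt (by norm_num)
    field_simp
    linear_combination (√T * √Y) * this
  have h5 : 1 / 2 * (√2 * ε * ∫ t in (0 : ℝ)..T, sourceAvg φ t) ≤
      1 / 2 * (√2 * ε * √(T * Y)) := by gcongr
  linarith

end MinimizerData

end Energy

/-! ### Growth of 𝒲 along a line, and measurability along a curve -/

section Growth

theorem exists_sublinear_bound {K θ : ℝ} (hK : 0 ≤ K) (hθ : 0 < θ) (hθ1 : θ < 1) :
    ∃ D : ℝ, 0 ≤ D ∧ ∀ y : ℝ, 0 ≤ y → K * (1 + y ^ θ) ≤ y / 2 + D := by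
  -- Weighted AM-GM applied to (l y)^θ m^{1-θ}: m is chosen so that this product is y^θ, and l so
  -- small that K θ l ≤ 1/2.
  set l : ℝ := 1 / (2 * (K + 1)) with hl
  have hl0 : 0 < l := by positivity
  set m : ℝ := l ^ (-(θ / (1 - θ))) with hm
  have hm0 : 0 < m := Real.rpow_pos_of_pos hl0 _
  have h1θ : 0 < 1 - θ := by linarith
  refine ⟨K * (1 + (1 - θ) * m), by positivity, fun y hy => ?_⟩
  have h1 := Real.geom_mean_le_arith_mean2_weighted hθ.le h1θ.le
    (mul_nonneg hl0.le hy) hm0.le (by ring)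
  have h2 : (l * y) ^ θ * m ^ (1 - θ) = y ^ θ := by
    rw [hm, ← Real.rpow_mul hl0.le, Real.mul_rpow hl0.le hy,
      show -(θ / (1 - θ)) * (1 - θ) = -θ by field_simp]
    rw [mul_right_comm, ← Real.rpow_add hl0]; simp
  rw [h2] at h1
  have h3 : K * (θ * (l * y)) ≤ y / 2 := by
    have h4 : K * l ≤ 1 / 2 := by
      rw [hl, mul_one_div, div_le_div_iff₀ (by positivity) (by norm_num)]; linarith
    have h5 : K * l * θ ≤ 1 / 2 := by
      nlinarith [mul_nonneg hK hl0.le]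
    nlinarith
  have h6 := mul_le_mul_of_nonneg_left h1 hK
  linarith

theorem le_mul_exp_half_of_hasDerivAt_le {y y' : ℝ → ℝ} {D : ℝ}
    (hy : ∀ t, HasDerivAt y (y' t) t) (hy' : ∀ t, y' t ≤ y t / 2 + D) {t : ℝ} (ht : 0 ≤ t) :
    y t + 2 * D ≤ (y 0 + 2 * D) * Real.exp (t / 2) := by
  have hd : ∀ s, HasDerivAt (fun s => Real.exp (-(s / 2)) * (y s + 2 * D))
      (Real.exp (-(s / 2)) * (y' s - y s / 2 - D)) s := by
    intro s
    have h1 : HasDerivAt (fun s : ℝ => -(s / 2)) (-(1 / 2)) s :=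
      ((hasDerivAt_id s).div_const 2).fun_neg
    refine (h1.exp.fun_mul ((hy s).add_const (2 * D))).congr_deriv ?_
    ring
  have hanti : Antitone fun s => Real.exp (-(s / 2)) * (y s + 2 * D) := by
    refine antitone_of_deriv_nonpos (fun s => (hd s).differentiableAt) fun s => ?_
    rw [(hd s).deriv]
    exact mul_nonpos_of_nonneg_of_nonpos (Real.exp_pos _).le (by linarith [hy' s])
  have h := hanti ht
  simp only [zero_div, neg_zero, Real.exp_zero, one_mul] at h
  rw [Real.exp_neg, inv_mul_le_iff₀ (Real.exp_pos _)] at h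
  linarith

variable {n : ℕ} {W : L2 n → ℝ≥0∞} {w₀ w₁ : L2 n}

/-- Along the line, y(τ) = 𝒲(w₀ + τ w₁) satisfies y' ≤ C‖w₁‖(1 + y^θ), hence y' ≤ y/2 + D because θ
< 1. The rate 1/2 matters: it must stay below the rate 1 of the weight e^{-t}. The derivative of 𝒲
is used nowhere else. -/
theorem AdmissibleFunctional.exists_growth (hW : AdmissibleFunctional W) (h0 : w₀ ∈ dom W)
    (h1 : w₁ ∈ dom W) : ∃ C : ℝ, 0 ≤ C ∧ ∀ τ : ℝ, 0 ≤ τ →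
      W (w₀ + τ • w₁) ≤ ENNReal.ofReal (C * Real.exp (τ / 2)) := by
  obtain ⟨-, V, _, _, ι, hV⟩ := hW
  rw [← hV.range_eq] at h0 h1
  obtain ⟨z₀, rfl⟩ := h0
  obtain ⟨z₁, rfl⟩ := h1
  obtain ⟨DW, C, θ, hC, hθ, hθ1, hd, hb⟩ := hV.gateaux
  obtain ⟨D, hD0, hD⟩ := exists_sublinear_bound (mul_nonneg hC (norm_nonneg z₁)) hθ hθ1
  set y : ℝ → ℝ := fun τ => (W (ι (z₀ + τ • z₁))).toReal with hy
  have hy' : ∀ τ, HasDerivAt y (DW (z₀ + τ • z₁) z₁) τ := by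
    intro τ
    have h := hd (z₀ + τ • z₁) z₁
    unfold HasLineDerivAt at h
    have h2 : HasDerivAt (fun s : ℝ => s - τ) 1 τ := (hasDerivAt_id τ).sub_const τ
    have h' : HasDerivAt (fun t : ℝ => (W (ι (z₀ + τ • z₁ + t • z₁))).toReal)
        (DW (z₀ + τ • z₁) z₁) ((fun s : ℝ => s - τ) τ) := by
      simp only [sub_self]; exact h
    have h3 := HasDerivAt.comp (h := fun s : ℝ => s - τ) τ h' h2
    rw [mul_one] at h3
    refine h3.congr_of_eventuallyEq (Eventually.of_forall fun s => ?_)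
    simp only [hy, Function.comp]
    congr 3
    rw [sub_smul]; abel
  have hle : ∀ τ, DW (z₀ + τ • z₁) z₁ ≤ y τ / 2 + D := by
    intro τ
    refine le_trans ?_ (hD (y τ) ENNReal.toReal_nonneg)
    refine (le_abs_self _).trans (((DW (z₀ + τ • z₁)).le_opNorm z₁).trans ?_)
    have := mul_le_mul_of_nonneg_right (hb (z₀ + τ • z₁)) (norm_nonneg z₁)
    linarith
  have hy0 : 0 ≤ y 0 := ENNReal.toReal_nonneg
  refine ⟨y 0 + 2 * D, by positivity, fun τ hτ => ?_⟩
  have h := le_mul_exp_half_of_hasDerivAt_le hy' hle hτ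
  have hfin : W (ι (z₀ + τ • z₁)) < ⊤ := by
    have : ι (z₀ + τ • z₁) ∈ dom W := hV.range_eq ▸ mem_range_self _
    exact this
  rw [← map_smul, ← map_add, ← ENNReal.ofReal_toReal hfin.ne]
  exact ENNReal.ofReal_le_ofReal (by linarith)

/-- A norm continuous curve is weakly continuous, so 𝒲 along it is lower semicontinuous and
therefore Borel. Replacing t by max(t, 0) is needed because u is continuous on t ≥ 0 only. -/
theorem AdmissibleFunctional.aemeasurable (hW : AdmissibleFunctional W) (u : H2loc (L2 n)) :
    AEMeasurable (fun t => W (u.u t)) (volume.restrict (Ioi 0)) := by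
  have h1 : Continuous fun t : ℝ => u.u (max t 0) :=
    u.continuousOn_u.comp_continuous (by fun_prop) fun t => mem_Ici.2 (le_max_right _ _)
  have h2 : LowerSemicontinuous fun t : ℝ => W (u.u (max t 0)) := by
    have h3 := hW.1.comp ((toWeakSpaceCLM ℝ (L2 n)).continuous.comp h1)
    exact h3
  refine h2.measurable.aemeasurable.congr ?_
  filter_upwards [ae_restrict_mem measurableSet_Ioi] with t ht
  rw [max_eq_left (le_of_lt ht)]

end Growth

/-! ### The level estimate -/

section Level

variable {n : ℕ} {W : L2 n → ℝ≥0∞} {w₀ w₁ : L2 n}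

/-- The affine function `t ↦ a + t b`. -/
noncomputable def H2loc.affine {E : Type} [NormedAddCommGroup E] [NormedSpace ℝ E]
    [CompleteSpace E] (a b : E) : H2loc E where
  u t := a + t • b
  u' _ := b
  u'' _ := 0
  memL2loc := fun _ _ => MemLp.zero
  u'_eq := by simp
  u_eq := by simp

theorem lintegral_exp_mul_exp_half {C : ℝ} (hC : 0 ≤ C) :
    ∫⁻ t in Ioi (0 : ℝ), ENNReal.ofReal (Real.exp (-t) * (C * Real.exp (t / 2))) =
      ENNReal.ofReal (2 * C) := by
  have hd : ∀ t, HasDerivAt (fun t => -(2 * C * Real.exp (-(t / 2))))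
      (Real.exp (-t) * (C * Real.exp (t / 2))) t := by
    intro t
    have h1 : HasDerivAt (fun s : ℝ => -(s / 2)) (-(1 / 2)) t :=
      ((hasDerivAt_id t).div_const 2).fun_neg
    refine (h1.exp.const_mul (2 * C)).fun_neg.congr_deriv ?_
    have h2 : Real.exp (-t) * Real.exp (t / 2) = Real.exp (-(t / 2)) := by
      rw [← Real.exp_add]; congr 1; ring
    linear_combination (-C) * h2
  have hl : Tendsto (fun t => -(2 * C * Real.exp (-(t / 2)))) atTop (𝓝 0) := by
    have := ((tendsto_exp_neg_mul_affine (c := 1 / 2) (by norm_num) 0 (2 * C))).neg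
    rw [neg_zero] at this
    refine this.congr fun s => ?_
    ring_nf
  rw [lintegral_Ioi_ofReal_eq_sub hd (fun t _ => by positivity) hl]
  simp

/-- The affine competitor has no acceleration, and ε < 1 slows the motion along the line, so the
potential grows at most like e^{t/2}. -/
theorem Hfun_affine_le {C : ℝ} (hC : 0 ≤ C)
    (hg : ∀ τ : ℝ, 0 ≤ τ → W (w₀ + τ • w₁) ≤ ENNReal.ofReal (C * Real.exp (τ / 2)))
    {ε : ℝ} (hε : ε ∈ Ioo (0 : ℝ) 1) :
    Hfun W ε (H2loc.affine w₀ (ε • w₁)) ≤ ENNReal.ofReal (2 * C) := by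
  rw [← lintegral_exp_mul_exp_half hC, Hfun]
  refine lintegral_mono_ae ?_
  filter_upwards [ae_restrict_mem measurableSet_Ioi] with t ht
  have ht' : 0 ≤ t := le_of_lt ht
  rw [ENNReal.ofReal_mul (Real.exp_pos _).le]
  refine mul_le_mul_right ?_ _
  simp only [H2loc.affine, norm_zero, ne_eq, OfNat.ofNat_ne_zero, not_false_eq_true, zero_pow,
    mul_zero, ENNReal.ofReal_zero, zero_add]
  rw [smul_smul]
  refine (hg (t * ε) (mul_nonneg ht' hε.1.le)).trans (ENNReal.ofReal_le_ofReal ?_)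
  have : t * ε ≤ t := mul_le_of_le_one_right ht' hε.2.le
  gcongr

theorem boundaryCond_affine (ε : ℝ) : BoundaryCond w₀ w₁ ε (H2loc.affine w₀ (ε • w₁)) := by
  simp [BoundaryCond, H2loc.affine]

variable {φ : ℝ → L2 n} {ε : ℝ} {u : H2loc (L2 n)}

theorem IsMinimizer.Hfun_ne_top (h : IsMinimizer W φ w₀ w₁ ε u) {v : H2loc (L2 n)}
    (hv : BoundaryCond w₀ w₁ ε v) (hfin : Hfun W ε v ≠ ⊤) : Hfun W ε u ≠ ⊤ := by
  intro htop
  have h1 := h.2 v hv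
  rw [Jfun, Jfun, htop] at h1
  lift Hfun W ε v to NNReal using hfin with a
  rw [EReal.coe_ennreal_top, EReal.top_sub_coe, EReal.coe_nnreal_eq_coe_real, ← EReal.coe_sub,
    top_le_iff] at h1
  exact EReal.coe_ne_top _ h1

/-- The difference to the affine function and its derivative both vanish at time 0, so the Hardy
inequality applies twice: 16 = 4 · 4. -/
theorem lintegral_exp_mul_sub_affine_sq_le (hu : BoundaryCond w₀ w₁ ε u) :
    ∫⁻ t in Ioi (0 : ℝ), ENNReal.ofReal (Real.exp (-t)) *
      ‖u.u t - (H2loc.affine w₀ (ε • w₁)).u t‖ₑ ^ 2 ≤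
      16 * ∫⁻ t in Ioi (0 : ℝ), ENNReal.ofReal (Real.exp (-t)) * ‖u.u'' t‖ₑ ^ 2 := by
  have e1 : ∀ t ∈ Ioi (0 : ℝ), u.u t - (H2loc.affine w₀ (ε • w₁)).u t =
      ∫ s in (0 : ℝ)..t, (u.u' s - ε • w₁) := by
    intro t ht
    have ht' : 0 ≤ t := le_of_lt (mem_Ioi.1 ht)
    rw [intervalIntegral.integral_sub (u.intervalIntegrable_u' le_rfl ht') (by simp),
      ← u.u_sub le_rfl ht', hu.1]
    simp only [H2loc.affine, intervalIntegral.integral_const, sub_zero]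
    abel
  have e2 : ∀ t ∈ Ioi (0 : ℝ), u.u' t - ε • w₁ = ∫ s in (0 : ℝ)..t, u.u'' s := by
    intro t ht
    rw [← u.u'_sub le_rfl (le_of_lt (mem_Ioi.1 ht)), hu.2]
  have hm : AEStronglyMeasurable (fun s => u.u' s - ε • w₁) (volume.restrict (Ioi 0)) :=
    ((u.continuousOn_u'.mono Ioi_subset_Ici_self).sub
      continuousOn_const).aestronglyMeasurable measurableSet_Ioi
  have h1 := lintegral_exp_mul_primitive_sq_le hm
  have h2 := lintegral_exp_mul_primitive_sq_le u.aestronglyMeasurable_u''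
  calc _ = ∫⁻ t in Ioi (0 : ℝ), ENNReal.ofReal (Real.exp (-t)) *
        ‖∫ s in (0 : ℝ)..t, (u.u' s - ε • w₁)‖ₑ ^ 2 :=
        setLIntegral_congr_fun measurableSet_Ioi fun t ht => by simp only [e1 t ht]
    _ ≤ _ := h1
    _ = 4 * ∫⁻ t in Ioi (0 : ℝ), ENNReal.ofReal (Real.exp (-t)) *
        ‖∫ s in (0 : ℝ)..t, u.u'' s‖ₑ ^ 2 := by
        congr 1
        exact setLIntegral_congr_fun measurableSet_Ioi fun t ht => by simp only [e2 t ht]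
    _ ≤ 4 * (4 * ∫⁻ t in Ioi (0 : ℝ), ENNReal.ofReal (Real.exp (-t)) * ‖u.u'' t‖ₑ ^ 2) :=
        mul_le_mul_right h2 _
    _ = _ := by rw [← mul_assoc]; norm_num

theorem lintegral_exp_mul_u''_sq_le (hε : 0 < ε) :
    ∫⁻ t in Ioi (0 : ℝ), ENNReal.ofReal (Real.exp (-t)) * ‖u.u'' t‖ₑ ^ 2 ≤
      ENNReal.ofReal (2 * ε ^ 2) * Hfun W ε u := by
  rw [lintegral_accel_add_lintegral_potential]
  refine le_trans (le_of_eq ?_) (mul_le_mul_right le_self_add _)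
  rw [← lintegral_const_mul' _ _ ENNReal.ofReal_ne_top]
  refine lintegral_congr fun t => ?_
  rw [← ofReal_norm_sq, ← ENNReal.ofReal_mul (Real.exp_pos _).le,
    ← ENNReal.ofReal_mul (by positivity)]
  congr 1
  unfold accel; field_simp

/-- The level estimate: the value `Hfun W ε u` at a minimizer is bounded uniformly in `ε`. -/
theorem IsMinimizer.toReal_Hfun_le (h : IsMinimizer W φ w₀ w₁ ε u) (hε : ε ∈ Ioo (0 : ℝ) 1)
    {C : ℝ} (hC : 0 ≤ C)
    (hg : ∀ τ : ℝ, 0 ≤ τ → W (w₀ + τ • w₁) ≤ ENNReal.ofReal (C * Real.exp (τ / 2)))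
    {Tstar : ℝ} (hφ : IntegrableOn φ (Ioi 0))
    (hφ0 : ∀ᵐ t : ℝ, 0 ≤ t → Tstar < t → φ t = 0)
    (hφ1 : weightedNormSq φ ≤ ENNReal.ofReal (ε ^ 2)) :
    Hfun W ε u ≠ ⊤ ∧ (Hfun W ε u).toReal ≤ 4 * C + 64 := by
  have hv := boundaryCond_affine (w₀ := w₀) (w₁ := w₁) ε
  have hHv := Hfun_affine_le hC hg hε
  have hvfin := ne_top_of_le_ne_top ENNReal.ofReal_ne_top hHv
  have hufin := h.Hfun_ne_top hv hvfin
  refine ⟨hufin, ?_⟩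
  set v := H2loc.affine w₀ (ε • w₁) with hvdef
  have hε0 := hε.1
  have hε1 : ε ^ 2 ≤ 1 := pow_le_one₀ hε0.le hε.2.le
  have h1 := toReal_sub_le_of_coe_sub_le hufin hvfin (h.2 v hv)
  have h2 := ENNReal.toReal_le_of_le_ofReal (by positivity) hHv
  set x := (Hfun W ε u).toReal with hx
  have hx0 : 0 ≤ x := ENNReal.toReal_nonneg
  have hint : ∀ z : H2loc (L2 n),
      IntegrableOn (fun t => Real.exp (-t) * inner ℝ (φ t) (z.u t)) (Ioi 0) := by
    intro z
    refine (integrableOn_inner_of_ae_eq_zero hφ hφ0 z.continuousOn_u).bdd_mul (c := 1)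
      (by fun_prop) ?_
    filter_upwards [ae_restrict_mem measurableSet_Ioi] with t ht
    rw [Real.norm_eq_abs, Real.abs_exp, Real.exp_le_one_iff]
    linarith [mem_Ioi.1 ht]
  have h3 : Sfun φ u - Sfun φ v =
      ∫ t in Ioi (0 : ℝ), Real.exp (-t) * inner ℝ (φ t) (u.u t - v.u t) := by
    rw [Sfun, Sfun, ← integral_sub (hint u) (hint v)]
    congr 1; ext t; rw [inner_sub_right]; ring
  have hmφ : AEMeasurable (fun t => ENNReal.ofReal (Real.exp (-t)) * ‖φ t‖ₑ ^ 2)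
      (volume.restrict (Ioi 0)) := AEMeasurable.mul (by fun_prop) (hφ.1.enorm.pow_const 2)
  -- Young's inequality with parameter 4: the coefficient 1/128, times 16 from Hardy and 2ε² from
  -- the definition of the density, leaves x/4 · ε², small enough to be absorbed by x on the left;
  -- the other coefficient is 32.
  have h4 : ‖Sfun φ u - Sfun φ v‖ₑ ≤ ENNReal.ofReal (32 * ε ^ 2 + x / 4 * ε ^ 2) := by
    rw [h3]
    calc ‖∫ t in Ioi (0 : ℝ), Real.exp (-t) * inner ℝ (φ t) (u.u t - v.u t)‖ₑ
        ≤ ∫⁻ t in Ioi (0 : ℝ), ‖Real.exp (-t) * inner ℝ (φ t) (u.u t - v.u t)‖ₑ :=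
          enorm_integral_le_lintegral_enorm _
      _ ≤ ∫⁻ t in Ioi (0 : ℝ), (ENNReal.ofReal (2 * 4 ^ 2) *
            (ENNReal.ofReal (Real.exp (-t)) * ‖φ t‖ₑ ^ 2) +
            ENNReal.ofReal (1 / (8 * 4 ^ 2)) *
              (ENNReal.ofReal (Real.exp (-t)) * ‖u.u t - v.u t‖ₑ ^ 2)) := by
          refine lintegral_mono fun t => ?_
          have e1 : ‖Real.exp (-t) * inner ℝ (φ t) (u.u t - v.u t)‖ₑ ≤
              ENNReal.ofReal (Real.exp (-t)) * (‖φ t‖ₑ * ‖u.u t - v.u t‖ₑ) := by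
            simp only [← ofReal_norm]
            rw [← ENNReal.ofReal_mul (norm_nonneg _), ← ENNReal.ofReal_mul (Real.exp_pos _).le]
            refine ENNReal.ofReal_le_ofReal ?_
            rw [norm_mul, Real.norm_eq_abs, Real.abs_exp]
            exact mul_le_mul_of_nonneg_left (norm_inner_le_norm _ _) (Real.exp_pos _).le
          refine e1.trans ((mul_le_mul_right
            (enorm_mul_enorm_le (by norm_num : (0 : ℝ) < 4) (φ t) (u.u t - v.u t) 0) _).trans_eq ?_)
          rw [sub_zero, enorm_zero, zero_mul, zero_add]
          ring
      _ = ENNReal.ofReal (2 * 4 ^ 2) * weightedNormSq φ + ENNReal.ofReal (1 / (8 * 4 ^ 2)) *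
            ∫⁻ t in Ioi (0 : ℝ), ENNReal.ofReal (Real.exp (-t)) * ‖u.u t - v.u t‖ₑ ^ 2 := by
          rw [lintegral_add_left' (hmφ.const_mul _),
            lintegral_const_mul' _ _ ENNReal.ofReal_ne_top,
            lintegral_const_mul' _ _ ENNReal.ofReal_ne_top]
          simp only [weightedNormSq, ofReal_norm_sq]
      _ ≤ ENNReal.ofReal (2 * 4 ^ 2) * ENNReal.ofReal (ε ^ 2) + ENNReal.ofReal (1 / (8 * 4 ^ 2)) *
            (ENNReal.ofReal 16 * (ENNReal.ofReal (2 * ε ^ 2) * ENNReal.ofReal x)) := by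
          refine add_le_add (mul_le_mul_right hφ1 _) (mul_le_mul_right ?_ _)
          refine (lintegral_exp_mul_sub_affine_sq_le h.1).trans ?_
          rw [hx, ENNReal.ofReal_toReal hufin, ENNReal.ofReal_ofNat]
          exact mul_le_mul_right (lintegral_exp_mul_u''_sq_le hε0) _
      _ = _ := by
          rw [← ENNReal.ofReal_mul (by positivity), ← ENNReal.ofReal_mul (by positivity),
            ← ENNReal.ofReal_mul (by positivity), ← ENNReal.ofReal_mul (by positivity),
            ← ENNReal.ofReal_add (by positivity) (by positivity)]
          congr 1; ring
  rw [← ofReal_norm, ENNReal.ofReal_le_ofReal_iff (by positivity)] at h4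
  have h5 := (le_abs_self _).trans h4
  nlinarith

end Level

/-! ### Bounds uniform in ε: the source and the energy at time 0 -/

section Source

variable {n : ℕ} {W : L2 n → ℝ≥0∞} {f φ : ℝ → L2 n} {w₀ w₁ : L2 n} {ε τ : ℝ} {u : H2loc (L2 n)}

theorem intervalIntegrable_norm_sq (hf : IsL2loc f) {a b : ℝ} (ha : 0 ≤ a) (hb : 0 ≤ b) :
    IntervalIntegrable (fun s => ‖f s‖ ^ 2) volume a b := by
  have h1 := hf (max a b + 1) (by positivity)
  have h2 := (memLp_two_iff_integrable_sq_norm h1.1).1 h1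
  rw [intervalIntegrable_iff]
  refine IntegrableOn.mono_set h2 fun x hx => ?_
  rw [uIoc, mem_Ioc] at hx
  exact ⟨(le_min ha hb).trans_lt hx.1, by linarith [hx.2]⟩

theorem gam_mono (hf : IsL2loc f) {a b : ℝ} (ha : 0 ≤ a) (hab : a ≤ b) : gam f a ≤ gam f b := by
  rw [gam, gam, ← intervalIntegral.integral_add_adjacent_intervals
    (intervalIntegrable_norm_sq hf le_rfl ha) (intervalIntegrable_norm_sq hf ha (ha.trans hab))]
  exact le_add_of_nonneg_right (intervalIntegral.integral_nonneg hab fun s _ => by positivity)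

theorem gam_nonneg {a : ℝ} (ha : 0 ≤ a) : 0 ≤ gam f a :=
  intervalIntegral.integral_nonneg ha fun s _ => by positivity

theorem profile_mul_exp_neg_le_one {T s : ℝ} (hs : 0 ≤ s) :
    profile T s * Real.exp (-s) ≤ 1 := by
  rw [Real.exp_neg, ← div_eq_mul_inv, div_le_one (Real.exp_pos s), profile]
  rcases le_total s T with h | h
  · rw [min_eq_left h]; linarith
  · rw [min_eq_right h]
    have h1 : Real.exp s = Real.exp T * Real.exp (s - T) := by rw [← Real.exp_add]; congr 1; ring
    have h2 := mul_le_mul_of_nonneg_left (Real.add_one_le_exp (s - T)) (Real.exp_pos T).le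
    linarith

namespace SourceCond

theorem sourceMass_le (h : SourceCond f τ ε φ) {T : ℝ} (hT : 0 ≤ T) :
    ENNReal.ofReal ε * sourceMass φ T ≤ ENNReal.ofReal (gam f (ε * T + τ) + ε ^ 2) := by
  rw [sourceMass_eq h.meas hT]
  exact h.avg_le T hT

theorem sourceMass_ne_top (h : SourceCond f τ ε φ) (hε : 0 < ε) {T : ℝ} (hT : 0 ≤ T) :
    sourceMass φ T ≠ ⊤ := by
  intro htop
  have h1 := h.sourceMass_le hT
  rw [htop, ENNReal.mul_top (by simpa using hε)] at h1
  exact ENNReal.ofReal_ne_top (top_le_iff.1 h1)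

theorem mul_toReal_sourceMass_le (h : SourceCond f τ ε φ) (hε : 0 < ε) (hτ : 0 < τ) {T : ℝ}
    (hT : 0 ≤ T) : ε * (sourceMass φ T).toReal ≤ gam f (ε * T + τ) + ε ^ 2 := by
  have h0 : 0 ≤ gam f (ε * T + τ) := gam_nonneg (by positivity)
  have h1 := ENNReal.toReal_le_of_le_ofReal (by positivity) (h.sourceMass_le hT)
  rwa [ENNReal.toReal_mul, ENNReal.toReal_ofReal hε.le] at h1

/-- Since φ vanishes after `Tstar`, the weight e^{-t} is bounded below where it matters, and ‖φ‖ ≤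
‖φ‖² + 1. -/
theorem integrableOn (h : SourceCond f τ ε φ) : IntegrableOn φ (Ioi 0) := by
  obtain ⟨Tstar, -, hs⟩ := h.supp
  have hm : AEMeasurable (fun t => ‖φ t‖) (volume.restrict (Ioi 0)) := h.meas.norm.aemeasurable
  have h1 : IntegrableOn (fun t => Real.exp (-t) * ‖φ t‖ ^ 2) (Ioi 0) := by
    refine ⟨(AEMeasurable.mul (by fun_prop) (hm.pow_const 2)).aestronglyMeasurable, ?_⟩
    rw [hasFiniteIntegral_iff_ofReal (Eventually.of_forall fun t => by positivity)]
    refine lt_of_eq_of_lt ?_ (h.norm_le.trans_lt ENNReal.ofReal_lt_top)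
    exact lintegral_congr fun t => ENNReal.ofReal_mul (Real.exp_pos _).le
  have h2 : IntegrableOn (fun t : ℝ => Real.exp (-t)) (Ioi 0) := integrableOn_exp_neg_Ioi 0
  refine ((h1.add h2).const_mul (Real.exp Tstar)).mono' h.meas ?_
  filter_upwards [ae_restrict_of_ae hs, ae_restrict_mem measurableSet_Ioi] with t ht ht0
  rcases le_or_gt t Tstar with h3 | h3
  · have h4 : 1 ≤ Real.exp Tstar * Real.exp (-t) := by
      rw [← Real.exp_add]; exact Real.one_le_exp (by linarith)
    have h5 : ‖φ t‖ ≤ ‖φ t‖ ^ 2 + 1 := by nlinarith [sq_nonneg (‖φ t‖ - 1)]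
    have h6 := mul_le_mul_of_nonneg_right h4 (show 0 ≤ ‖φ t‖ ^ 2 + 1 by positivity)
    simp only [Pi.add_apply]
    linarith
  · rw [ht (le_of_lt ht0) h3, norm_zero]
    simp only [Pi.add_apply]; positivity

/-- For ε ≥ a the support condition confines φ to times at most 1/a², so the weighted norm controls
the source mass without any reference to the time shift. -/
theorem toReal_sourceMass_le_exp (h : SourceCond f τ ε φ) {T a : ℝ} (hT : 0 ≤ T) (ha : 0 < a)
    (hε : ε ∈ Ioo (0 : ℝ) 1) (haε : a ≤ ε) :
    (sourceMass φ T).toReal ≤ Real.exp (1 / a ^ 2) := by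
  obtain ⟨Tstar, hT1, hs⟩ := h.supp
  have hTs : Tstar ≤ 1 / a ^ 2 := by
    rw [le_div_iff₀ (by positivity)]
    rcases le_or_gt Tstar 0 with h0 | h0
    · nlinarith [sq_nonneg a]
    · have h1 : √ε ≤ 1 := Real.sqrt_le_one.2 hε.2.le
      have h2 : a ^ 2 ≤ ε ^ 2 := pow_le_pow_left₀ ha.le haε 2
      nlinarith
  refine ENNReal.toReal_le_of_le_ofReal (Real.exp_pos _).le ?_
  have hε1 : ε ^ 2 ≤ 1 := pow_le_one₀ hε.1.le hε.2.le
  calc sourceMass φ T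
      ≤ ∫⁻ t in Ioi (0 : ℝ), ENNReal.ofReal (Real.exp (1 / a ^ 2)) *
          (ENNReal.ofReal (Real.exp (-t)) * ENNReal.ofReal (‖φ t‖ ^ 2)) := by
        refine lintegral_mono_ae ?_
        filter_upwards [ae_restrict_of_ae hs, ae_restrict_mem measurableSet_Ioi] with t ht ht0
        have hpn := profile_nonneg hT (le_of_lt ht0)
        rw [← ofReal_norm_sq, ← ENNReal.ofReal_mul (by positivity),
          ← ENNReal.ofReal_mul (by positivity), ← ENNReal.ofReal_mul (by positivity)]
        refine ENNReal.ofReal_le_ofReal ?_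
        rcases le_or_gt t Tstar with h3 | h3
        · rw [← mul_assoc]
          refine mul_le_mul_of_nonneg_right ?_ (by positivity)
          refine (profile_mul_exp_neg_le_one (le_of_lt ht0)).trans ?_
          rw [← Real.exp_add]
          exact Real.one_le_exp (by linarith)
        · simp [ht (le_of_lt ht0) h3]
    _ = ENNReal.ofReal (Real.exp (1 / a ^ 2)) * weightedNormSq φ :=
        lintegral_const_mul' _ _ ENNReal.ofReal_ne_top
    _ ≤ ENNReal.ofReal (Real.exp (1 / a ^ 2)) * ENNReal.ofReal (ε ^ 2) :=
        mul_le_mul_right h.norm_le _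
    _ ≤ _ := by
        rw [← ENNReal.ofReal_mul (Real.exp_pos _).le]
        exact ENNReal.ofReal_le_ofReal (mul_le_of_le_one_right (Real.exp_pos _).le hε1)

end SourceCond

/-- The time shift tends to 0 as ε ↓ 0 but need not be bounded on (0, 1). For small ε it is below 1
and the averaged condition bounds the mass by γ(T + 1) + 1; for ε bounded away from 0 the support
condition takes over. -/
theorem exists_source_bound {tε : ℝ → ℝ} {φ : ℝ → ℝ → L2 n} (hf : IsL2loc f)
    (htε : ∀ ε ∈ Ioo (0 : ℝ) 1, 0 < tε ε) (hlim : Tendsto tε (𝓝[>] 0) (𝓝 0))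
    (hφ : ∀ ε ∈ Ioo (0 : ℝ) 1, SourceCond f (tε ε) ε (φ ε)) {T : ℝ} (hT : 0 ≤ T) :
    ∃ G : ℝ, ∀ ε ∈ Ioo (0 : ℝ) 1, ε * (sourceMass (φ ε) (T / ε)).toReal ≤ G := by
  obtain ⟨a, ha, hlt⟩ := mem_nhdsGT_iff_exists_Ioo_subset.1
    (hlim.eventually (Iio_mem_nhds one_pos))
  refine ⟨max (gam f (T + 1) + 1) (Real.exp (1 / a ^ 2)), fun ε hε => ?_⟩
  have hε0 := hε.1
  have hε1 : ε ^ 2 ≤ 1 := pow_le_one₀ hε.1.le hε.2.le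
  rcases lt_or_ge ε a with h | h
  · refine le_max_of_le_left ?_
    have h1 := (hφ ε hε).mul_toReal_sourceMass_le hε0 (htε ε hε) (div_nonneg hT hε0.le)
    rw [mul_div_cancel₀ _ hε0.ne'] at h1
    have h2 : tε ε < 1 := hlt ⟨hε0, h⟩
    have h3 := gam_mono hf (add_nonneg hT (htε ε hε).le) (show T + tε ε ≤ T + 1 by linarith)
    linarith
  · refine le_max_of_le_right ?_
    have h1 := (hφ ε hε).toReal_sourceMass_le_exp (div_nonneg hT hε0.le) ha hε h
    exact (mul_le_of_le_one_left ENNReal.toReal_nonneg hε.2.le).trans h1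

/-- On [0, 1] the weight is at least e⁻¹, so u' is its initial value plus the integral of u'',
controlled by the level. The factor ε is essential: it compensates the growth of the source mass
like 1/ε. -/
theorem MinimizerData.norm_u'_le (h : MinimizerData W φ w₀ w₁ ε u) {t : ℝ} (ht : t ∈ Icc 0 1) :
    ‖u.u' t‖ ≤ ε * (‖w₁‖ + 1 / 2 + Real.exp 1 * (Hfun W ε u).toReal) := by
  have hε := h.pos
  have iA := integrableOn_exp_mul_accel h.finite
  have h1 : ‖∫ s in (0 : ℝ)..t, u.u'' s‖ ≤
      ∫ s in (0 : ℝ)..t, (ε / 2 + ε * Real.exp 1 * (Real.exp (-s) * accel ε u s)) := by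
    have hi : IntervalIntegrable (fun s => Real.exp (-s) * accel ε u s) volume 0 t :=
      (intervalIntegrable_iff_integrableOn_Ioc_of_le ht.1).2 (iA.mono_set Ioc_subset_Ioi_self)
    refine (intervalIntegral.norm_integral_le_integral_norm ht.1).trans
      (intervalIntegral.integral_mono_on ht.1 (u.intervalIntegrable_u'' le_rfl ht.1).norm
        ((by simp : IntervalIntegrable (fun _ => ε / 2) volume 0 t).add (hi.const_mul _))
        fun s hs => ?_)
    have h2 : 1 ≤ Real.exp 1 * Real.exp (-s) := by
      rw [← Real.exp_add]; exact Real.one_le_exp (by linarith [hs.2, ht.2])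
    -- Young's inequality balanced so that both terms carry a factor ε.
    have h3 : ‖u.u'' s‖ ≤ ε / 2 + ε * accel ε u s := by
      have : ε / 2 + ε * accel ε u s - ‖u.u'' s‖ = (ε - ‖u.u'' s‖) ^ 2 / (2 * ε) := by
        unfold accel; field_simp; ring
      have h4 : 0 ≤ (ε - ‖u.u'' s‖) ^ 2 / (2 * ε) := by positivity
      linarith
    have h5 := mul_le_mul_of_nonneg_right h2
      (mul_nonneg hε.le (accel_nonneg (ε := ε) (u := u) s))
    linarith
  have h2 : ∫ s in (0 : ℝ)..t, (ε / 2 + ε * Real.exp 1 * (Real.exp (-s) * accel ε u s)) ≤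
      ε / 2 + ε * Real.exp 1 * (Hfun W ε u).toReal := by
    have hi : IntervalIntegrable (fun s => Real.exp (-s) * accel ε u s) volume 0 t :=
      (intervalIntegrable_iff_integrableOn_Ioc_of_le ht.1).2 (iA.mono_set Ioc_subset_Ioi_self)
    rw [intervalIntegral.integral_add (by simp) (hi.const_mul _),
      intervalIntegral.integral_const_mul]
    have h3 : ∫ s in (0 : ℝ)..t, Real.exp (-s) * accel ε u s ≤ (Hfun W ε u).toReal := by
      rw [toReal_Hfun h.finite h.meas, intervalIntegral.integral_of_le ht.1]
      have iW := integrableOn_exp_mul_potential h.finite h.meas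
      refine (setIntegral_mono_set iA (Eventually.of_forall fun s =>
        mul_nonneg (Real.exp_pos _).le (accel_nonneg s))
        (show Ioc 0 t ⊆ Ioi 0 from fun x hx => hx.1).eventuallyLE).trans ?_
      refine integral_mono iA ((iA.add iW).congr (Eventually.of_forall fun s => by
        simp only [Pi.add_apply]; ring)) fun s => ?_
      exact mul_le_mul_of_nonneg_left (le_add_of_nonneg_right (potential_nonneg s))
        (Real.exp_pos _).le
    refine add_le_add ?_ (mul_le_mul_of_nonneg_left h3 (by positivity))
    simp only [intervalIntegral.integral_const, sub_zero, smul_eq_mul]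
    exact mul_le_of_le_one_left (by positivity) ht.2
  have h3 : u.u' t = ε • w₁ + ∫ s in (0 : ℝ)..t, u.u'' s := by
    rw [u.u'_eq t ht.1, h.isMin.1.2]
  rw [h3]
  refine (norm_add_le _ _).trans ?_
  rw [norm_smul, Real.norm_eq_abs, abs_of_pos hε]
  linarith

theorem MinimizerData.kinetic_zero (h : MinimizerData W φ w₀ w₁ ε u) :
    kinetic ε u 0 = ‖w₁‖ ^ 2 / 2 := by
  have hε := h.pos
  rw [kinetic, h.isMin.1.2, norm_smul, Real.norm_eq_abs, abs_of_pos hε]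
  field_simp

/-- The weighted inequality with T = 1 bounds the potential against g by the level and the source,
and s ≤ 1 + g(s) transfers this to the first moment. The initial kinetic energy ‖w₁‖²/2 enters
twice: through that inequality and through the energy itself. -/
theorem MinimizerData.energy_zero_le (h : MinimizerData W φ w₀ w₁ ε u) (hε1 : ε < 1) {A G : ℝ}
    (hA : (Hfun W ε u).toReal ≤ A) (hG : ε * (sourceMass φ 1).toReal ≤ G) :
    energy W ε u 0 ≤ ‖w₁‖ ^ 2 + (1 + Real.exp 1) * A +
      (‖w₁‖ + 1 / 2 + Real.exp 1 * A) * √G + 2 * G := by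
  have hε := h.pos
  have hY0 : 0 ≤ (sourceMass φ 1).toReal := ENNReal.toReal_nonneg
  have iW := integrableOn_exp_mul_potential h.finite h.meas
  have iA := integrableOn_exp_mul_accel h.finite
  have ip := h.integrableOn_profile_potential zero_le_one
  have hPA : ∫ s in Ioi (0 : ℝ), Real.exp (-s) * potential W u s ≤ A := by
    refine le_trans ?_ hA
    rw [toReal_Hfun h.finite h.meas]
    refine integral_mono iW ((iA.add iW).congr (Eventually.of_forall fun s => by
      simp only [Pi.add_apply]; ring)) fun s => ?_
    exact mul_le_mul_of_nonneg_left (le_add_of_nonneg_left (accel_nonneg s)) (Real.exp_pos _).le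
  have h1 := h.kinetic_add_integral_profile_le zero_le_one
  have h2 : ∫ s in Ioi (0 : ℝ), profileDeriv 1 s * (Real.exp (-s) * potential W u s) ≤
      Real.exp 1 * A := by
    refine le_trans ?_ (mul_le_mul_of_nonneg_left hPA (Real.exp_pos 1).le)
    rw [← integral_const_mul]
    refine integral_mono (h.integrableOn_profileDeriv_potential zero_le_one) (iW.const_mul _)
      fun s => ?_
    exact mul_le_mul_of_nonneg_right (profileDeriv_le 1 s)
      (mul_nonneg (Real.exp_pos _).le (potential_nonneg s))
  have h3 : ∫ s in Ioi (0 : ℝ), s * (Real.exp (-s) * potential W u s) ≤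
      A + ∫ s in Ioi (0 : ℝ), profile 1 s * (Real.exp (-s) * potential W u s) := by
    refine le_trans ?_ (add_le_add_left hPA _)
    rw [← integral_add iW ip]
    refine setIntegral_mono_on h.integrableOn_mul_exp_potential (iW.add ip) measurableSet_Ioi
      fun s hs => ?_
    have := mul_le_mul_of_nonneg_right (le_one_add_profile_one (le_of_lt hs))
      (mul_nonneg (Real.exp_pos (-s)).le (potential_nonneg (W := W) (u := u) s))
    linarith
  set B := ‖w₁‖ + 1 / 2 + Real.exp 1 * A with hB
  have hA0 : 0 ≤ A := ENNReal.toReal_nonneg.trans hA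
  have hB0 : 0 ≤ B := by positivity
  have hb := integral_sourceAvg_le h.source.1 zero_le_one (h.mass 1 zero_le_one)
  have h4 : ∫ t in (0 : ℝ)..1, ‖u.u' t‖ * sourceAvg φ t ≤ B * √G := by
    have h5 : ∫ t in (0 : ℝ)..1, ‖u.u' t‖ * sourceAvg φ t ≤
        ∫ t in (0 : ℝ)..1, ε * B * sourceAvg φ t := by
      refine intervalIntegral.integral_mono_on zero_le_one
        (lintegral_enorm_mul_avg_norm h.source.1 zero_le_one (h.mass 1 zero_le_one)).1
        (((intervalIntegrable_iff_integrableOn_Ioc_of_le zero_le_one).2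
          (integrableOn_sourceAvg h.source.1 zero_le_one (h.mass 1 zero_le_one))).const_mul _)
        fun t ht => ?_
      refine mul_le_mul_of_nonneg_right ((h.norm_u'_le ht).trans ?_) ENNReal.toReal_nonneg
      rw [hB]
      gcongr
    rw [intervalIntegral.integral_const_mul] at h5
    have h6 : ε * √(1 * (sourceMass φ 1).toReal) ≤ √G := by
      refine Real.le_sqrt_of_sq_le ?_
      rw [one_mul, mul_pow, Real.sq_sqrt hY0]
      nlinarith [mul_nonneg hε.le hY0]
    calc _ ≤ _ := h5
      _ ≤ ε * B * √(1 * (sourceMass φ 1).toReal) := by gcongr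
      _ = B * (ε * √(1 * (sourceMass φ 1).toReal)) := by ring
      _ ≤ _ := by gcongr
  have h7 : 2 * ε ^ 2 * (sourceMass φ 1).toReal ≤ 2 * G := by
    nlinarith [mul_nonneg hε.le hY0]
  have h8 := kinetic_nonneg (ε := ε) (u := u) 1
  have h9 := h.kinetic_zero
  rw [energy_zero]
  linarith

/-- Scaling: at time T/ε one factor √ε can be taken from each coefficient and joined to the source
mass, leaving √(2ε) and √(T/2). -/
theorem MinimizerData.sqrt_energy_div_le (h : MinimizerData W φ w₀ w₁ ε u) {T Γ : ℝ}
    (hT : 0 ≤ T) (hΓ : ε * (sourceMass φ (T / ε)).toReal ≤ Γ) :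
    √(energy W ε u (T / ε)) ≤ √(energy W ε u 0) + (√(ε * 2) + √(T / 2)) * √Γ := by
  have hε := h.pos
  refine (h.sqrt_energy_le (div_nonneg hT hε.le)).trans (add_le_add_right ?_ _)
  have e1 : 2 * ε ^ 2 = ε * 2 * ε := by ring
  have e2 : T / ε * ε ^ 2 / 2 = T / 2 * ε := by field_simp
  rw [e1, e2, Real.sqrt_mul (show 0 ≤ ε * 2 by positivity) ε,
    Real.sqrt_mul (show 0 ≤ T / 2 by positivity) ε, ← add_mul, mul_assoc, ← Real.sqrt_mul hε.le]
  gcongr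

end Source

/-! ### Conclusion -/

theorem mainTheorem2 :
    ∃ Cβ : ℝ → ℝ, (∀ β : ℝ, 1 < β → 0 < Cβ β) ∧
      ∀ (n : ℕ) (W : L2 n → ℝ≥0∞) (w₀ w₁ : L2 n) (f : ℝ → L2 n)
        (tε : ℝ → ℝ) (φ : ℝ → ℝ → L2 n) (u : ℝ → H2loc (L2 n)),
        AdmissibleFunctional W →
        w₀ ∈ dom W → w₁ ∈ dom W →
        IsL2loc f →
        (∀ ε ∈ Ioo (0 : ℝ) 1, 0 < tε ε) →
        Tendsto tε (𝓝[>] 0) (𝓝 0) →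
        (∀ ε ∈ Ioo (0 : ℝ) 1, SourceCond f (tε ε) ε (φ ε)) →
        (∀ ε ∈ Ioo (0 : ℝ) 1, IsMinimizer W (φ ε) w₀ w₁ ε (u ε)) →
        (∀ ε ∈ Ioo (0 : ℝ) 1, ∀ t : ℝ, 0 ≤ t → approxEnergy W ε (u ε) t < ⊤) ∧
        (∀ β : ℝ, 1 < β → ∀ T : ℝ, 0 ≤ T → ∀ ε ∈ Ioo (0 : ℝ) 1,
          √(approxEnergy W ε (u ε) (T / ε)).toReal ≤
            √(approxEnergy W ε (u ε) 0).toReal +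
              (√(ε * Cβ β) + √(T * β / 2)) * √(gam f (T + tε ε) + ε ^ 2)) ∧
        (∀ T : ℝ, 0 ≤ T → ∃ C : ℝ, ∀ ε ∈ Ioo (0 : ℝ) 1, ∀ t ∈ Icc 0 T,
          (approxEnergy W ε (u ε) (t / ε)).toReal ≤ C) := by
  -- The value 2 is the constant of the term 2ε² from Young's inequality. It serves for every β,
  -- since T/2 ≤ Tβ/2 is the only way in which β enters.
  refine ⟨fun _ => 2, fun _ _ => two_pos, ?_⟩
  intro n W w₀ w₁ f tε φ u hW h0 h1 hf htε hlim hφ hu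
  obtain ⟨C, hC, hg⟩ := hW.exists_growth h0 h1
  have hlevel : ∀ ε ∈ Ioo (0 : ℝ) 1, Hfun W ε (u ε) ≠ ⊤ ∧
      (Hfun W ε (u ε)).toReal ≤ 4 * C + 64 := fun ε hε => by
    obtain ⟨Tstar, -, hs⟩ := (hφ ε hε).supp
    exact (hu ε hε).toReal_Hfun_le hε hC hg (hφ ε hε).integrableOn hs (hφ ε hε).norm_le
  have hdata : ∀ ε ∈ Ioo (0 : ℝ) 1, MinimizerData W (φ ε) w₀ w₁ ε (u ε) := fun ε hε =>
    { pos := hε.1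
      isMin := hu ε hε
      finite := (hlevel ε hε).1
      meas := hW.aemeasurable (u ε)
      source := (hφ ε hε).integrableOn
      supp := by
        obtain ⟨Tstar, -, hs⟩ := (hφ ε hε).supp
        exact ⟨Tstar, hs⟩
      mass := fun T hT => (hφ ε hε).sourceMass_ne_top hε.1 hT }
  have hE : ∀ ε ∈ Ioo (0 : ℝ) 1, ∀ t, 0 ≤ t →
      (approxEnergy W ε (u ε) t).toReal = energy W ε (u ε) t := fun ε hε t ht => by
    rw [(hdata ε hε).approxEnergy_eq ht, ENNReal.toReal_ofReal (energy_nonneg t)]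
  refine ⟨fun ε hε t ht => ?_, fun β hβ T hT ε hε => ?_, fun T hT => ?_⟩
  · rw [(hdata ε hε).approxEnergy_eq ht]
    exact ENNReal.ofReal_lt_top
  · rw [hE ε hε _ (div_nonneg hT hε.1.le), hE ε hε 0 le_rfl]
    have hΓ := (hφ ε hε).mul_toReal_sourceMass_le hε.1 (htε ε hε) (div_nonneg hT hε.1.le)
    rw [mul_div_cancel₀ _ hε.1.ne'] at hΓ
    refine ((hdata ε hε).sqrt_energy_div_le hT hΓ).trans ?_
    have : T / 2 ≤ T * β / 2 := by nlinarith
    gcongr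
  · obtain ⟨G, hG⟩ := exists_source_bound hf htε hlim hφ hT
    obtain ⟨G', hG'⟩ := exists_source_bound hf htε hlim hφ zero_le_one
    set E₀ : ℝ := ‖w₁‖ ^ 2 + (1 + Real.exp 1) * (4 * C + 64) +
      (‖w₁‖ + 1 / 2 + Real.exp 1 * (4 * C + 64)) * √G' + 2 * G' with hE₀
    refine ⟨(√E₀ + (√2 + √(T / 2)) * √G) ^ 2, fun ε hε t ht => ?_⟩
    have hd := hdata ε hε
    have hε0 := hε.1
    -- The source bound holds at the rescaled time 1/ε ≥ 1, and monotonicity of the mass brings it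
    -- down to time 1, where the initial energy is estimated.
    have hm1 : ε * (sourceMass (φ ε) 1).toReal ≤ G' := by
      refine le_trans ?_ (hG' ε hε)
      have h2 := ENNReal.toReal_mono (hd.mass (1 / ε) (by positivity))
        (sourceMass_mono hd.source.1 zero_le_one (one_le_one_div hε0 hε.2.le))
      gcongr
    have hmt : ε * (sourceMass (φ ε) (t / ε)).toReal ≤ G := by
      refine le_trans ?_ (hG ε hε)
      have h2 := ENNReal.toReal_mono (hd.mass (T / ε) (div_nonneg hT hε0.le))
        (sourceMass_mono hd.source.1 (div_nonneg ht.1 hε0.le)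
          (div_le_div_of_nonneg_right ht.2 hε0.le))
      gcongr
    rw [hE ε hε _ (div_nonneg ht.1 hε0.le), ← Real.sqrt_le_left (by positivity)]
    refine (hd.sqrt_energy_div_le ht.1 hmt).trans ?_
    have h3 := hd.energy_zero_le hε.2 (hlevel ε hε).2 hm1
    have h4 : ε * 2 ≤ 2 := by linarith [hε.2]
    have h5 : t / 2 ≤ T / 2 := by linarith [ht.2]
    gcongr
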